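/- Let $d\ge 1$, let $\mathbb{T}^d=(\mathbb{R}/2\pi\mathbb{Z})^d$ and $L^2_0(\mathbb{T}^d)=\{\theta\in L^2(\mathbb{T}^d):\int\theta\,dx=0\}$. Let $u\in L^\infty_{loc}([0,\infty)\times\mathbb{T}^d;\mathbb{R}^d)$ with $\nabla\cdot u=0$. For a locally bounded divergence-free flow $v$ on a time interval and $\nu\ge 0$, let $\Phi^{v,\nu}_{s,t}:L^2_0(\mathbb{T}^d)\to L^2_0(\mathbb{T}^d)$ be the solution operator, from time $s$ to time $t$, of $\partial_t\theta-\nu\Delta\theta+v\cdot\nabla\theta=0$ (for $\nu=0$ it is used only for flows that are smooth in $x$). Put $$\tau^u(\nu)=\sup_{s\ge 0}\,\inf\{t-s:\ t\ge s,\ \|\Phi^{u,\nu}_{s,t}\|_{L^2_0\to L^2_0}\le \tfrac12\},\qquad f(a)=\sup_{0\le b\le a} b\,\tau^u(b),\qquad f^{-1}(y)=\sup\{a\ge 0: f(a)\le y\}.$$ For an increasing smooth diffeomorphism $\sigma:[0,1)\to[0,\infty)$ put $u_\sigma(t,x)=\sigma'(t)\,u(\sigma(t),x)$, and call $u_\sigma$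 totally diffusive if $\Phi^{u_\sigma,\nu}_{s,1}\theta_0=0$, that is $\Phi^{u_\sigma,\nu}_{s,t}\theta_0\to 0$ in $L^2$ as $t\to 1$, for all $\nu>0$, $s\in[0,1)$ and $\theta_0\in L^2_0(\mathbb{T}^d)$. 1. Suppose that $u$ is relaxation enhancing, that is $\nu\tau^u(\nu)\to 0$ as $\nu\to 0$, and let $X$ be a Banach space of (classes of) functions $\mathbb{T}^d\to\mathbb{R}^d$. Then $0<f^{-1}\big(\tfrac{1-t}{4(|\log_2(1-t)|+1)}\big)<\infty$ for all $t\in[0,1)$, and there is an increasing smooth diffeomorphism $\sigma:[0,1)\to[0,\infty)$ such that $u_\sigma$ is totally diffusive and $$\left\|\frac{f^{-1}\Big(\frac{1-t}{4(|\log_2(1-t)|+1)}\Big)}{2(|\log_2(1-t)|+1)}\,u_\sigma(t)\right\|_{L^\infty([0,1],X)}\le\|u\|_{L^\infty([0,\infty),X)},$$ where the right-hand side is $\infty$ if $u\notin L^\infty([0,\infty),X)$. 2. Suppose that $u\in L^\infty([0,\infty),C^\infty(\mathbb{T}^d))$, that is, every $C^k$ norm of $u(t)$ is essentially bounded over $t\geq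 0$, and that $u$ is exponentially mixing: for some $K,p>0$, $$\|\Phi^{u,0}_{s,t}\theta_0\|_{\dot H^{-1}(\mathbb{T}^d)}\le K e^{-(t-s)^p/K}\|\theta_0\|_{H^1(\mathbb{T}^d)}\qquad\text{for all } 0\le s\le t \text{ and all } \theta_0\in L^2_0(\mathbb{T}^d)$$ (the right-hand side being $\infty$ if $\theta_0\notin H^1$; for a time-independent $u$ it is enough to have this for $s=0$). Then there is an increasing smooth diffeomorphism $\sigma:[0,1)\to[0,\infty)$ such that $u_\sigma$ is totally diffusive and $$\frac{1-t}{|\log_2(1-t)|^{2+2/p}+1}\,u_\sigma(t)\in L^\infty([0,1],C^\infty(\mathbb{T}^d)).$$ -/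

import Mathlib

open Set Filter Topology MeasureTheory
open scoped ENNReal

namespace AcceleratedFlow

instance factTwoPiPos : Fact (0 < 2 * Real.pi) := ⟨Real.two_pi_pos⟩

/-- The torus `(ℝ / 2πℤ)^d`, with Lebesgue measure `volume` of total mass `(2π)^d`. -/
noncomputable abbrev Torus (d : ℕ) : Type := Fin d → AddCircle (2 * Real.pi)

/-- Euclidean space `ℝ^d`. -/
abbrev Vec (d : ℕ) : Type := EuclideanSpace ℝ (Fin d)

/-- `L²(𝕋^d)`, real valued. -/
abbrev L2 (d : ℕ) : Type := Lp ℝ 2 (volume : Measure (Torus d))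

/-- `L²_0(𝕋^d)`: the elements of `L²` of mean zero. -/
def L20 (d : ℕ) : Set (L2 d) := {θ | ∫ x, θ x = 0}

/-- A function on the torus read as a periodic function on `ℝ^d`. -/
noncomputable def lift {d : ℕ} {F : Type*} (g : Torus d → F) : Vec d → F :=
  fun y => g (fun i => ((y i : ℝ) : AddCircle (2 * Real.pi)))

/-- `g ∈ C^∞(𝕋^d; F)`. -/
def IsSmooth {d : ℕ} {F : Type*} [NormedAddCommGroup F] [NormedSpace ℝ F]
    (g : Torus d → F) : Prop :=
  ContDiff ℝ ((⊤ : ℕ∞) : WithTop ℕ∞) (lift g)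

/-- The partial derivative `∂_i φ`. -/
noncomputable def pderiv {d : ℕ} (i : Fin d) (φ : Torus d → ℝ) (x : Torus d) : ℝ :=
  deriv (fun h : ℝ => φ (x + Pi.single i (h : AddCircle (2 * Real.pi)))) 0

/-- The gradient `∇φ`. -/
noncomputable def grad {d : ℕ} (φ : Torus d → ℝ) (x : Torus d) : Vec d :=
  WithLp.toLp 2 (fun i => pderiv i φ x)

/-- The Laplacian `Δφ`. -/
noncomputable def lap {d : ℕ} (φ : Torus d → ℝ) (x : Torus d) : ℝ :=
  ∑ i, pderiv i (pderiv i φ) x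

/-- `u ∈ L^∞_loc([0,∞) × 𝕋^d; ℝ^d)` with `∇ · u = 0` in the sense of distributions. -/
structure IsFlow {d : ℕ} (u : ℝ → Torus d → Vec d) : Prop where
  measurable : AEStronglyMeasurable (fun z : ℝ × Torus d => u z.1 z.2)
    ((volume.restrict (Ici (0 : ℝ))).prod volume)
  locallyBounded : ∀ T : ℝ, ∃ M : ℝ,
    ∀ᵐ z ∂((volume.restrict (Icc (0 : ℝ) T)).prod (volume : Measure (Torus d))),
      ‖u z.1 z.2‖ ≤ M
  divergenceFree : ∀ φ : Torus d → ℝ, IsSmooth φ →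
    ∀ᵐ t ∂(volume.restrict (Ici (0 : ℝ))), ∫ x, inner ℝ (u t x) (grad φ x) = 0

/-- `θ` is a solution on the time interval `J`, whose left end is `s ∈ J`, of
`∂_t θ - ν Δθ + u · ∇θ = 0`, `θ(s) = θ₀`: it is continuous in time with values in `L²` and solves
the equation weakly against all smooth functions. For a bounded divergence-free `u`, if `ν > 0`,
or if `ν = 0` and `u` is smooth in space, there is exactly one such `θ` on `J`, so that
`θ(t)` is the value `Φ_{s,t}^{u,ν} θ₀` of the solution operator. -/
structure IsSolution {d : ℕ} (u : ℝ → Torus d → Vec d) (ν s : ℝ) (J : Set ℝ)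
    (θ₀ : L2 d) (θ : ℝ → L2 d) : Prop where
  continuousOn : ContinuousOn θ J
  initial : θ s = θ₀
  weak : ∀ φ : Torus d → ℝ, IsSmooth φ → ∀ t ∈ J,
    (∫ x, θ t x * φ x) - (∫ x, θ₀ x * φ x) =
      ∫ r in s..t, ∫ x, θ r x * (ν * lap φ x + inner ℝ (u r x) (grad φ x))

/-- `‖Φ_{s,t}^{u,ν}‖_{L²_0 → L²_0} ≤ c`. -/
def SolNormLE {d : ℕ} (u : ℝ → Torus d → Vec d) (ν s t c : ℝ) : Prop :=
  ∀ θ₀ ∈ L20 d, ∀ θ : ℝ → L2 d, IsSolution u ν s (Icc s t) θ₀ θ → ‖θ t‖ ≤ c * ‖θ₀‖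

/-- The dissipation time `τ^u(ν) ∈ [0,∞]`. -/
noncomputable def dissTime {d : ℕ} (u : ℝ → Torus d → Vec d) (ν : ℝ) : ℝ≥0∞ :=
  ⨆ s ∈ Ici (0 : ℝ), ⨅ t ∈ {t : ℝ | s ≤ t ∧ SolNormLE u ν s t (1 / 2)}, ENNReal.ofReal (t - s)

/-- `ν τ^u(ν) → 0` as `ν → 0`. -/
def RelaxationEnhancing {d : ℕ} (u : ℝ → Torus d → Vec d) : Prop :=
  Tendsto (fun ν : ℝ => ENNReal.ofReal ν * dissTime u ν) (𝓝[>] 0) (𝓝 0)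

/-- `f(a) = sup_{0 ≤ b ≤ a} b τ^u(b)`. -/
noncomputable def relaxFun {d : ℕ} (u : ℝ → Torus d → Vec d) (a : ℝ) : ℝ≥0∞ :=
  ⨆ b ∈ Icc (0 : ℝ) a, ENNReal.ofReal b * dissTime u b

/-- The inverse of the nondecreasing function `f`: `f⁻¹(y) = sup {a ≥ 0 : f(a) ≤ y}`. This is the
usual inverse wherever `f` is strictly increasing and continuous, and the largest of the
generalized inverses otherwise. -/
noncomputable def relaxInv {d : ℕ} (u : ℝ → Torus d → Vec d) (y : ℝ) : ℝ≥0∞ :=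
  ⨆ a ∈ {a : ℝ | 0 ≤ a ∧ relaxFun u a ≤ ENNReal.ofReal y}, ENNReal.ofReal a

/-- `σ : [0,1) → [0,∞)` is an increasing smooth diffeomorphism. -/
structure IsTimeChange (σ : ℝ → ℝ) : Prop where
  smooth : ContDiffOn ℝ ((⊤ : ℕ∞) : WithTop ℕ∞) σ (Ico 0 1)
  bijOn : BijOn σ (Ico 0 1) (Ici 0)
  deriv_pos : ∀ t ∈ Ico (0 : ℝ) 1, 0 < derivWithin σ (Ico 0 1) t

/-- The accelerated flow `u_σ(t,x) = σ'(t) u(σ(t),x)`, for `t ∈ [0,1)`. -/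
noncomputable def accel {d : ℕ} (u : ℝ → Torus d → Vec d) (σ : ℝ → ℝ) :
    ℝ → Torus d → Vec d :=
  fun t x => derivWithin σ (Ico 0 1) t • u (σ t) x

/-- Total dissipation at time `1` for every diffusivity: `Φ_{s,1}^{v,ν} θ₀ = 0` for all `ν > 0`,
`s ∈ [0,1)` and `θ₀ ∈ L²_0`. As `v` is only locally bounded on `[0,1)`, the value at time `1` is
the limit in `L²` of the solution on `[s,1)`. -/
def TotallyDiffusive {d : ℕ} (v : ℝ → Torus d → Vec d) : Prop :=
  ∀ ν : ℝ, 0 < ν → ∀ s ∈ Ico (0 : ℝ) 1, ∀ θ₀ ∈ L20 d,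
    (∃ θ : ℝ → L2 d, IsSolution v ν s (Ico s 1) θ₀ θ) ∧
    ∀ θ : ℝ → L2 d, IsSolution v ν s (Ico s 1) θ₀ θ → Tendsto θ (𝓝[<] 1) (𝓝 0)

/-- The norm of `v` in `L^∞(I, X)`, where `X` is a Banach space of (classes of) functions
`𝕋^d → ℝ^d`, embedded by `ι`; it is `∞` if `v` is not a strongly measurable function `I → X`. -/
noncomputable def linftyNorm {d : ℕ} {X : Type*} [NormedAddCommGroup X] [NormedSpace ℝ X]
    (ι : X →ₗ[ℝ] (Torus d →ₘ[(volume : Measure (Torus d))] Vec d)) (I : Set ℝ)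
    (v : ℝ → Torus d → Vec d) : ℝ≥0∞ :=
  ⨅ V ∈ {V : ℝ → X | AEStronglyMeasurable V (volume.restrict I) ∧
      ∀ᵐ t ∂(volume.restrict I), (ι (V t) : Torus d → Vec d) =ᵐ[volume] v t},
    eLpNorm V ∞ (volume.restrict I)

/-- For a jointly measurable `v`: `v ∈ L^∞(I, C^∞(𝕋^d))`, that is, every `C^k` norm of `v(t)` is
essentially bounded over `t ∈ I`. -/
def LinftySmooth {d : ℕ} (I : Set ℝ) (v : ℝ → Torus d → Vec d) : Prop :=
  (∀ᵐ t ∂(volume.restrict I), IsSmooth (v t)) ∧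
  ∀ k : ℕ, ∃ M : ℝ, ∀ᵐ t ∂(volume.restrict I),
    ∀ y : Vec d, ‖iteratedFDeriv ℝ k (lift (v t)) y‖ ≤ M

/-- The Fourier coefficient `(2π)^{-d} ∫ θ(x) e^{-i k · x} dx`. -/
noncomputable def fourierC {d : ℕ} (θ : L2 d) (k : Fin d → ℤ) : ℂ :=
  (((2 * Real.pi) ^ d)⁻¹ : ℝ) * ∫ x : Torus d, (θ x : ℂ) * ∏ i, fourier (-(k i)) (x i)

/-- `|k|²`. -/
def sqLen {d : ℕ} (k : Fin d → ℤ) : ℝ := ∑ i, (k i : ℝ) ^ 2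

/-- The norm of `H^1(𝕋^d)`, equal to `∞` outside `H^1`. -/
noncomputable def normH1 {d : ℕ} (θ : L2 d) : ℝ≥0∞ :=
  (∑' k : Fin d → ℤ,
    ENNReal.ofReal ((2 * Real.pi) ^ d * (1 + sqLen k)) * ‖fourierC θ k‖ₑ ^ 2) ^ (1 / 2 : ℝ)

/-- The homogeneous norm of `H^{-1}(𝕋^d)`. -/
noncomputable def normHneg1 {d : ℕ} (θ : L2 d) : ℝ≥0∞ :=
  (∑' k : {k : Fin d → ℤ // k ≠ 0},
    ENNReal.ofReal ((2 * Real.pi) ^ d / sqLen k.1) * ‖fourierC θ k.1‖ₑ ^ 2) ^ (1 / 2 : ℝ)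

/-- Exponential mixing, uniformly in the initial time:
`‖Φ_{s,t}^{u,0} θ₀‖_{Ḣ^{-1}} ≤ K exp(-(t-s)^p / K) ‖θ₀‖_{H^1}`. -/
def ExpMixing {d : ℕ} (u : ℝ → Torus d → Vec d) (K p : ℝ) : Prop :=
  ∀ s t : ℝ, 0 ≤ s → s ≤ t → ∀ θ₀ ∈ L20 d, ∀ θ : ℝ → L2 d,
    IsSolution u 0 s (Icc s t) θ₀ θ →
      normHneg1 (θ t) ≤ ENNReal.ofReal (K * Real.exp (-((t - s) ^ p) / K)) * normH1 θ₀

/-- `|log_2 (1-t)|`. -/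
noncomputable def absLog (t : ℝ) : ℝ := |Real.logb 2 (1 - t)|

end AcceleratedFlow

open AcceleratedFlow

/-! Suppose that `σ` has constant derivative `l n` on the second half of the dyadic interval from `1
- 2^(-n)` to `1 - 2^(-(n+1))`. Rescaling time there turns the accelerated equation with diffusivity
`ν` into the original one with diffusivity `ν / l n`, run for a time `l n * 2^(-(n+2))`. If the
dissipation time `τ(ν / l n)` is smaller than this, the `L²` norm is halved. If this happens for all
large `n`, whatever `ν > 0`, then the norm, which never increases, tends to `0` at time `1`: this is
`totallyDiffusive_accel`. The time change comes from `exists_isTimeChange`, and it remains to choose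
the rates `l n`.

For a relaxation enhancing flow put `y = 2^(-n) / (4 (n+1))`, `R = f⁻¹(y)` and `l n = 2 (n+1) / R`.
For large `n` the diffusivity `b = ν / l n` is below `R`, so `b τ(b) ≤ y`, while `b` times the
available time is `ν 2^(-n) / 4 > y`. A single Fourier mode moves with bounded speed, so `τ(b)` is
at least a constant times `1 / (b + M)`; this makes `f⁻¹(y)` finite and of order at most `y`
(`IsFlow.exists_relaxInv_le`), so that `l n` grows at least like `2^n` and `σ` reaches infinity.

For an exponentially mixing flow it suffices that `τ(ν)` is at most of order `|log ν|^(2/p)`; then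
`l n = 2^n (n+1)^(2+2/p)` works. The bound follows from `IsFlow.norm_sq_le_of_mixing`. If a solution
loses little energy over a time `3T`, its gradient is moderate at some time in the first and in the
last third, and the `H¹` estimate controls the time integral of the square of its Laplacian. Between
these two times it therefore stays close to the inviscid solution with the same data. That solution
is mixed, hence almost orthogonal to the viscous one, whose gradient is moderate at the end. Then
the viscous solution must be small, a contradiction. With `T^p = 2K |log ν|` one such step gains a
factor `1 - δ` with `δ` of order `1/T`, so order `T` steps of length `3T` suffice.

The equation is handled through coefficients in the real orthonormal basis of multiples of `cos(k·x)
+ sin(k·x)`. Differentiation multiplies by a component of `k` and replaces `k` by `-k`, which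
explains the index `-k` in `Drift`. The divergence condition becomes skewness of the transport
matrix. Weak solutions are exactly the solutions of the resulting system (`isSolution_iff`).
Existence (`Drift.exists_isMode`), the energy identity (`Drift.IsMode.energy`), the `H¹` estimate
and the inviscid limit are proved for that system. -/

namespace AcceleratedFlow

open scoped RealInnerProductSpace

/-! ### Evolution of coefficients -/

section

/-- Product rule for two functions given as integrals. -/
theorem mul_sub_mul_eq_integral {y z y' z' : ℝ → ℝ} {s T : ℝ}
    (hy' : IntervalIntegrable y' volume s T) (hz' : IntervalIntegrable z' volume s T)
    (hsT : s ≤ T)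
    (hy : ∀ t ∈ Icc s T, y t - y s = ∫ r in s..t, y' r)
    (hz : ∀ t ∈ Icc s T, z t - z s = ∫ r in s..t, z' r) {t : ℝ} (ht : t ∈ Icc s T) :
    y t * z t - y s * z s = ∫ r in s..t, (y' r * z r + y r * z' r) := by
  have hst : uIcc s t ⊆ uIcc s T := by
    rw [uIcc_of_le hsT, uIcc_of_le ht.1]; exact Icc_subset_Icc le_rfl ht.2
  have hy1 := hy'.mono_set hst
  have hz1 := hz'.mono_set hst
  -- The derivatives are merely integrable, so the product rule for absolutely continuous functions
  -- is applied to the primitives, which agree with `y` and `z` on `Icc s T`.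
  have key := AbsolutelyContinuousOnInterval.integral_deriv_mul_eq_sub
    (f := fun r => y s + ∫ q in s..r, y' q) (g := fun r => z s + ∫ q in s..r, z' q) (a := s) (b := t)
    ((LipschitzWith.const (y s)).lipschitzOnWith.absolutelyContinuousOnInterval.add
      (hy1.absolutelyContinuousOnInterval_intervalIntegral (by simp)))
    ((LipschitzWith.const (z s)).lipschitzOnWith.absolutelyContinuousOnInterval.add
      (hz1.absolutelyContinuousOnInterval_intervalIntegral (by simp)))
  have e1 : ∀ r ∈ Icc s T, y s + ∫ q in s..r, y' q = y r := fun r hr => by rw [← hy r hr]; ring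
  have e2 : ∀ r ∈ Icc s T, z s + ∫ q in s..r, z' q = z r := fun r hr => by rw [← hz r hr]; ring
  simp only [e1 t ht, e2 t ht, intervalIntegral.integral_same, add_zero] at key
  rw [← key]
  apply intervalIntegral.integral_congr_ae
  filter_upwards [hy1.ae_hasDerivAt_integral, hz1.ae_hasDerivAt_integral] with r h1 h2 hr
  have hr' : r ∈ uIcc s t := uIoc_subset_uIcc hr
  have hr2 : r ∈ Icc s T := by have := hst hr'; rwa [uIcc_of_le hsT] at this
  rw [((h1 hr' s (by simp)).const_add (y s)).deriv, ((h2 hr' s (by simp)).const_add (z s)).deriv,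
    e1 r hr2, e2 r hr2]

variable {d : ℕ} {H : Type*} [NormedAddCommGroup H] [InnerProductSpace ℝ H]

/-- The coefficients of `θ` in the basis `e` are the integrals of the functions `c k`. -/
structure Evolves (e : HilbertBasis (Fin d → ℤ) ℝ H) (c : (Fin d → ℤ) → ℝ → ℝ) (s T : ℝ)
    (θ : ℝ → H) : Prop where
  le : s ≤ T
  cont : ContinuousOn θ (Icc s T)
  int : ∀ k, IntervalIntegrable (c k) volume s T
  eq : ∀ k, ∀ t ∈ Icc s T, ⟪e k, θ t⟫ - ⟪e k, θ s⟫ = ∫ r in s..t, c k r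

namespace Evolves

variable {e : HilbertBasis (Fin d → ℤ) ℝ H} {c c' : (Fin d → ℤ) → ℝ → ℝ} {s T : ℝ} {θ θ' : ℝ → H}

theorem sub (h : Evolves e c s T θ) (h' : Evolves e c' s T θ') :
    Evolves e (fun k r => c k r - c' k r) s T (fun t => θ t - θ' t) := by
  refine ⟨h.le, h.cont.sub h'.cont, fun k => (h.int k).sub (h'.int k), fun k t ht => ?_⟩
  have hst : uIcc s t ⊆ uIcc s T := by
    rw [uIcc_of_le ht.1, uIcc_of_le (ht.1.trans ht.2)]; exact Icc_subset_Icc le_rfl ht.2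
  rw [intervalIntegral.integral_sub ((h.int k).mono_set hst) ((h'.int k).mono_set hst),
    ← h.eq k t ht, ← h'.eq k t ht, inner_sub_right, inner_sub_right]
  ring

theorem mono (h : Evolves e c s T θ) {a b : ℝ} (hsa : s ≤ a) (hab : a ≤ b) (hbT : b ≤ T) :
    Evolves e c a b θ := by
  have sub : Icc a b ⊆ Icc s T := Icc_subset_Icc hsa hbT
  have ii : ∀ k x y, x ∈ Icc s T → y ∈ Icc s T → IntervalIntegrable (c k) volume x y := by
    intro k x y hx hy
    refine (h.int k).mono_set ?_
    rw [uIcc_of_le (hx.1.trans hx.2)]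
    exact uIcc_subset_Icc hx hy
  have ha : a ∈ Icc s T := ⟨hsa, hab.trans hbT⟩
  have hs : s ∈ Icc s T := ⟨le_rfl, hsa.trans (hab.trans hbT)⟩
  refine ⟨hab, h.cont.mono sub, fun k => ii k a b ha ⟨hsa.trans hab, hbT⟩, fun k t ht => ?_⟩
  have h1 := h.eq k t (sub ht)
  have h2 := h.eq k a ha
  rw [← intervalIntegral.integral_add_adjacent_intervals (ii k s a hs ha) (ii k a t ha (sub ht))]
    at h1
  linarith

theorem congr (h : Evolves e c s T θ) (hc : ∀ k, ∀ r ∈ Icc s T, c k r = c' k r) :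
    Evolves e c' s T θ := by
  refine ⟨h.le, h.cont, fun k => ?_, fun k t ht => ?_⟩
  · refine (h.int k).congr fun r hr => hc k r ?_
    rw [uIoc_of_le h.le] at hr; exact Ioc_subset_Icc_self hr
  · rw [h.eq k t ht]
    refine intervalIntegral.integral_congr fun r hr => hc k r ?_
    rw [uIcc_of_le ht.1] at hr; exact ⟨hr.1, hr.2.trans ht.2⟩

theorem coeff_continuousOn (h : Evolves e c s T θ) (k) :
    ContinuousOn (fun r => ⟪e k, θ r⟫) (Icc s T) := continuousOn_const.inner h.cont

theorem intervalIntegrable_mul (h : Evolves e c s T θ) (k) :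
    IntervalIntegrable (fun r => ⟪e k, θ r⟫ * c k r) volume s T :=
  (h.int k).continuousOn_mul (by rw [uIcc_of_le h.le]; exact h.coeff_continuousOn k)

theorem sq_sub_sq (h : Evolves e c s T θ) (k) {t : ℝ} (ht : t ∈ Icc s T) :
    ⟪e k, θ t⟫ ^ 2 - ⟪e k, θ s⟫ ^ 2 = 2 * ∫ r in s..t, ⟪e k, θ r⟫ * c k r := by
  rw [sq, sq, mul_sub_mul_eq_integral (h.int k) (h.int k) (ht.1.trans ht.2) (h.eq k) (h.eq k) ht,
    ← intervalIntegral.integral_const_mul]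
  exact intervalIntegral.integral_congr fun r _ => by ring

/-- Weighted energy identity. -/
theorem hasSum_energy (h : Evolves e c s T θ) (m : (Fin d → ℤ) → ℝ)
    (hs : Summable fun k => m k * ⟪e k, θ s⟫ ^ 2)
    (hsum : Summable fun k => ∫ r in s..T, |m k * (⟪e k, θ r⟫ * c k r)|) {t : ℝ}
    (ht : t ∈ Icc s T) :
    HasSum (fun k => m k * ⟪e k, θ t⟫ ^ 2)
      ((∑' k, m k * ⟪e k, θ s⟫ ^ 2) + 2 * ∫ r in s..t, ∑' k, m k * (⟪e k, θ r⟫ * c k r)) := by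
  have hint : ∀ k, IntegrableOn (fun r => m k * (⟪e k, θ r⟫ * c k r)) (Ioc s T) := fun k =>
    ((intervalIntegrable_iff_integrableOn_Ioc_of_le h.le).1 (h.intervalIntegrable_mul k)).const_mul _
  have hsub : Ioc s t ⊆ Ioc s T := Ioc_subset_Ioc_right ht.2
  have h1 : HasSum (fun k => ∫ r in s..t, m k * (⟪e k, θ r⟫ * c k r))
      (∫ r in s..t, ∑' k, m k * (⟪e k, θ r⟫ * c k r)) := by
    simp only [intervalIntegral.integral_of_le ht.1]
    refine hasSum_integral_of_summable_integral_norm (fun k => (hint k).mono_set hsub) ?_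
    refine Summable.of_nonneg_of_le (fun k => by positivity) (fun k => ?_) hsum
    rw [intervalIntegral.integral_of_le h.le]
    exact setIntegral_mono_set (hint k).norm (ae_of_all _ fun r => norm_nonneg _)
      (LE.le.eventuallyLE hsub)
  convert hs.hasSum.add (h1.mul_left 2) using 2 with k
  rw [intervalIntegral.integral_const_mul]
  have := h.sq_sub_sq k ht
  linear_combination m k * this

end Evolves

end

/-! ### Drifts -/

section

/-- Tonelli: the sum of the absolute values has finite integral, hence is finite almost everywhere.
Applied to dissipation terms, it puts a solution in `H¹` or `H²` at almost every time. -/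
theorem ae_summable_of_summable_integral {α ι : Type*} [Countable ι] [MeasurableSpace α]
    {μ : Measure α} {f : ι → α → ℝ} (hf : ∀ i, Integrable (f i) μ)
    (hs : Summable fun i => ∫ a, |f i a| ∂μ) :
    (∀ᵐ a ∂μ, Summable fun i => f i a) ∧ Integrable (fun a => ∑' i, f i a) μ := by
  have h0 : ∑' i, ∫⁻ a, ‖f i a‖ₑ ∂μ ≠ ∞ := by
    have (i : ι) : ∫⁻ a, ‖f i a‖ₑ ∂μ = ENNReal.ofReal (∫ a, |f i a| ∂μ) :=
      (ofReal_integral_norm_eq_lintegral_enorm (hf i)).symm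
    simp only [this]
    rw [← ENNReal.ofReal_tsum_of_nonneg (fun i => integral_nonneg fun a => abs_nonneg _) hs]
    exact ENNReal.ofReal_ne_top
  rw [← lintegral_tsum fun i => (hf i).1.enorm] at h0
  have h1 : ∀ᵐ a ∂μ, Summable fun i => f i a := by
    filter_upwards [ae_lt_top' (AEMeasurable.tsum fun i => (hf i).1.enorm) h0] with a ha
    exact Summable.of_enorm ha.ne
  refine ⟨h1, ?_, ?_⟩
  · refine aestronglyMeasurable_of_tendsto_ae (u := (atTop : Filter (Finset ι)))
      (f := fun A a => ∑ i ∈ A, f i a) (fun A => ?_) ?_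
    · exact Finset.aestronglyMeasurable_fun_sum A fun i _ => (hf i).1
    · filter_upwards [h1] with a ha using ha.hasSum
  · refine lt_of_le_of_lt (lintegral_mono fun a => ?_) h0.lt_top
    exact enorm_tsum_le_tsum_enorm

theorem summable_of_sum_integral_le {α ι : Type*} [MeasurableSpace α] {μ : Measure α}
    {f : ι → α → ℝ} (hf : ∀ i, Integrable (f i) μ) (hf0 : ∀ i a, 0 ≤ f i a) {C : ℝ}
    (hC : ∀ A : Finset ι, ∫ a, ∑ i ∈ A, f i a ∂μ ≤ C) :
    Summable fun i => ∫ a, |f i a| ∂μ := by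
  refine summable_of_sum_le (c := C) (fun i => integral_nonneg fun a => abs_nonneg _) fun A => ?_
  refine le_of_eq_of_le ?_ (hC A)
  rw [integral_finsetSum _ fun i _ => hf i]
  exact Finset.sum_congr rfl fun i _ => by simp only [abs_of_nonneg (hf0 i _)]

variable {d : ℕ} {H : Type*} [NormedAddCommGroup H] [InnerProductSpace ℝ H]

theorem sqLen_nonneg (k : Fin d → ℤ) : 0 ≤ sqLen k := Finset.sum_nonneg fun _ _ => sq_nonneg _

theorem hasSum_inner_sq (e : HilbertBasis (Fin d → ℤ) ℝ H) (x : H) :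
    HasSum (fun k => ⟪e k, x⟫ ^ 2) (‖x‖ ^ 2) := by
  have := e.hasSum_inner_mul_inner x x
  rw [real_inner_self_eq_norm_sq] at this
  have h : (fun k => ⟪e k, x⟫ ^ 2) = fun k => ⟪x, e k⟫ * ⟪e k, x⟫ :=
    funext fun k => by rw [real_inner_comm, sq]
  rwa [h]

/-- Truncation of an expansion. -/
noncomputable def trunc (e : HilbertBasis (Fin d → ℤ) ℝ H) (A : Finset (Fin d → ℤ)) (x : H) : H :=
  ∑ k ∈ A, ⟪e k, x⟫ • e k

theorem tendsto_trunc (e : HilbertBasis (Fin d → ℤ) ℝ H) (x : H) :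
    Tendsto (fun A => trunc e A x) atTop (𝓝 x) := by
  have := e.hasSum_repr x
  simp only [e.repr_apply_apply] at this
  exact this

theorem inner_trunc (e : HilbertBasis (Fin d → ℤ) ℝ H) (A : Finset (Fin d → ℤ)) (x : H)
    (k : Fin d → ℤ) : ⟪e k, trunc e A x⟫ = if k ∈ A then ⟪e k, x⟫ else 0 := by
  have h := e.orthonormal
  rw [orthonormal_iff_ite] at h
  simp [trunc, inner_sum, inner_smul_right, h]

/-- The operators of multiplication by the components of a time dependent velocity field, of
size at most `M`; the last property expresses that the field is divergence free. -/
structure Drift (e : HilbertBasis (Fin d → ℤ) ℝ H) where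
  B : ℝ → Fin d → H →L[ℝ] H
  M : ℝ
  M_nonneg : 0 ≤ M
  bound : ∀ r x, ∑ j, ‖B r j x‖ ^ 2 ≤ M ^ 2 * ‖x‖ ^ 2
  meas : ∀ j x y, AEStronglyMeasurable (fun r => ⟪y, B r j x⟫) volume
  skew : ∀ r k l, ∑ j, (k j : ℝ) * ⟪e (-k), B r j (e l)⟫ = -∑ j, (l j : ℝ) * ⟪e (-l), B r j (e k)⟫

namespace Drift

variable {e : HilbertBasis (Fin d → ℤ) ℝ H} (S : Drift e)

/-- The coefficients of the transport term. -/
noncomputable def F (r : ℝ) (k : Fin d → ℤ) : H →L[ℝ] ℝ :=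
  ∑ j, (k j : ℝ) • (innerSL ℝ (e (-k))).comp (S.B r j)

/-- The squared length of the `k`-th coefficient of the flux. -/
noncomputable def G (r : ℝ) (k : Fin d → ℤ) (x : H) : ℝ := ∑ j, ⟪e (-k), S.B r j x⟫ ^ 2

theorem F_apply (r k x) : S.F r k x = ∑ j, (k j : ℝ) * ⟪e (-k), S.B r j x⟫ := by
  simp [F]

theorem G_nonneg (r k x) : 0 ≤ S.G r k x := Finset.sum_nonneg fun _ _ => sq_nonneg _

/-- Cauchy-Schwarz over the components separates the derivative, which costs `sqLen k`, from the
flux coefficients, which are summable in `k` by Parseval. -/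
theorem F_sq_le (r k x) : S.F r k x ^ 2 ≤ sqLen k * S.G r k x := by
  rw [F_apply]; exact Finset.sum_mul_sq_le_sq_mul_sq _ _ _

theorem hasSum_G (r x) : HasSum (fun k => S.G r k x) (∑ j, ‖S.B r j x‖ ^ 2) :=
  hasSum_sum fun j _ => (Equiv.neg (Fin d → ℤ)).hasSum_iff.2 (hasSum_inner_sq e (S.B r j x))

theorem sum_G_le (r x) (A : Finset (Fin d → ℤ)) : ∑ k ∈ A, S.G r k x ≤ S.M ^ 2 * ‖x‖ ^ 2 :=
  (sum_le_hasSum A (fun k _ => S.G_nonneg r k x) (S.hasSum_G r x)).trans (S.bound r x)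

theorem G_le (r k x) : S.G r k x ≤ S.M ^ 2 * ‖x‖ ^ 2 := by
  simpa using S.sum_G_le r x {k}

theorem F_skew (r k l) : S.F r k (e l) = -S.F r l (e k) := by
  rw [F_apply, F_apply, S.skew]

/-- The transport term is in divergence form: Cauchy-Schwarz over the pairs `(k, j)` puts the
derivative on `a`, so that `x` enters only through its `L²` norm. -/
theorem sum_mul_F_sq_le (r : ℝ) (x : H) (a : (Fin d → ℤ) → ℝ) (A : Finset (Fin d → ℤ)) :
    (∑ k ∈ A, a k * S.F r k x) ^ 2 ≤ (∑ k ∈ A, sqLen k * a k ^ 2) * (S.M ^ 2 * ‖x‖ ^ 2) := by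
  have h1 : ∑ k ∈ A, a k * S.F r k x =
      ∑ p ∈ A ×ˢ Finset.univ, (a p.1 * p.1 p.2) * ⟪e (-p.1), S.B r p.2 x⟫ := by
    rw [Finset.sum_product]
    refine Finset.sum_congr rfl fun k _ => ?_
    rw [F_apply, Finset.mul_sum]
    exact Finset.sum_congr rfl fun j _ => by ring
  have h2 : ∑ p ∈ A ×ˢ Finset.univ, (a p.1 * (p.1 p.2 : ℤ)) ^ 2 = ∑ k ∈ A, sqLen k * a k ^ 2 := by
    rw [Finset.sum_product]
    refine Finset.sum_congr rfl fun k _ => ?_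
    rw [sqLen, Finset.sum_mul]
    exact Finset.sum_congr rfl fun j _ => by ring
  have h3 : ∑ p ∈ A ×ˢ Finset.univ, ⟪e (-p.1), S.B r p.2 x⟫ ^ 2 = ∑ k ∈ A, S.G r k x := by
    rw [Finset.sum_product]; rfl
  rw [h1, ← h2]
  refine (Finset.sum_mul_sq_le_sq_mul_sq _ _ _).trans ?_
  rw [h3]
  exact mul_le_mul_of_nonneg_left (S.sum_G_le r x A) (Finset.sum_nonneg fun _ _ => sq_nonneg _)

theorem F_trunc (r k A x) : S.F r k (trunc e A x) = ∑ l ∈ A, ⟪e l, x⟫ * S.F r k (e l) := by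
  simp [trunc, map_sum]

/-- Integration by parts for trigonometric polynomials: both sides are finite double sums, exchanged
term by term through `F_skew`. -/
theorem sum_F_trunc_skew (r : ℝ) (A : Finset (Fin d → ℤ)) (x : H) (K : Finset (Fin d → ℤ))
    (y : H) : ∑ k ∈ K, ⟪e k, y⟫ * S.F r k (trunc e A x) =
      -∑ l ∈ A, ⟪e l, x⟫ * S.F r l (trunc e K y) := by
  simp only [F_trunc, Finset.mul_sum]
  rw [Finset.sum_comm, ← Finset.sum_neg_distrib]
  refine Finset.sum_congr rfl fun l _ => ?_
  rw [← Finset.sum_neg_distrib]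
  refine Finset.sum_congr rfl fun k _ => ?_
  rw [S.F_skew r k l]; ring

theorem summable_mul_F (r : ℝ) {x : H} (hx : Summable fun k => sqLen k * ⟪e k, x⟫ ^ 2) (y : H) :
    Summable fun k => ⟪e k, x⟫ * S.F r k y := by
  refine Summable.of_norm_bounded (g := fun k => sqLen k * ⟪e k, x⟫ ^ 2 + S.G r k y)
    (hx.add (S.hasSum_G r y).summable) fun k => ?_
  rw [Real.norm_eq_abs]
  have h := S.F_sq_le r k y
  have h0 := sqLen_nonneg k
  have h1 := S.G_nonneg r k y
  have h2 : (⟪e k, x⟫ * S.F r k y) ^ 2 ≤ (sqLen k * ⟪e k, x⟫ ^ 2) * S.G r k y := by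
    nlinarith [sq_nonneg ⟪e k, x⟫]
  refine abs_le_of_sq_le_sq (h2.trans ?_) (by positivity)
  have h3 : 0 ≤ sqLen k * ⟪e k, x⟫ ^ 2 := by positivity
  nlinarith [mul_nonneg h3 h1]

/-- The transport term does not contribute to the energy. -/
theorem tsum_mul_F_self (r : ℝ) {x : H} (hx : Summable fun k => sqLen k * ⟪e k, x⟫ ^ 2) :
    ∑' k, ⟪e k, x⟫ * S.F r k x = 0 := by
  refine tendsto_nhds_unique (f := fun A : Finset (Fin d → ℤ) => ∑ k ∈ A, ⟪e k, x⟫ * S.F r k x)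
    (l := atTop) (S.summable_mul_F r hx x).hasSum ?_
  set C := ∑' k, sqLen k * ⟪e k, x⟫ ^ 2
  -- A truncation paired with its own transport term gives zero by skewness. What is left involves
  -- `x - trunc e A x`, which is small in `L²`, against a factor bounded by the `H¹` seminorm.
  have h1 : ∀ A, |∑ k ∈ A, ⟪e k, x⟫ * S.F r k x| ≤ √(C * S.M ^ 2) * ‖x - trunc e A x‖ := by
    intro A
    have h0 : ∑ k ∈ A, ⟪e k, x⟫ * S.F r k (trunc e A x) = 0 := by
      have := S.sum_F_trunc_skew r A x A x; linarith
    have h2 : ∑ k ∈ A, ⟪e k, x⟫ * S.F r k x = ∑ k ∈ A, ⟪e k, x⟫ * S.F r k (x - trunc e A x) := by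
      simp only [map_sub, mul_sub, Finset.sum_sub_distrib, h0, sub_zero]
    rw [h2]
    have hC : ∑ k ∈ A, sqLen k * ⟪e k, x⟫ ^ 2 ≤ C :=
      hx.sum_le_tsum _ fun k _ => mul_nonneg (sqLen_nonneg k) (sq_nonneg _)
    have hC0 : 0 ≤ C := tsum_nonneg fun k => mul_nonneg (sqLen_nonneg k) (sq_nonneg _)
    refine abs_le_of_sq_le_sq ((S.sum_mul_F_sq_le r _ _ A).trans ?_) (by positivity)
    rw [mul_pow, Real.sq_sqrt (by positivity)]
    calc _ ≤ C * (S.M ^ 2 * ‖x - trunc e A x‖ ^ 2) := by gcongr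
      _ = _ := by ring
  refine squeeze_zero_norm h1 ?_
  have h3 : Tendsto (fun A => ‖x - trunc e A x‖) atTop (𝓝 0) := by
    simpa using ((tendsto_const_nhds (x := x)).sub (tendsto_trunc e x)).norm
  simpa using h3.const_mul (√(C * S.M ^ 2))

/-- For `x` in `H¹` the transport term is in `L²`. -/
theorem sum_F_sq_le (r : ℝ) {x : H} (hx : Summable fun k => sqLen k * ⟪e k, x⟫ ^ 2)
    (K : Finset (Fin d → ℤ)) :
    ∑ k ∈ K, S.F r k x ^ 2 ≤ S.M ^ 2 * ∑' k, sqLen k * ⟪e k, x⟫ ^ 2 := by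
  set C := ∑' k, sqLen k * ⟪e k, x⟫ ^ 2
  have h1 : ∀ A, ∑ k ∈ K, S.F r k (trunc e A x) ^ 2 ≤ S.M ^ 2 * C := by
    intro A
    -- Duality: `y` has the transport coefficients themselves as coefficients. Moving the transport
    -- onto `y` puts the derivative on `x` and yields `‖y‖⁴ ≤ C M² ‖y‖²`.
    set y : H := ∑ k ∈ K, S.F r k (trunc e A x) • e k
    have ho := e.orthonormal
    rw [orthonormal_iff_ite] at ho
    have hy : ∀ k ∈ K, ⟪e k, y⟫ = S.F r k (trunc e A x) := by
      intro k hk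
      simp [y, inner_sum, inner_smul_right, ho, hk]
    have hyt : trunc e K y = y := Finset.sum_congr rfl fun k hk => by rw [hy k hk]
    have hn : ‖y‖ ^ 2 = ∑ k ∈ K, S.F r k (trunc e A x) ^ 2 := by
      rw [← real_inner_self_eq_norm_sq]
      conv_lhs => rw [show y = ∑ k ∈ K, S.F r k (trunc e A x) • e k from rfl]
      rw [sum_inner]
      refine Finset.sum_congr rfl fun k hk => ?_
      rw [real_inner_smul_left, hy k hk, sq]
    have h2 := S.sum_F_trunc_skew r A x K y
    rw [Finset.sum_congr rfl fun k hk => by rw [hy k hk, ← sq], ← hn, hyt] at h2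
    have h3 := S.sum_mul_F_sq_le r y (fun l => ⟪e l, x⟫) A
    have h4 : (‖y‖ ^ 2) ^ 2 ≤ C * (S.M ^ 2 * ‖y‖ ^ 2) := by
      refine le_trans (le_of_eq (by rw [h2, neg_sq])) (h3.trans ?_)
      exact mul_le_mul_of_nonneg_right
        (hx.sum_le_tsum _ fun k _ => mul_nonneg (sqLen_nonneg k) (sq_nonneg _))
        (mul_nonneg (sq_nonneg _) (sq_nonneg _))
    rw [← hn]
    rcases (sq_nonneg ‖y‖).eq_or_lt with h | h
    · rw [← h]
      exact mul_nonneg (sq_nonneg _) (tsum_nonneg fun k => mul_nonneg (sqLen_nonneg k) (sq_nonneg _))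
    · nlinarith
  refine le_of_tendsto' (x := atTop) (f := fun A => ∑ k ∈ K, S.F r k (trunc e A x) ^ 2) ?_ h1
  refine tendsto_finsetSum _ fun k _ => ?_
  exact (((S.F r k).continuous.tendsto x).comp (tendsto_trunc e x)).pow 2

/-- The bilinear form of the transport term on `H¹`, bounded as for a velocity with gradient at
most `L`. -/
def GradBound (L r : ℝ) : Prop :=
  ∀ (x : H) (A : Finset (Fin d → ℤ)),
    ∑ k ∈ A, sqLen k * ⟪e k, x⟫ * S.F r k (trunc e A x) ≤ L * ∑ k ∈ A, sqLen k * ⟪e k, x⟫ ^ 2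

/-- `GradBound` speaks of truncations. The error of truncating the argument of `F` is paired with
the `H²` weight of `x`, and by `sum_F_sq_le` it is controlled by the `H¹` tail of `x`, which tends
to `0`. -/
theorem tsum_sqLen_mul_F_le {L r : ℝ} (hL : S.GradBound L r) (hL0 : 0 ≤ L) {x : H}
    (hx : Summable fun k => sqLen k * ⟪e k, x⟫ ^ 2)
    (hx2 : Summable fun k => sqLen k * (sqLen k * ⟪e k, x⟫ ^ 2))
    (hs : Summable fun k => sqLen k * (⟪e k, x⟫ * S.F r k x)) :
    ∑' k, sqLen k * (⟪e k, x⟫ * S.F r k x) ≤ L * ∑' k, sqLen k * ⟪e k, x⟫ ^ 2 := by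
  classical
  set D := ∑' k, sqLen k * ⟪e k, x⟫ ^ 2
  set C := ∑' k, sqLen k * (sqLen k * ⟪e k, x⟫ ^ 2)
  have hC0 : 0 ≤ C := tsum_nonneg fun k =>
    mul_nonneg (sqLen_nonneg k) (mul_nonneg (sqLen_nonneg k) (sq_nonneg _))
  have h1 : ∀ A : Finset (Fin d → ℤ), ∑ k ∈ A, sqLen k * (⟪e k, x⟫ * S.F r k x) ≤
      L * D + √(C * (S.M ^ 2 * (D - ∑ k ∈ A, sqLen k * ⟪e k, x⟫ ^ 2))) := by
    intro A
    have hd : ∀ k, ⟪e k, x - trunc e A x⟫ = if k ∈ A then 0 else ⟪e k, x⟫ := by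
      intro k
      rw [inner_sub_right, inner_trunc]
      split_ifs <;> simp
    have hfin : HasSum (fun k => sqLen k * ⟪e k, x - trunc e A x⟫ ^ 2)
        (D - ∑ k ∈ A, sqLen k * ⟪e k, x⟫ ^ 2) := by
      have hf : HasSum (fun k => if k ∈ A then sqLen k * ⟪e k, x⟫ ^ 2 else 0)
          (∑ k ∈ A, sqLen k * ⟪e k, x⟫ ^ 2) := by
        have := hasSum_sum_of_ne_finset_zero (s := A) (L := SummationFilter.unconditional _)
          (f := fun k => if k ∈ A then sqLen k * ⟪e k, x⟫ ^ 2 else 0) (fun k hk => by simp [hk])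
        convert this using 1
        exact Finset.sum_congr rfl fun k hk => by simp [hk]
      have h : (fun k => sqLen k * ⟪e k, x - trunc e A x⟫ ^ 2) = fun k =>
          sqLen k * ⟪e k, x⟫ ^ 2 - if k ∈ A then sqLen k * ⟪e k, x⟫ ^ 2 else 0 :=
        funext fun k => by rw [hd]; split_ifs <;> simp
      rw [h]
      exact hx.hasSum.sub hf
    have h2 : ∑ k ∈ A, sqLen k * (⟪e k, x⟫ * S.F r k x) =
        ∑ k ∈ A, sqLen k * ⟪e k, x⟫ * S.F r k (trunc e A x) +
          ∑ k ∈ A, sqLen k * ⟪e k, x⟫ * S.F r k (x - trunc e A x) := by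
      rw [← Finset.sum_add_distrib]
      refine Finset.sum_congr rfl fun k _ => ?_
      rw [map_sub]; ring
    rw [h2]
    refine add_le_add ((hL x A).trans ?_) ?_
    · gcongr
      exact hx.sum_le_tsum _ fun k _ => mul_nonneg (sqLen_nonneg k) (sq_nonneg _)
    · refine Real.le_sqrt_of_sq_le ((Finset.sum_mul_sq_le_sq_mul_sq _ _ _).trans ?_)
      refine mul_le_mul ?_ ?_ (Finset.sum_nonneg fun _ _ => sq_nonneg _) hC0
      · rw [Finset.sum_congr rfl fun k _ =>
          show (sqLen k * ⟪e k, x⟫) ^ 2 = sqLen k * (sqLen k * ⟪e k, x⟫ ^ 2) by ring]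
        exact hx2.sum_le_tsum _ fun k _ =>
          mul_nonneg (sqLen_nonneg k) (mul_nonneg (sqLen_nonneg k) (sq_nonneg _))
      · rw [← hfin.tsum_eq]
        exact S.sum_F_sq_le r hfin.summable A
  refine le_of_tendsto_of_tendsto' (b := atTop) hs.hasSum (?_ : Tendsto _ atTop (𝓝 (L * D))) h1
  have h3 : Tendsto (fun A : Finset (Fin d → ℤ) => D - ∑ k ∈ A, sqLen k * ⟪e k, x⟫ ^ 2) atTop
      (𝓝 0) := by
    have := (tendsto_const_nhds (x := D)).sub hx.hasSum
    rwa [sub_self] at this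
  have h4 := ((h3.const_mul (S.M ^ 2)).const_mul C).sqrt.const_add (L * D)
  simpa using h4

end Drift

end

/-! ### Solutions of the system for the coefficients -/

section

variable {d : ℕ} {H : Type*} [NormedAddCommGroup H] [InnerProductSpace ℝ H]

/-- Membership in `H¹`. -/
def IsH1 (e : HilbertBasis (Fin d → ℤ) ℝ H) (x : H) : Prop :=
  Summable fun k => sqLen k * ⟪e k, x⟫ ^ 2

/-- Membership in `H²`. -/
def IsH2 (e : HilbertBasis (Fin d → ℤ) ℝ H) (x : H) : Prop :=
  Summable fun k => sqLen k * (sqLen k * ⟪e k, x⟫ ^ 2)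

/-- `‖∇x‖²`. -/
noncomputable def gradSq (e : HilbertBasis (Fin d → ℤ) ℝ H) (x : H) : ℝ :=
  ∑' k, sqLen k * ⟪e k, x⟫ ^ 2

/-- `‖Δx‖²`. -/
noncomputable def lapSq (e : HilbertBasis (Fin d → ℤ) ℝ H) (x : H) : ℝ :=
  ∑' k, sqLen k * (sqLen k * ⟪e k, x⟫ ^ 2)

theorem gradSq_nonneg (e : HilbertBasis (Fin d → ℤ) ℝ H) (x : H) : 0 ≤ gradSq e x :=
  tsum_nonneg fun k => mul_nonneg (sqLen_nonneg k) (sq_nonneg _)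

theorem lapSq_nonneg (e : HilbertBasis (Fin d → ℤ) ℝ H) (x : H) : 0 ≤ lapSq e x :=
  tsum_nonneg fun k => mul_nonneg (sqLen_nonneg k) (mul_nonneg (sqLen_nonneg k) (sq_nonneg _))

theorem exists_norm_le {E : Type*} [NormedAddCommGroup E] {s T : ℝ} {θ : ℝ → E}
    (h : ContinuousOn θ (Icc s T)) :
    ∃ C, 0 ≤ C ∧ ∀ r ∈ Icc s T, ‖θ r‖ ≤ C := by
  obtain ⟨C, hC⟩ := isCompact_Icc.exists_bound_of_continuousOn h
  exact ⟨max C 0, le_max_right _ _, fun r hr => (hC r hr).trans (le_max_left _ _)⟩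

theorem integrableOn_of_le {s T C : ℝ} {f : ℝ → ℝ}
    (hf : AEStronglyMeasurable f (volume.restrict (Ioc s T))) (hC : ∀ r ∈ Icc s T, |f r| ≤ C) :
    IntegrableOn f (Ioc s T) :=
  Integrable.of_bound hf C
    ((ae_restrict_mem measurableSet_Ioc).mono fun r hr => hC r (Ioc_subset_Icc_self hr))

/-- The energy estimate is made for each coefficient separately, so no regularity has to be assumed.
Young's inequality absorbs half of the dissipation and leaves `q / (2ν)`, which is summable by
hypothesis. It is used with `m = 1`, `q = G` for the `L²` energy and with `m = sqLen`, `q = F²` for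
the `H¹` energy. -/
theorem Evolves.summable_dissipation {e : HilbertBasis (Fin d → ℤ) ℝ H}
    {c : (Fin d → ℤ) → ℝ → ℝ} {s T : ℝ} {θ : ℝ → H} (h : Evolves e c s T θ) {ν : ℝ} (hν : 0 < ν)
    {m : (Fin d → ℤ) → ℝ} (hm : ∀ k, 0 ≤ m k) (hs : Summable fun k => m k * ⟪e k, θ s⟫ ^ 2)
    {f q : (Fin d → ℤ) → ℝ → ℝ} (hc : ∀ k r, c k r = -(ν * sqLen k * ⟪e k, θ r⟫) + f k r)
    (hq : ∀ k, IntegrableOn (q k) (Ioc s T)) (hq0 : ∀ k r, 0 ≤ q k r)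
    (hfq : ∀ k r, m k * f k r ^ 2 ≤ sqLen k * q k r)
    (hqs : Summable fun k => ∫ r in Ioc s T, |q k r|) :
    (∀ k, IntegrableOn (fun r => m k * (sqLen k * ⟪e k, θ r⟫ ^ 2)) (Ioc s T)) ∧
    (Summable fun k => ∫ r in Ioc s T, |m k * (sqLen k * ⟪e k, θ r⟫ ^ 2)|) ∧
    Summable fun k => ∫ r in s..T, |m k * (⟪e k, θ r⟫ * c k r)| := by
  have hint : ∀ k, IntegrableOn (fun r => m k * (sqLen k * ⟪e k, θ r⟫ ^ 2)) (Ioc s T) := fun k =>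
    ((continuousOn_const.mul (continuousOn_const.mul
      ((h.coeff_continuousOn k).pow 2))).integrableOn_Icc).mono_set Ioc_subset_Icc_self
  have hcint : ∀ k, IntegrableOn (fun r => m k * (⟪e k, θ r⟫ * c k r)) (Ioc s T) := fun k =>
    ((intervalIntegrable_iff_integrableOn_Ioc_of_le h.le).1 (h.intervalIntegrable_mul k)).const_mul _
  have hpos : ∀ k r, 0 ≤ m k * (sqLen k * ⟪e k, θ r⟫ ^ 2) := fun k r =>
    mul_nonneg (hm k) (mul_nonneg (sqLen_nonneg k) (sq_nonneg _))
  have young : ∀ k r, |m k * (⟪e k, θ r⟫ * f k r)| ≤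
      ν / 2 * (m k * (sqLen k * ⟪e k, θ r⟫ ^ 2)) + 1 / (2 * ν) * q k r := by
    intro k r
    have h1 := hpos k r
    have h2 := hq0 k r
    refine abs_le_of_sq_le_sq ?_ (by positivity)
    have h3 : (m k * (⟪e k, θ r⟫ * f k r)) ^ 2 ≤ (m k * (sqLen k * ⟪e k, θ r⟫ ^ 2)) * q k r := by
      have h4 := mul_le_mul_of_nonneg_left (hfq k r) (mul_nonneg (hm k) (sq_nonneg ⟪e k, θ r⟫))
      linarith
    set X := m k * (sqLen k * ⟪e k, θ r⟫ ^ 2)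
    have h5 : (ν / 2 * X + 1 / (2 * ν) * q k r) ^ 2 =
        X * q k r + (ν / 2 * X - 1 / (2 * ν) * q k r) ^ 2 := by field_simp; ring
    rw [h5]; nlinarith [sq_nonneg (ν / 2 * X - 1 / (2 * ν) * q k r)]
  have hT : T ∈ Icc s T := ⟨h.le, le_rfl⟩
  have bound : ∀ k, ∫ r in Ioc s T, |m k * (sqLen k * ⟪e k, θ r⟫ ^ 2)| ≤
      1 / ν * (m k * ⟪e k, θ s⟫ ^ 2) + 1 / ν ^ 2 * ∫ r in Ioc s T, |q k r| := by
    intro k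
    have h1 := h.sq_sub_sq k hT
    rw [intervalIntegral.integral_of_le h.le] at h1
    have h2 : m k * ⟪e k, θ T⟫ ^ 2 - m k * ⟪e k, θ s⟫ ^ 2 =
        2 * ∫ r in Ioc s T, m k * (⟪e k, θ r⟫ * c k r) := by
      rw [integral_const_mul]; linear_combination m k * h1
    have h3 : ∫ r in Ioc s T, m k * (⟪e k, θ r⟫ * c k r) ≤
        ∫ r in Ioc s T, (1 / (2 * ν) * |q k r| - ν / 2 * |m k * (sqLen k * ⟪e k, θ r⟫ ^ 2)|) := by
      refine integral_mono (hcint k) (((hq k).abs.const_mul _).sub ((hint k).abs.const_mul _))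
        fun r => ?_
      have := (abs_le.1 (young k r)).2
      simp only [hc, abs_of_nonneg (hpos k r), abs_of_nonneg (hq0 k r)]
      linarith
    rw [integral_sub ((hq k).abs.const_mul _) ((hint k).abs.const_mul _),
      integral_const_mul (1 / (2 * ν)), integral_const_mul (ν / 2)] at h3
    have h4 : 0 ≤ m k * ⟪e k, θ T⟫ ^ 2 := mul_nonneg (hm k) (sq_nonneg _)
    have h5 : ν * ∫ r in Ioc s T, |m k * (sqLen k * ⟪e k, θ r⟫ ^ 2)| ≤
        m k * ⟪e k, θ s⟫ ^ 2 + 1 / ν * ∫ r in Ioc s T, |q k r| := by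
      have : 1 / ν = 2 * (1 / (2 * ν)) := by field_simp
      rw [this]; linarith
    calc _ = 1 / ν * (ν * ∫ r in Ioc s T, |m k * (sqLen k * ⟪e k, θ r⟫ ^ 2)|) := by field_simp
      _ ≤ 1 / ν * (m k * ⟪e k, θ s⟫ ^ 2 + 1 / ν * ∫ r in Ioc s T, |q k r|) := by gcongr
      _ = _ := by field_simp
  have hsum := Summable.of_nonneg_of_le (fun k => integral_nonneg fun r => abs_nonneg _) bound
    ((hs.mul_left _).add (hqs.mul_left _))
  refine ⟨hint, hsum, ?_⟩
  refine Summable.of_nonneg_of_le (fun k => intervalIntegral.integral_nonneg h.le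
    fun r _ => abs_nonneg _) (fun k => ?_) ((hsum.mul_left (2 * ν)).add (hqs.mul_left (1 / (2 * ν))))
  rw [intervalIntegral.integral_of_le h.le, ← integral_const_mul, ← integral_const_mul,
    ← integral_add ((hint k).abs.const_mul _) ((hq k).abs.const_mul _)]
  refine integral_mono (hcint k).abs (((hint k).abs.const_mul _).add ((hq k).abs.const_mul _))
    fun r => ?_
  have h1 := young k r
  have h2 := hpos k r
  have h3 : m k * (⟪e k, θ r⟫ * c k r) =
      -(ν * (m k * (sqLen k * ⟪e k, θ r⟫ ^ 2))) + m k * (⟪e k, θ r⟫ * f k r) := by rw [hc]; ring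
  simp only [abs_of_nonneg h2, abs_of_nonneg (hq0 k r)]
  rw [h3]
  refine (abs_add_le _ _).trans ?_
  rw [abs_neg, abs_of_nonneg (by positivity)]
  nlinarith [mul_nonneg hν.le h2]

namespace Drift

variable {e : HilbertBasis (Fin d → ℤ) ℝ H} (S : Drift e) {s T ν : ℝ} {θ θ' : ℝ → H}

/-- `Drift.meas` concerns fixed vectors only; the moving vector `θ r` is expanded in the basis, and
measurability passes to the limit of the truncations. -/
theorem aestronglyMeasurable_inner_B (h : ContinuousOn θ (Icc s T)) (j : Fin d) (y : H) :
    AEStronglyMeasurable (fun r => ⟪y, S.B r j (θ r)⟫) (volume.restrict (Ioc s T)) := by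
  refine aestronglyMeasurable_of_tendsto_ae (u := (atTop : Filter (Finset (Fin d → ℤ))))
    (f := fun A r => ∑ l ∈ A, ⟪e l, θ r⟫ * ⟪y, S.B r j (e l)⟫) (fun A => ?_)
    (ae_of_all _ fun r => ?_)
  · refine Finset.aestronglyMeasurable_fun_sum A fun l _ => ?_
    refine AEStronglyMeasurable.mul ?_ (S.meas j (e l) y).restrict
    exact ((continuousOn_const.inner h).mono Ioc_subset_Icc_self).aestronglyMeasurable
      measurableSet_Ioc
  · have h1 := ((innerSL ℝ y).comp (S.B r j)).continuous.tendsto (θ r)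
    have h2 := h1.comp (tendsto_trunc e (θ r))
    refine h2.congr fun A => ?_
    simp [trunc, map_sum]

theorem aestronglyMeasurable_F (h : ContinuousOn θ (Icc s T)) (k : Fin d → ℤ) :
    AEStronglyMeasurable (fun r => S.F r k (θ r)) (volume.restrict (Ioc s T)) := by
  simp only [F_apply]
  exact Finset.aestronglyMeasurable_fun_sum _ fun j _ =>
    (S.aestronglyMeasurable_inner_B h j _).const_mul _

theorem abs_F_le (r k) (x : H) : |S.F r k x| ≤ √(sqLen k) * (S.M * ‖x‖) := by
  have := S.M_nonneg
  refine abs_le_of_sq_le_sq ?_ (by positivity)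
  rw [mul_pow, Real.sq_sqrt (sqLen_nonneg k), mul_pow]
  exact (S.F_sq_le r k x).trans (mul_le_mul_of_nonneg_left (S.G_le r k x) (sqLen_nonneg k))

theorem integrableOn_F (h : ContinuousOn θ (Icc s T)) (k : Fin d → ℤ) :
    IntegrableOn (fun r => S.F r k (θ r)) (Ioc s T) := by
  obtain ⟨C, hC0, hC⟩ := exists_norm_le h
  have := S.M_nonneg
  refine integrableOn_of_le (C := √(sqLen k) * (S.M * C)) (S.aestronglyMeasurable_F h k)
    fun r hr => (S.abs_F_le r k _).trans ?_
  have := hC r hr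
  gcongr

theorem integrableOn_G (h : ContinuousOn θ (Icc s T)) (k : Fin d → ℤ) :
    IntegrableOn (fun r => S.G r k (θ r)) (Ioc s T) := by
  obtain ⟨C, hC0, hC⟩ := exists_norm_le h
  refine integrableOn_of_le (C := S.M ^ 2 * C ^ 2) ?_ fun r hr => ?_
  · exact Finset.aestronglyMeasurable_fun_sum _ fun j _ =>
      (S.aestronglyMeasurable_inner_B h j _).pow 2
  · rw [abs_of_nonneg (S.G_nonneg _ _ _)]
    have := hC r hr
    exact (S.G_le r k _).trans (by gcongr)

theorem summable_integral_G (h : ContinuousOn θ (Icc s T)) :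
    Summable fun k => ∫ r in Ioc s T, |S.G r k (θ r)| := by
  obtain ⟨C, hC0, hC⟩ := exists_norm_le h
  refine summable_of_sum_integral_le (C := ∫ r in Ioc s T, S.M ^ 2 * C ^ 2)
    (fun k => S.integrableOn_G h k) (fun k r => S.G_nonneg r k _) fun A => ?_
  refine setIntegral_mono_on (integrable_finsetSum _ fun k _ => S.integrableOn_G h k)
    (integrable_const _) measurableSet_Ioc fun r hr => (S.sum_G_le r _ A).trans ?_
  have := hC r (Ioc_subset_Icc_self hr)
  gcongr

/-- The right-hand side of the advection-diffusion equation in coefficients. -/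
noncomputable def rhs (ν : ℝ) (θ : ℝ → H) (k : Fin d → ℤ) (r : ℝ) : ℝ :=
  -(ν * sqLen k * ⟪e k, θ r⟫) + S.F r k (θ r)

/-- Solutions of the advection-diffusion equation. -/
def IsMode (ν s T : ℝ) (θ : ℝ → H) : Prop := Evolves e (S.rhs ν θ) s T θ

theorem intervalIntegrable_rhs (h : ContinuousOn θ (Icc s T)) (hsT : s ≤ T) (ν : ℝ) (k) :
    IntervalIntegrable (S.rhs ν θ k) volume s T := by
  rw [intervalIntegrable_iff_integrableOn_Ioc_of_le hsT]
  refine Integrable.add ?_ (S.integrableOn_F h k)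
  exact ((continuousOn_const.mul (continuousOn_const.inner h)).neg.integrableOn_Icc).mono_set
    Ioc_subset_Icc_self

variable {S}

namespace IsMode

theorem mono (h : S.IsMode ν s T θ) {a b : ℝ} (hsa : s ≤ a) (hab : a ≤ b) (hbT : b ≤ T) :
    S.IsMode ν a b θ := Evolves.mono h hsa hab hbT

theorem sub (h : S.IsMode ν s T θ) (h' : S.IsMode ν s T θ') :
    S.IsMode ν s T (fun t => θ t - θ' t) :=
  (Evolves.sub h h').congr fun k r _ => by
    simp only [rhs, map_sub, inner_sub_right]; ring

theorem dissipation (h : S.IsMode ν s T θ) (hν : 0 < ν) :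
    (∀ k, IntegrableOn (fun r => sqLen k * ⟪e k, θ r⟫ ^ 2) (Ioc s T)) ∧
    (Summable fun k => ∫ r in Ioc s T, |sqLen k * ⟪e k, θ r⟫ ^ 2|) ∧
    Summable fun k => ∫ r in s..T, |⟪e k, θ r⟫ * S.rhs ν θ k r| := by
  have := Evolves.summable_dissipation h hν (m := fun _ => 1) (fun _ => zero_le_one)
    (by simpa using (hasSum_inner_sq e (θ s)).summable) (f := fun k r => S.F r k (θ r))
    (q := fun k r => S.G r k (θ r)) (fun k r => rfl) (S.integrableOn_G h.cont)
    (fun k r => S.G_nonneg r k _) (fun k r => by simpa using S.F_sq_le r k _)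
    (S.summable_integral_G h.cont)
  simpa only [one_mul] using this

theorem ae_isH1 (h : S.IsMode ν s T θ) (hν : 0 < ν) :
    (∀ᵐ r ∂(volume.restrict (Ioc s T)), IsH1 e (θ r)) ∧
      IntegrableOn (fun r => gradSq e (θ r)) (Ioc s T) :=
  ae_summable_of_summable_integral (h.dissipation hν).1 (h.dissipation hν).2.1

/-- At almost every time the solution is in `H¹`, where the transport term cancels by
`tsum_mul_F_self`; only the dissipation remains. -/
theorem energy (h : S.IsMode ν s T θ) (hν : 0 < ν) {t : ℝ} (ht : t ∈ Icc s T) :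
    ‖θ t‖ ^ 2 = ‖θ s‖ ^ 2 - 2 * ν * ∫ r in s..t, gradSq e (θ r) := by
  have h1 := Evolves.hasSum_energy h (fun _ => 1)
    (by simpa using (hasSum_inner_sq e (θ s)).summable)
    (by simpa only [one_mul] using (h.dissipation hν).2.2) ht
  simp only [one_mul] at h1
  rw [(hasSum_inner_sq e (θ s)).tsum_eq] at h1
  rw [(hasSum_inner_sq e (θ t)).unique h1, sub_eq_add_neg, mul_assoc, ← mul_neg,
    ← intervalIntegral.integral_const_mul ν, ← intervalIntegral.integral_neg]
  congr 2
  rw [intervalIntegral.integral_of_le ht.1, intervalIntegral.integral_of_le ht.1]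
  refine integral_congr_ae ?_
  have h2 := ae_restrict_of_ae_restrict_of_subset (Ioc_subset_Ioc_right ht.2) (h.ae_isH1 hν).1
  filter_upwards [h2] with r hr
  have h3 : ∀ k, ⟪e k, θ r⟫ * S.rhs ν θ k r =
      -(ν * (sqLen k * ⟪e k, θ r⟫ ^ 2)) + ⟪e k, θ r⟫ * S.F r k (θ r) := by
    intro k; rw [rhs]; ring
  simp only [h3]
  rw [Summable.tsum_add (hr.mul_left ν).neg (S.summable_mul_F r hr _), S.tsum_mul_F_self r hr,
    tsum_neg, tsum_mul_left, add_zero, gradSq]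

theorem norm_le (h : S.IsMode ν s T θ) (hν : 0 < ν) {a b : ℝ} (ha : s ≤ a) (hab : a ≤ b)
    (hb : b ≤ T) : ‖θ b‖ ≤ ‖θ a‖ := by
  have h1 := (h.mono ha hab hb).energy hν (t := b) ⟨hab, le_rfl⟩
  have h2 : 0 ≤ ∫ r in a..b, gradSq e (θ r) :=
    intervalIntegral.integral_nonneg hab fun r _ => gradSq_nonneg e _
  have h3 : ‖θ b‖ ^ 2 ≤ ‖θ a‖ ^ 2 := by nlinarith [mul_nonneg hν.le h2]
  exact le_of_sq_le_sq h3 (norm_nonneg _)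

theorem unique (h : S.IsMode ν s T θ) (h' : S.IsMode ν s T θ') (hν : 0 < ν) (hs : θ s = θ' s)
    {t : ℝ} (ht : t ∈ Icc s T) : θ t = θ' t := by
  have h1 := (h.sub h').norm_le hν le_rfl ht.1 ht.2
  rw [hs, sub_self, norm_zero] at h1
  exact sub_eq_zero.1 (norm_le_zero_iff.1 h1)

/-- The bootstrap from `L²` to `H¹`: the `L²` energy makes the gradient square integrable in time,
and `sum_F_sq_le` then makes the transport term an admissible forcing in the `H¹` energy. -/
theorem summable_integral_F_sq (h : S.IsMode ν s T θ) (hν : 0 < ν) :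
    (∀ k, IntegrableOn (fun r => S.F r k (θ r) ^ 2) (Ioc s T)) ∧
    Summable fun k => ∫ r in Ioc s T, |S.F r k (θ r) ^ 2| := by
  obtain ⟨C, hC0, hC⟩ := exists_norm_le h.cont
  have hM := S.M_nonneg
  have hi : ∀ k, IntegrableOn (fun r => S.F r k (θ r) ^ 2) (Ioc s T) := fun k => by
    refine integrableOn_of_le (C := (√(sqLen k) * (S.M * C)) ^ 2)
      ((S.aestronglyMeasurable_F h.cont k).pow 2) fun r hr => ?_
    rw [abs_pow]
    have h1 := hC r hr
    have h2 := S.abs_F_le r k (θ r)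
    refine pow_le_pow_left₀ (abs_nonneg _) (h2.trans ?_) 2
    gcongr
  refine ⟨hi, summable_of_sum_integral_le (C := ∫ r in Ioc s T, S.M ^ 2 * gradSq e (θ r)) hi
    (fun k r => sq_nonneg _) fun A => ?_⟩
  refine integral_mono_ae (integrable_finsetSum _ fun k _ => hi k)
    ((h.ae_isH1 hν).2.const_mul _) ?_
  filter_upwards [(h.ae_isH1 hν).1] with r hr using S.sum_F_sq_le r hr A

theorem dissipationH1 (h : S.IsMode ν s T θ) (hν : 0 < ν) (hs : IsH1 e (θ s)) :
    (∀ k, IntegrableOn (fun r => sqLen k * (sqLen k * ⟪e k, θ r⟫ ^ 2)) (Ioc s T)) ∧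
    (Summable fun k => ∫ r in Ioc s T, |sqLen k * (sqLen k * ⟪e k, θ r⟫ ^ 2)|) ∧
    Summable fun k => ∫ r in s..T, |sqLen k * (⟪e k, θ r⟫ * S.rhs ν θ k r)| :=
  Evolves.summable_dissipation h hν sqLen_nonneg hs (f := fun k r => S.F r k (θ r))
    (q := fun k r => S.F r k (θ r) ^ 2) (fun _ _ => rfl) (h.summable_integral_F_sq hν).1
    (fun _ _ => sq_nonneg _) (fun _ _ => le_rfl) (h.summable_integral_F_sq hν).2

theorem ae_isH2 (h : S.IsMode ν s T θ) (hν : 0 < ν) (hs : IsH1 e (θ s)) :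
    (∀ᵐ r ∂(volume.restrict (Ioc s T)), IsH2 e (θ r)) ∧
      IntegrableOn (fun r => lapSq e (θ r)) (Ioc s T) :=
  ae_summable_of_summable_integral (h.dissipationH1 hν hs).1 (h.dissipationH1 hν hs).2.1

theorem isH1 (h : S.IsMode ν s T θ) (hν : 0 < ν) (hs : IsH1 e (θ s))
    {t : ℝ} (ht : t ∈ Icc s T) : IsH1 e (θ t) :=
  (Evolves.hasSum_energy h sqLen hs (h.dissipationH1 hν hs).2.2 ht).summable

/-- The energy identity with weight `sqLen`. At almost every time the solution is in `H²`, so that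
the bound on the transport term extends from truncations to the solution. -/
theorem gradSq_add_le (h : S.IsMode ν s T θ) (hν : 0 < ν) (hs : IsH1 e (θ s))
    {L : ℝ} (hL0 : 0 ≤ L)
    (hL : ∀ᵐ r ∂(volume.restrict (Ioc s T)), S.GradBound L r) {t : ℝ} (ht : t ∈ Icc s T) :
    gradSq e (θ t) + 2 * ν * ∫ r in s..t, lapSq e (θ r) ≤
      gradSq e (θ s) + 2 * L * ∫ r in s..t, gradSq e (θ r) := by
  have h1 := Evolves.hasSum_energy h sqLen hs (h.dissipationH1 hν hs).2.2 ht
  have hsub : Ioc s t ⊆ Ioc s T := Ioc_subset_Ioc_right ht.2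
  have hst : uIcc s t ⊆ uIcc s T := by
    rw [uIcc_of_le ht.1, uIcc_of_le h.le]; exact Icc_subset_Icc_right ht.2
  have i1 : IntervalIntegrable (fun r => gradSq e (θ r)) volume s t :=
    (intervalIntegrable_iff_integrableOn_Ioc_of_le ht.1).2 ((h.ae_isH1 hν).2.mono_set hsub)
  have i2 : IntervalIntegrable (fun r => lapSq e (θ r)) volume s t :=
    (intervalIntegrable_iff_integrableOn_Ioc_of_le ht.1).2 ((h.ae_isH2 hν hs).2.mono_set hsub)
  have hci : ∀ k, IntegrableOn (fun r => sqLen k * (⟪e k, θ r⟫ * S.rhs ν θ k r)) (Ioc s T) :=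
    fun k => ((intervalIntegrable_iff_integrableOn_Ioc_of_le h.le).1
      (Evolves.intervalIntegrable_mul h k)).const_mul _
  have hae := ae_summable_of_summable_integral hci (by
    have := (h.dissipationH1 hν hs).2.2
    simpa only [intervalIntegral.integral_of_le h.le] using this)
  have h2 : ∫ r in s..t, ∑' k, sqLen k * (⟪e k, θ r⟫ * S.rhs ν θ k r) ≤
      ∫ r in s..t, (L * gradSq e (θ r) - ν * lapSq e (θ r)) := by
    refine intervalIntegral.integral_mono_ae_restrict ht.1
      ((intervalIntegrable_iff_integrableOn_Ioc_of_le ht.1).2 (IntegrableOn.mono_set hae.2 hsub))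
      ((i1.const_mul _).sub (i2.const_mul _)) ?_
    rw [restrict_Ioc_eq_restrict_Icc.symm]
    have a1 := ae_restrict_of_ae_restrict_of_subset hsub (h.ae_isH1 hν).1
    have a2 := ae_restrict_of_ae_restrict_of_subset hsub (h.ae_isH2 hν hs).1
    have a3 := ae_restrict_of_ae_restrict_of_subset hsub hae.1
    have a4 := ae_restrict_of_ae_restrict_of_subset hsub hL
    filter_upwards [a1, a2, a3, a4] with r h1 h2 h3 h4
    have h5 : ∀ k, sqLen k * (⟪e k, θ r⟫ * S.F r k (θ r)) =
        sqLen k * (⟪e k, θ r⟫ * S.rhs ν θ k r) +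
          ν * (sqLen k * (sqLen k * ⟪e k, θ r⟫ ^ 2)) := fun k => by rw [rhs]; ring
    have h6 : Summable fun k => sqLen k * (⟪e k, θ r⟫ * S.F r k (θ r)) := by
      simp only [h5]; exact h3.add (h2.mul_left ν)
    have h7 := S.tsum_sqLen_mul_F_le h4 hL0 h1 h2 h6
    simp only [h5] at h7
    rw [Summable.tsum_add h3 (h2.mul_left ν), tsum_mul_left] at h7
    simp only [gradSq, lapSq]
    linarith
  have h8 := h1.tsum_eq
  rw [intervalIntegral.integral_sub (i1.const_mul _) (i2.const_mul _),
    intervalIntegral.integral_const_mul, intervalIntegral.integral_const_mul] at h2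
  simp only [gradSq] at h8 h2 ⊢
  rw [h8]; linarith

end IsMode
end Drift

end

/-! ### Existence of viscous solutions -/

section

/-- Cauchy-Schwarz inequality with a weight. -/
theorem sq_integral_mul_le {α : Type*} [MeasurableSpace α] {μ : Measure α} {w f : α → ℝ}
    (hw0 : ∀ a, 0 ≤ w a) (hw : Integrable w μ) (h1 : Integrable (fun a => w a * f a) μ)
    (h2 : Integrable (fun a => w a * f a ^ 2) μ) :
    (∫ a, w a * f a ∂μ) ^ 2 ≤ (∫ a, w a ∂μ) * ∫ a, w a * f a ^ 2 ∂μ := by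
  set I := ∫ a, w a * f a ∂μ
  set W := ∫ a, w a ∂μ
  -- The integral of `w (p f - q)²` is nonnegative. The choice `p = W`, `q = I` gives the inequality
  -- when `W > 0`; when `W = 0`, `p = 1` with a suitable `q` forces `I = 0`.
  have key : ∀ p q : ℝ, 0 ≤ p ^ 2 * (∫ a, w a * f a ^ 2 ∂μ) - 2 * p * q * I + q ^ 2 * W := by
    intro p q
    have h3 : 0 ≤ ∫ a, (p ^ 2 * (w a * f a ^ 2) - 2 * p * q * (w a * f a) + q ^ 2 * w a) ∂μ := by
      refine integral_nonneg fun a => ?_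
      have : p ^ 2 * (w a * f a ^ 2) - 2 * p * q * (w a * f a) + q ^ 2 * w a =
          w a * (p * f a - q) ^ 2 := by ring
      rw [Pi.zero_apply, this]
      exact mul_nonneg (hw0 a) (sq_nonneg _)
    have i1 := h2.const_mul (p ^ 2)
    have i2 := h1.const_mul (2 * p * q)
    rwa [integral_add (f := fun a => p ^ 2 * (w a * f a ^ 2) - 2 * p * q * (w a * f a)) (i1.sub i2)
      (hw.const_mul _), integral_sub i1 i2, integral_const_mul (p ^ 2),
      integral_const_mul (2 * p * q), integral_const_mul (q ^ 2)] at h3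
  have hW : 0 ≤ W := integral_nonneg hw0
  rcases hW.eq_or_lt with h | h
  · rw [← h, zero_mul]
    by_contra! hI
    have hI0 : I ≠ 0 := fun h0 => by simp [h0] at hI
    have h4 := key 1 ((∫ a, w a * f a ^ 2 ∂μ + 1) / I)
    have h5 : 0 ≤ ∫ a, w a * f a ^ 2 ∂μ :=
      integral_nonneg fun a => mul_nonneg (hw0 a) (sq_nonneg _)
    rw [← h, mul_zero, add_zero, mul_assoc, div_mul_cancel₀ _ hI0] at h4
    linarith
  · have h4 := key W I
    have h5 : 0 ≤ W * (W * (∫ a, w a * f a ^ 2 ∂μ) - I ^ 2) := by linarith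
    linarith [nonneg_of_mul_nonneg_right h5 h]

variable {d : ℕ} {H : Type*} [NormedAddCommGroup H] [InnerProductSpace ℝ H]

theorem exists_inner_eq (e : HilbertBasis (Fin d → ℤ) ℝ H) {y : (Fin d → ℤ) → ℝ}
    (hy : Summable fun k => y k ^ 2) : ∃ x : H, ∀ k, ⟪e k, x⟫ = y k := by
  have hm : Memℓp y 2 := by
    refine memℓp_gen ?_
    simpa using hy
  refine ⟨e.repr.symm ⟨y, hm⟩, fun k => ?_⟩
  rw [← e.repr_apply_apply, LinearIsometryEquiv.apply_symm_apply]

theorem eq_of_inner_eq (e : HilbertBasis (Fin d → ℤ) ℝ H) {x y : H}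
    (h : ∀ k, ⟪e k, x⟫ = ⟪e k, y⟫) : x = y := by
  have h1 := hasSum_inner_sq e (x - y)
  simp only [inner_sub_right, h, sub_self, zero_pow two_ne_zero] at h1
  have := h1.unique hasSum_zero
  exact sub_eq_zero.1 (norm_eq_zero.1 (pow_eq_zero_iff two_ne_zero |>.1 this))

theorem norm_sq_le_of_sum_le (e : HilbertBasis (Fin d → ℤ) ℝ H) {x : H} {C : ℝ}
    (h : ∀ A : Finset (Fin d → ℤ), ∑ k ∈ A, ⟪e k, x⟫ ^ 2 ≤ C) : ‖x‖ ^ 2 ≤ C :=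
  le_of_tendsto' (hasSum_inner_sq e x) h

/-- Dominated convergence in the Parseval series of `f t - f t₀`, whose terms are at most `4 * b k`.
-/
theorem continuous_of_coeff (e : HilbertBasis (Fin d → ℤ) ℝ H) {X : Type*} [TopologicalSpace X]
    {f : X → H} {b : (Fin d → ℤ) → ℝ} (hb : Summable b)
    (hf : ∀ k, Continuous fun t => ⟪e k, f t⟫) (hfb : ∀ k t, ⟪e k, f t⟫ ^ 2 ≤ b k) :
    Continuous f := by
  refine continuous_iff_continuousAt.2 fun t₀ => ?_
  refine tendsto_iff_norm_sub_tendsto_zero.2 ?_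
  have h1 : Tendsto (fun t => ∑' k, ⟪e k, f t - f t₀⟫ ^ 2) (𝓝 t₀)
      (𝓝 (∑' _ : Fin d → ℤ, (0 : ℝ))) := by
    refine tendsto_tsum_of_dominated_convergence (bound := fun k => 4 * b k) (hb.mul_left 4)
      (fun k => ?_) (Eventually.of_forall fun t k => ?_)
    · have := (((hf k).sub continuous_const).pow 2).tendsto (f := fun t =>
        (⟪e k, f t⟫ - ⟪e k, f t₀⟫) ^ 2) t₀
      simpa [inner_sub_right] using this
    · rw [inner_sub_right, Real.norm_eq_abs, abs_of_nonneg (sq_nonneg _)]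
      nlinarith [hfb k t, hfb k t₀, sq_nonneg (⟪e k, f t⟫ + ⟪e k, f t₀⟫)]
  simp only [(hasSum_inner_sq e _).tsum_eq, tsum_zero] at h1
  have h2 := h1.sqrt
  simpa using h2

namespace Drift

variable {e : HilbertBasis (Fin d → ℤ) ℝ H} (S : Drift e) {s T ν : ℝ}

/-- The contribution of the transport term in Duhamel's formula with damping. -/
noncomputable def duhamel (ν l s : ℝ) (θ : ℝ → H) (k : Fin d → ℤ) (t : ℝ) : ℝ :=
  ∫ r in s..t, Real.exp (-(ν * sqLen k + l) * (t - r)) * S.F r k (θ r)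

/-- Taking the exponential in `t` out of the integral leaves a primitive, which is continuous in
`t`. -/
theorem duhamel_eq (l : ℝ) (θ : ℝ → H) (k : Fin d → ℤ) {t : ℝ} : S.duhamel ν l s θ k t =
    Real.exp (-(ν * sqLen k + l) * (t - s)) *
      ∫ r in s..t, Real.exp ((ν * sqLen k + l) * (r - s)) * S.F r k (θ r) := by
  rw [duhamel, ← intervalIntegral.integral_const_mul]
  refine intervalIntegral.integral_congr fun r _ => ?_
  rw [← mul_assoc, ← Real.exp_add]
  congr 2; ring

/-- Cauchy-Schwarz with the exponential as weight, of mass at most `1 / (ν * sqLen k + l)`. The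
factor `sqLen k` lost in `F_sq_le` is regained from this mass, at the price `1 / ν`. The damping
`exp (-l (t - r))` is kept in the integral for the sum over `k`. -/
theorem duhamel_sq_le {θ : ℝ → H} (hθ : ContinuousOn θ (Icc s T)) {l : ℝ}
    (hν : 0 < ν) (hl : 0 < l) (k : Fin d → ℤ) {t : ℝ} (ht : t ∈ Icc s T) :
    S.duhamel ν l s θ k t ^ 2 ≤
      1 / ν * ∫ r in Ioc s t, Real.exp (-l * (t - r)) * S.G r k (θ r) := by
  have hθ' : ContinuousOn θ (Icc s t) := hθ.mono (Icc_subset_Icc_right ht.2)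
  set a := ν * sqLen k + l with ha
  have hk := sqLen_nonneg k
  have ha0 : 0 < a := by positivity
  have hexp : Continuous fun r => Real.exp (-a * (t - r)) := by fun_prop
  have hexp' : Continuous fun r => Real.exp (-l * (t - r)) := by fun_prop
  obtain ⟨C, hC0, hC⟩ := exists_norm_le hθ'
  have hM := S.M_nonneg
  have hF2 : IntegrableOn (fun r => S.F r k (θ r) ^ 2) (Ioc s t) := by
    refine integrableOn_of_le (C := (√(sqLen k) * (S.M * C)) ^ 2)
      ((S.aestronglyMeasurable_F hθ' k).pow 2) fun r hr => ?_
    rw [abs_pow]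
    have h1 := hC r hr
    refine pow_le_pow_left₀ (abs_nonneg _) ((S.abs_F_le r k (θ r)).trans ?_) 2
    gcongr
  have bdd : ∀ {c : ℝ}, 0 < c → ∀ r ∈ Ioc s t, Real.exp (-c * (t - r)) ≤ 1 := by
    intro c hc r hr
    rw [Real.exp_le_one_iff]
    nlinarith [hr.2]
  have mulint : ∀ {c : ℝ} {f : ℝ → ℝ}, 0 < c → IntegrableOn f (Ioc s t) →
      IntegrableOn (fun r => Real.exp (-c * (t - r)) * f r) (Ioc s t) := by
    intro c f hc hf
    refine Integrable.bdd_mul hf (c := 1)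
      (Continuous.aestronglyMeasurable (by fun_prop)) ?_
    filter_upwards [ae_restrict_mem measurableSet_Ioc] with r hr
    rw [Real.norm_eq_abs, abs_of_pos (Real.exp_pos _)]
    exact bdd hc r hr
  have h1 : ∫ r in Ioc s t, Real.exp (-a * (t - r)) ≤ 1 / a := by
    rw [← intervalIntegral.integral_of_le ht.1]
    have hd : ∀ r ∈ uIcc s t, HasDerivAt (fun r => 1 / a * Real.exp (-a * (t - r)))
        (Real.exp (-a * (t - r))) r := by
      intro r _
      have h := ((((hasDerivAt_id' r).const_sub t).const_mul (-a)).exp).const_mul (1 / a)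
      exact h.congr_deriv (by field_simp)
    rw [intervalIntegral.integral_eq_sub_of_hasDerivAt hd (hexp.intervalIntegrable _ _)]
    have := Real.exp_pos (-a * (t - s))
    simp only [sub_self, mul_zero, Real.exp_zero, mul_one]
    have : 0 < 1 / a * Real.exp (-a * (t - s)) := by positivity
    linarith
  rw [duhamel, intervalIntegral.integral_of_le ht.1, ← ha]
  refine (sq_integral_mul_le (fun r => (Real.exp_pos _).le) ?_
    (mulint ha0 (S.integrableOn_F hθ' k)) (mulint ha0 hF2)).trans ?_
  · exact (hexp.continuousOn.integrableOn_Icc).mono_set Ioc_subset_Icc_self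
  have h2 : ∫ r in Ioc s t, Real.exp (-a * (t - r)) * S.F r k (θ r) ^ 2 ≤
      sqLen k * ∫ r in Ioc s t, Real.exp (-l * (t - r)) * S.G r k (θ r) := by
    rw [← integral_const_mul]
    refine setIntegral_mono_on (mulint ha0 hF2)
      ((mulint hl (S.integrableOn_G hθ' k)).const_mul _) measurableSet_Ioc fun r hr => ?_
    have h3 : Real.exp (-a * (t - r)) ≤ Real.exp (-l * (t - r)) := by
      rw [Real.exp_le_exp]
      have : 0 ≤ ν * sqLen k * (t - r) := mul_nonneg (by positivity) (by linarith [hr.2])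
      rw [ha]; nlinarith
    calc _ ≤ Real.exp (-l * (t - r)) * (sqLen k * S.G r k (θ r)) :=
          mul_le_mul h3 (S.F_sq_le r k _) (sq_nonneg _) (Real.exp_pos _).le
      _ = _ := by ring
  have h4 : 0 ≤ ∫ r in Ioc s t, Real.exp (-l * (t - r)) * S.G r k (θ r) :=
    integral_nonneg fun r => mul_nonneg (Real.exp_pos _).le (S.G_nonneg _ _ _)
  calc _ ≤ 1 / a * (sqLen k * ∫ r in Ioc s t, Real.exp (-l * (t - r)) * S.G r k (θ r)) :=
        mul_le_mul h1 h2 (integral_nonneg fun r => mul_nonneg (Real.exp_pos _).le (sq_nonneg _))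
          (by positivity)
    _ = (sqLen k / a) * ∫ r in Ioc s t, Real.exp (-l * (t - r)) * S.G r k (θ r) := by ring
    _ ≤ _ := by
        refine mul_le_mul_of_nonneg_right ?_ h4
        rw [div_le_div_iff₀ ha0 hν]; linarith

/-- Parseval bounds the sum of the `G` uniformly in time, and integrating the remaining damping
gains `1 / l`: for large `l` the Duhamel map is a contraction on an interval of any length. -/
theorem sum_duhamel_sq_le {θ : ℝ → H} (hθ : ContinuousOn θ (Icc s T)) {l : ℝ}
    (hν : 0 < ν) (hl : 0 < l) {C : ℝ} (hC : ∀ r ∈ Icc s T, ‖θ r‖ ≤ C)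
    (A : Finset (Fin d → ℤ)) {t : ℝ} (ht : t ∈ Icc s T) :
    ∑ k ∈ A, S.duhamel ν l s θ k t ^ 2 ≤ S.M ^ 2 * C ^ 2 / (ν * l) := by
  have hθ' : ContinuousOn θ (Icc s t) := hθ.mono (Icc_subset_Icc_right ht.2)
  have hi : ∀ k, IntegrableOn (fun r => Real.exp (-l * (t - r)) * S.G r k (θ r)) (Ioc s t) := by
    intro k
    refine Integrable.bdd_mul (S.integrableOn_G hθ' k) (c := 1)
      (Continuous.aestronglyMeasurable (by fun_prop)) ?_
    filter_upwards [ae_restrict_mem measurableSet_Ioc] with r hr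
    rw [Real.norm_eq_abs, abs_of_pos (Real.exp_pos _), Real.exp_le_one_iff]
    nlinarith [hr.2]
  have hexp : Continuous fun r => Real.exp (-l * (t - r)) * (S.M ^ 2 * C ^ 2) := by fun_prop
  have h1 : ∑ k ∈ A, ∫ r in Ioc s t, Real.exp (-l * (t - r)) * S.G r k (θ r) ≤
      S.M ^ 2 * C ^ 2 / l := by
    rw [← integral_finsetSum _ fun k _ => hi k]
    calc _ ≤ ∫ r in Ioc s t, Real.exp (-l * (t - r)) * (S.M ^ 2 * C ^ 2) := by
          refine setIntegral_mono_on (integrable_finsetSum _ fun k _ => hi k)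
            ((hexp.continuousOn.integrableOn_Icc).mono_set Ioc_subset_Icc_self) measurableSet_Ioc
            fun r hr => ?_
          rw [← Finset.mul_sum]
          have h2 := hC r ⟨hr.1.le, hr.2.trans ht.2⟩
          refine mul_le_mul_of_nonneg_left ((S.sum_G_le r _ A).trans ?_) (Real.exp_pos _).le
          gcongr
      _ ≤ _ := by
          rw [← intervalIntegral.integral_of_le ht.1]
          have hd : ∀ r ∈ uIcc s t, HasDerivAt
              (fun r => 1 / l * (Real.exp (-l * (t - r)) * (S.M ^ 2 * C ^ 2)))
              (Real.exp (-l * (t - r)) * (S.M ^ 2 * C ^ 2)) r := by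
            intro r _
            have h := (((((hasDerivAt_id' r).const_sub t).const_mul (-l)).exp).mul_const
              (S.M ^ 2 * C ^ 2)).const_mul (1 / l)
            exact h.congr_deriv (by field_simp)
          rw [intervalIntegral.integral_eq_sub_of_hasDerivAt hd (hexp.intervalIntegrable _ _)]
          have : 0 ≤ 1 / l * (Real.exp (-l * (t - s)) * (S.M ^ 2 * C ^ 2)) := by positivity
          simp only [sub_self, mul_zero, Real.exp_zero, one_mul]
          have e1 : 1 / l * (S.M ^ 2 * C ^ 2) = S.M ^ 2 * C ^ 2 / l := by ring
          linarith
  calc _ ≤ ∑ k ∈ A, 1 / ν * ∫ r in Ioc s t, Real.exp (-l * (t - r)) * S.G r k (θ r) :=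
        Finset.sum_le_sum fun k _ => S.duhamel_sq_le hθ hν hl k ht
    _ ≤ 1 / ν * (S.M ^ 2 * C ^ 2 / l) := by
        rw [← Finset.mul_sum]; gcongr
    _ = _ := by field_simp

theorem intervalIntegrable_exp_mul_F {θ : ℝ → H} (hθ : ContinuousOn θ (Icc s T))
    (hsT : s ≤ T) (a : ℝ) (k : Fin d → ℤ) :
    IntervalIntegrable (fun r => Real.exp (a * (r - s)) * S.F r k (θ r)) volume s T :=
  ((intervalIntegrable_iff_integrableOn_Ioc_of_le hsT).2 (S.integrableOn_F hθ k)).continuousOn_mul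
    (Continuous.continuousOn (by fun_prop))

/-- Existence of solutions of the advection-diffusion equation. -/
theorem exists_isMode [CompleteSpace H] (hν : 0 < ν) (hsT : s ≤ T) (x : H) :
    ∃ θ, S.IsMode ν s T θ ∧ θ s = x := by
  -- The damping is chosen so that the square of the Lipschitz constant, `M² / (ν l)`, is at most
  -- `1/4`. The fixed point will be the solution multiplied by `exp (-l (t - s))`.
  obtain ⟨l, hl, hlM⟩ : ∃ l : ℝ, 0 < l ∧ S.M ^ 2 / (ν * l) ≤ (1 / 2) ^ 2 := by
    refine ⟨4 * (S.M ^ 2 + 1) / ν, by positivity, ?_⟩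
    rw [show ν * (4 * (S.M ^ 2 + 1) / ν) = 4 * (S.M ^ 2 + 1) by field_simp,
      div_le_iff₀ (by positivity)]
    nlinarith [sq_nonneg S.M]
  have hcont : ∀ φ : C(Icc s T, H), ContinuousOn (fun r => φ (projIcc s T hsT r)) (Icc s T) :=
    fun φ => (φ.continuous.comp continuous_projIcc).continuousOn
  have hstep : ∀ φ : C(Icc s T, H), ∃ ψ : C(Icc s T, H), ∀ k (t : Icc s T), ⟪e k, ψ t⟫ =
      Real.exp (-(ν * sqLen k + l) * (t - s)) * ⟪e k, x⟫ +
        S.duhamel ν l s (fun r => φ (projIcc s T hsT r)) k t := by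
    intro φ
    set θ : ℝ → H := fun r => φ (projIcc s T hsT r)
    set y : (Fin d → ℤ) → ℝ → ℝ := fun k t =>
      Real.exp (-(ν * sqLen k + l) * (t - s)) * ⟪e k, x⟫ + S.duhamel ν l s θ k t
    -- A summable bound, uniform in time, for the squared coefficients of the image; it gives both
    -- that the image lies in `H` and that it is continuous.
    set b : (Fin d → ℤ) → ℝ := fun k =>
      2 * ⟪e k, x⟫ ^ 2 + 2 * (1 / ν * ∫ r in Ioc s T, |S.G r k (θ r)|)
    have hb : Summable b := ((hasSum_inner_sq e x).summable.mul_left 2).add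
      (((S.summable_integral_G (hcont φ)).mul_left _).mul_left 2)
    have hyb : ∀ k, ∀ t ∈ Icc s T, y k t ^ 2 ≤ b k := by
      intro k t ht
      have h1 : (Real.exp (-(ν * sqLen k + l) * (t - s)) * ⟪e k, x⟫) ^ 2 ≤ ⟪e k, x⟫ ^ 2 := by
        rw [mul_pow]
        refine mul_le_of_le_one_left (sq_nonneg _) (pow_le_one₀ (Real.exp_pos _).le ?_)
        rw [Real.exp_le_one_iff]
        have := mul_nonneg (add_nonneg (mul_nonneg hν.le (sqLen_nonneg k)) hl.le)
          (sub_nonneg.2 ht.1)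
        linarith
      have h2 := S.duhamel_sq_le (hcont φ) hν hl k ht
      have h3 : ∫ r in Ioc s t, Real.exp (-l * (t - r)) * S.G r k (θ r) ≤
          ∫ r in Ioc s T, |S.G r k (θ r)| := by
        have hi : IntegrableOn (fun r => |S.G r k (θ r)|) (Ioc s T) :=
          Integrable.abs (S.integrableOn_G (hcont φ) k)
        refine le_trans ?_ (setIntegral_mono_set hi (ae_of_all _ fun r => abs_nonneg _)
          (LE.le.eventuallyLE (Ioc_subset_Ioc_right ht.2)))
        refine integral_mono_of_nonneg (ae_of_all _ fun r => ?_)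
          (hi.mono_set (Ioc_subset_Ioc_right ht.2)) ?_
        · exact mul_nonneg (Real.exp_pos _).le (S.G_nonneg _ _ _)
        · filter_upwards [ae_restrict_mem measurableSet_Ioc] with r hr
          rw [abs_of_nonneg (S.G_nonneg _ _ _)]
          refine mul_le_of_le_one_left (S.G_nonneg _ _ _) ?_
          rw [Real.exp_le_one_iff]
          nlinarith [hr.2]
      have h4 : S.duhamel ν l s θ k t ^ 2 ≤ 1 / ν * ∫ r in Ioc s T, |S.G r k (θ r)| :=
        h2.trans (by gcongr)
      simp only [y, b]
      nlinarith [sq_nonneg (Real.exp (-(ν * sqLen k + l) * (t - s)) * ⟪e k, x⟫ -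
        S.duhamel ν l s θ k t)]
    have hex : ∀ t : Icc s T, ∃ z : H, ∀ k, ⟪e k, z⟫ = y k t := fun t =>
      exists_inner_eq e (Summable.of_nonneg_of_le (fun k => sq_nonneg _)
        (fun k => hyb k t t.2) hb)
    choose z hz using hex
    refine ⟨⟨z, continuous_of_coeff e hb (fun k => ?_) fun k t => ?_⟩, fun k t => hz t k⟩
    · rw [show (fun t => ⟪e k, z t⟫) = fun t : Icc s T => y k t from funext fun t => hz t k]
      have h1 : ContinuousOn (y k) (Icc s T) := by
        refine ContinuousOn.add (Continuous.continuousOn (by fun_prop)) ?_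
        rw [show S.duhamel ν l s θ k = _ from funext fun t => S.duhamel_eq l θ k]
        refine ContinuousOn.mul (Continuous.continuousOn (by fun_prop)) ?_
        have h2 := intervalIntegral.continuousOn_primitive_interval'
          (S.intervalIntegrable_exp_mul_F (hcont φ) hsT (ν * sqLen k + l) k) (a := s) (by simp)
        rwa [uIcc_of_le hsT] at h2
      exact continuousOn_iff_continuous_domRestrict.1 h1
    · rw [hz]; exact hyb k t t.2
  choose K hK using hstep
  have hcontr : ContractingWith (1 / 2) K := by
    refine ⟨by norm_num, LipschitzWith.of_dist_le_mul fun φ ψ => ?_⟩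
    rw [ContinuousMap.dist_le (by positivity)]
    intro t
    rw [dist_eq_norm]
    refine le_of_sq_le_sq ?_ (by positivity)
    have h1 : ∀ k, ⟪e k, K φ t - K ψ t⟫ = S.duhamel ν l s
        (fun r => φ (projIcc s T hsT r) - ψ (projIcc s T hsT r)) k t := by
      intro k
      rw [inner_sub_right, hK, hK]
      have hi : ∀ χ : C(Icc s T, H), IntervalIntegrable (fun r =>
          Real.exp (-(ν * sqLen k + l) * (t - r)) * S.F r k (χ (projIcc s T hsT r)))
          volume s t := by
        intro χ
        refine IntervalIntegrable.continuousOn_mul ?_ (Continuous.continuousOn (by fun_prop))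
        rw [intervalIntegrable_iff_integrableOn_Ioc_of_le t.2.1]
        exact (S.integrableOn_F (hcont χ) k).mono_set (Ioc_subset_Ioc_right t.2.2)
      rw [add_sub_add_left_eq_sub, duhamel, duhamel, duhamel,
        ← intervalIntegral.integral_sub (hi φ) (hi ψ)]
      exact intervalIntegral.integral_congr fun r _ => by simp only [map_sub]; ring
    refine (norm_sq_le_of_sum_le e (C := S.M ^ 2 * dist φ ψ ^ 2 / (ν * l)) fun A => ?_).trans ?_
    · simp only [h1]
      refine S.sum_duhamel_sq_le ((hcont φ).sub (hcont ψ)) hν hl (fun r _ => ?_) A t.2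
      rw [Pi.sub_apply, ← dist_eq_norm]
      exact ContinuousMap.dist_apply_le_dist _
    · rw [mul_pow]
      calc _ = S.M ^ 2 / (ν * l) * dist φ ψ ^ 2 := by ring
        _ ≤ (1 / 2) ^ 2 * dist φ ψ ^ 2 := by gcongr
        _ = _ := by norm_num
  set φ := ContractingWith.fixedPoint K hcontr
  have hφ : K φ = φ := hcontr.fixedPoint_isFixedPt
  -- The damping is undone.
  set θ : ℝ → H := fun r => Real.exp (l * (r - s)) • φ (projIcc s T hsT r) with hθd
  have hθ : ContinuousOn θ (Icc s T) :=
    ContinuousOn.smul (Continuous.continuousOn (by fun_prop)) (hcont φ)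
  have hform : ∀ k, ∀ t ∈ Icc s T, ⟪e k, θ t⟫ = Real.exp (-(ν * sqLen k) * (t - s)) *
      (⟪e k, x⟫ + ∫ r in s..t, Real.exp (ν * sqLen k * (r - s)) * S.F r k (θ r)) := by
    intro k t ht
    have h1 := hK φ k ⟨t, ht⟩
    rw [hφ, S.duhamel_eq] at h1
    have h2 : ∫ r in s..t, Real.exp (ν * sqLen k * (r - s)) * S.F r k (θ r) =
        ∫ r in s..t, Real.exp ((ν * sqLen k + l) * (r - s)) *
          S.F r k (φ (projIcc s T hsT r)) := by
      refine intervalIntegral.integral_congr fun r _ => ?_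
      simp only [θ, map_smul, smul_eq_mul]
      rw [← mul_assoc, ← Real.exp_add]
      congr 2; ring
    rw [h2]
    simp only [θ, projIcc_of_mem hsT ht, inner_smul_right, h1]
    rw [← mul_add, ← mul_assoc, ← Real.exp_add]
    congr 2; ring
  have hθs : θ s = x := by
    refine eq_of_inner_eq e fun k => ?_
    rw [hform k s ⟨le_rfl, hsT⟩]; simp
  refine ⟨θ, ⟨hsT, hθ, S.intervalIntegrable_rhs hθ hsT ν, fun k t ht => ?_⟩, hθs⟩
  have hd : ∀ r, HasDerivAt (fun r => Real.exp (-(ν * sqLen k) * (r - s)))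
      (-(ν * sqLen k) * Real.exp (-(ν * sqLen k) * (r - s))) r := by
    intro r
    have h := (((hasDerivAt_id' r).sub_const s).const_mul (-(ν * sqLen k))).exp
    exact h.congr_deriv (by ring)
  have hc : Continuous fun r => -(ν * sqLen k) * Real.exp (-(ν * sqLen k) * (r - s)) := by fun_prop
  -- The product rule for the heat factor and the integral in Duhamel's formula gives back the
  -- differential equation in integrated form.
  have h1 := mul_sub_mul_eq_integral (y := fun r => Real.exp (-(ν * sqLen k) * (r - s)))
    (y' := fun r => -(ν * sqLen k) * Real.exp (-(ν * sqLen k) * (r - s)))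
    (z := fun t => ⟪e k, x⟫ + ∫ r in s..t, Real.exp (ν * sqLen k * (r - s)) * S.F r k (θ r))
    (z' := fun r => Real.exp (ν * sqLen k * (r - s)) * S.F r k (θ r))
    (hc.intervalIntegrable s T) (S.intervalIntegrable_exp_mul_F hθ hsT _ k) hsT
    (fun t _ => (intervalIntegral.integral_eq_sub_of_hasDerivAt (fun r _ => hd r)
      (hc.intervalIntegrable _ _)).symm)
    (fun t _ => by simp) ht
  rw [← hform k t ht, ← hform k s ⟨le_rfl, hsT⟩] at h1
  rw [h1]
  refine intervalIntegral.integral_congr fun r hr => ?_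
  rw [uIcc_of_le ht.1] at hr
  simp only [rhs]
  rw [hform k r ⟨hr.1, hr.2.trans ht.2⟩, ← mul_assoc (Real.exp _) (Real.exp _), ← Real.exp_add,
    show -(ν * sqLen k) * (r - s) + ν * sqLen k * (r - s) = 0 by ring, Real.exp_zero]
  ring

end Drift

end

/-! ### The inviscid limit -/

section

/-- An integral form of Grönwall's inequality. -/
theorem integral_le_of_le_add_integral {g : ℝ → ℝ} {s T g₀ L : ℝ} (hg₀ : 0 ≤ g₀) (hL : 0 ≤ L)
    (hg : IntegrableOn g (Ioc s T))
    (h : ∀ t ∈ Icc s T, g t ≤ g₀ + L * ∫ r in s..t, g r) {t : ℝ} (ht : t ∈ Icc s T) :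
    ∫ r in s..t, g r ≤ g₀ * (t - s) * Real.exp (L * (t - s)) := by
  have hsT := ht.1.trans ht.2
  have hgi : IntervalIntegrable g volume s T :=
    (intervalIntegrable_iff_integrableOn_Ioc_of_le hsT).2 hg
  have hd : ∀ r, HasDerivAt (fun r => Real.exp (-L * (r - s))) (-L * Real.exp (-L * (r - s))) r :=
    fun r => ((((hasDerivAt_id' r).sub_const s).const_mul (-L)).exp).congr_deriv (by ring)
  have hc : Continuous fun r => -L * Real.exp (-L * (r - s)) := by fun_prop
  have h1 := mul_sub_mul_eq_integral (y := fun r => Real.exp (-L * (r - s)))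
    (y' := fun r => -L * Real.exp (-L * (r - s))) (z := fun t => ∫ r in s..t, g r) (z' := g)
    (hc.intervalIntegrable s T) hgi hsT
    (fun t _ => (intervalIntegral.integral_eq_sub_of_hasDerivAt (fun r _ => hd r)
      (hc.intervalIntegrable _ _)).symm) (fun t _ => by simp) ht
  simp only [intervalIntegral.integral_same, mul_zero, sub_zero] at h1
  have hst : uIcc s t ⊆ uIcc s T := by
    rw [uIcc_of_le ht.1, uIcc_of_le hsT]; exact Icc_subset_Icc_right ht.2
  have hprim : ContinuousOn (fun t => ∫ r in s..t, g r) (uIcc s t) :=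
    intervalIntegral.continuousOn_primitive_interval' (hgi.mono_set hst) (by simp)
  have i1 : IntervalIntegrable (fun r => -L * Real.exp (-L * (r - s)) * ∫ q in s..r, g q)
      volume s t := (hc.continuousOn.mul hprim).intervalIntegrable
  have i2 : IntervalIntegrable (fun r => Real.exp (-L * (r - s)) * g r) volume s t :=
    (hgi.mono_set hst).continuousOn_mul (Continuous.continuousOn (by fun_prop))
  have h2 : Real.exp (-L * (t - s)) * ∫ r in s..t, g r ≤ ∫ _ in s..t, g₀ := by
    rw [h1]
    refine intervalIntegral.integral_mono_on ht.1 (i1.add i2) (by simp) fun r hr => ?_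
    have h3 := h r ⟨hr.1, hr.2.trans ht.2⟩
    have h4 : Real.exp (-L * (r - s)) ≤ 1 := by
      rw [Real.exp_le_one_iff]; nlinarith [hr.1]
    have h5 := Real.exp_pos (-L * (r - s))
    calc _ = Real.exp (-L * (r - s)) * (g r - L * ∫ q in s..r, g q) := by ring
      _ ≤ Real.exp (-L * (r - s)) * g₀ := by gcongr; linarith
      _ ≤ g₀ := mul_le_of_le_one_left hg₀ h4
  rw [intervalIntegral.integral_const, smul_eq_mul] at h2
  calc _ = (Real.exp (-L * (t - s)) * ∫ r in s..t, g r) * Real.exp (L * (t - s)) := by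
        rw [mul_comm (Real.exp _), mul_assoc, ← Real.exp_add]; simp
    _ ≤ (t - s) * g₀ * Real.exp (L * (t - s)) := by gcongr
    _ = _ := by ring

variable {d : ℕ} {H : Type*} [NormedAddCommGroup H] [InnerProductSpace ℝ H]

namespace Drift

variable {e : HilbertBasis (Fin d → ℤ) ℝ H} {S : Drift e} {s T ν : ℝ} {θ θ' : ℝ → H}

/-- Energy estimate for a forced equation. -/
theorem norm_sq_le_of_forced {c h b : (Fin d → ℤ) → ℝ → ℝ} {w : ℝ → H} (hE : Evolves e c s T w)
    (hc : ∀ k r, c k r = h k r + S.F r k (w r)) (hw0 : w s = 0)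
    (hw : Summable fun k => ∫ r in Ioc s T, |sqLen k * ⟪e k, w r⟫ ^ 2|)
    (hb : ∀ k, IntegrableOn (b k) (Ioc s T)) (hbs : Summable fun k => ∫ r in Ioc s T, |b k r|)
    (hhb : ∀ k r, 2 * |h k r * ⟪e k, w r⟫| ≤ b k r) {t : ℝ} (ht : t ∈ Icc s T) :
    ‖w t‖ ^ 2 ≤ ∫ r in s..t, ∑' k, b k r := by
  have hwi : ∀ k, IntegrableOn (fun r => sqLen k * ⟪e k, w r⟫ ^ 2) (Ioc s T) := fun k =>
    ((continuousOn_const.mul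
      ((hE.coeff_continuousOn k).pow 2)).integrableOn_Icc).mono_set Ioc_subset_Icc_self
  have hci : ∀ k, IntegrableOn (fun r => ⟪e k, w r⟫ * c k r) (Ioc s T) := fun k =>
    (intervalIntegrable_iff_integrableOn_Ioc_of_le hE.le).1 (hE.intervalIntegrable_mul k)
  have hcb : ∀ k r, |⟪e k, w r⟫ * c k r| ≤
      |b k r| + (|sqLen k * ⟪e k, w r⟫ ^ 2| + |S.G r k (w r)|) := by
    intro k r
    have h1 := sqLen_nonneg k
    have h2 := S.G_nonneg r k (w r)
    have h3 : |⟪e k, w r⟫ * S.F r k (w r)| ≤ sqLen k * ⟪e k, w r⟫ ^ 2 + S.G r k (w r) := by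
      have h4 : 0 ≤ sqLen k * ⟪e k, w r⟫ ^ 2 := by positivity
      refine abs_le_of_sq_le_sq ?_ (by positivity)
      have h5 := mul_le_mul_of_nonneg_left (S.F_sq_le r k (w r)) (sq_nonneg ⟪e k, w r⟫)
      nlinarith [mul_nonneg h4 h2]
    have h4 := hhb k r
    have h5 : ⟪e k, w r⟫ * c k r = h k r * ⟪e k, w r⟫ + ⟪e k, w r⟫ * S.F r k (w r) := by
      rw [hc]; ring
    rw [h5]
    refine (abs_add_le _ _).trans ?_
    have h6 := le_abs_self (b k r)
    have h7 := abs_nonneg (h k r * ⟪e k, w r⟫)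
    have h8 := le_abs_self (sqLen k * ⟪e k, w r⟫ ^ 2)
    have h9 := le_abs_self (S.G r k (w r))
    linarith
  have hGi := fun k => S.integrableOn_G hE.cont k
  have hcs : Summable fun k => ∫ r in Ioc s T, |⟪e k, w r⟫ * c k r| := by
    refine Summable.of_nonneg_of_le (fun k => integral_nonneg fun r => abs_nonneg _) (fun k => ?_)
      (hbs.add (hw.add (S.summable_integral_G hE.cont)))
    rw [← integral_add (hwi k).abs (hGi k).abs,
      ← integral_add (g := fun r => |sqLen k * ⟪e k, w r⟫ ^ 2| + |S.G r k (w r)|) (hb k).abs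
        ((hwi k).abs.add (hGi k).abs)]
    exact integral_mono (hci k).abs ((hb k).abs.add ((hwi k).abs.add (hGi k).abs))
      (hcb k)
  have h1 := hE.hasSum_energy (fun _ => 1) (by simp [hw0, summable_zero])
    (by simpa only [one_mul, intervalIntegral.integral_of_le hE.le] using hcs) ht
  simp only [one_mul, hw0, inner_zero_right, zero_pow two_ne_zero, tsum_zero, zero_add] at h1
  rw [(hasSum_inner_sq e (w t)).unique h1, ← intervalIntegral.integral_const_mul]
  have hsub : Ioc s t ⊆ Ioc s T := Ioc_subset_Ioc_right ht.2
  have ac := ae_summable_of_summable_integral hci hcs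
  have ab := ae_summable_of_summable_integral hb hbs
  have aw := ae_summable_of_summable_integral hwi hw
  refine intervalIntegral.integral_mono_ae_restrict ht.1
    (((intervalIntegrable_iff_integrableOn_Ioc_of_le ht.1).2
      (IntegrableOn.mono_set ac.2 hsub)).const_mul 2)
    ((intervalIntegrable_iff_integrableOn_Ioc_of_le ht.1).2 (IntegrableOn.mono_set ab.2 hsub)) ?_
  rw [restrict_Ioc_eq_restrict_Icc.symm]
  filter_upwards [ae_restrict_of_ae_restrict_of_subset hsub ac.1,
    ae_restrict_of_ae_restrict_of_subset hsub ab.1,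
    ae_restrict_of_ae_restrict_of_subset hsub aw.1] with r h1 h2 h3
  -- Since `w r` is in `H¹` at almost every time, the transport terms sum to zero and may be
  -- subtracted; only the forcing is left.
  have h4 : ∀ k, ⟪e k, w r⟫ * c k r - ⟪e k, w r⟫ * S.F r k (w r) = h k r * ⟪e k, w r⟫ :=
    fun k => by rw [hc]; ring
  have h5 := h1.sub (S.summable_mul_F r h3 (w r))
  have h6 : ∑' k, ⟪e k, w r⟫ * c k r =
      ∑' k, (⟪e k, w r⟫ * c k r - ⟪e k, w r⟫ * S.F r k (w r)) := by
    rw [Summable.tsum_sub h1 (S.summable_mul_F r h3 (w r)), S.tsum_mul_F_self r h3, sub_zero]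
  rw [h6, ← tsum_mul_left]
  refine Summable.tsum_le_tsum (fun k => ?_) (h5.mul_left 2) h2
  rw [h4]
  exact (mul_le_mul_of_nonneg_left (le_abs_self _) two_pos.le).trans (hhb k r)

namespace IsMode

/-- Grönwall after the `H²` dissipation is dropped. The bound does not depend on `ν`, which is what
the vanishing viscosity limit needs. -/
theorem integral_gradSq_le (h : S.IsMode ν s T θ) (hν : 0 < ν) (hs : IsH1 e (θ s)) {L : ℝ}
    (hL0 : 0 ≤ L) (hL : ∀ᵐ r ∂(volume.restrict (Ioc s T)), S.GradBound L r) {t : ℝ}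
    (ht : t ∈ Icc s T) :
    ∫ r in s..t, gradSq e (θ r) ≤ gradSq e (θ s) * (t - s) * Real.exp (2 * L * (t - s)) := by
  refine integral_le_of_le_add_integral (gradSq_nonneg e _) (by positivity) (h.ae_isH1 hν).2
    (fun r hr => ?_) ht
  have h1 := h.gradSq_add_le hν hs hL0 hL hr
  have h2 : 0 ≤ ∫ q in s..r, lapSq e (θ q) :=
    intervalIntegral.integral_nonneg hr.1 fun _ _ => lapSq_nonneg e _
  have := mul_nonneg (mul_nonneg two_pos.le hν.le) h2
  linarith

/-- Solutions with different diffusivities are close. -/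
theorem norm_sub_sq_le {ν' : ℝ} (h : S.IsMode ν s T θ) (h' : S.IsMode ν' s T θ') (hν : 0 < ν)
    (hν' : 0 < ν') (hs : θ s = θ' s) {t : ℝ} (ht : t ∈ Icc s T) :
    ‖θ t - θ' t‖ ^ 2 ≤ 4 * (ν + ν') *
      ((∫ r in s..t, gradSq e (θ r)) + ∫ r in s..t, gradSq e (θ' r)) := by
  obtain ⟨i1, s1, -⟩ := h.dissipation hν
  obtain ⟨i2, s2, -⟩ := h'.dissipation hν'
  have hsub : Ioc s t ⊆ Ioc s T := Ioc_subset_Ioc_right ht.2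
  -- Both Laplacians count as forcing of the difference. Paired with the difference they are bounded
  -- by products of gradients, so no second derivatives are needed.
  have key := norm_sq_le_of_forced (S := S) (Evolves.sub h h')
    (h := fun k r => -(ν * sqLen k * ⟪e k, θ r⟫) + ν' * sqLen k * ⟪e k, θ' r⟫)
    (b := fun k r => 4 * (ν + ν') * (sqLen k * ⟪e k, θ r⟫ ^ 2 + sqLen k * ⟪e k, θ' r⟫ ^ 2))
    (fun k r => by simp only [rhs, map_sub]; ring) (by simp [hs]) ?_
    (fun k => Integrable.const_mul (Integrable.fun_add (i1 k) (i2 k)) _) ?_ (fun k r => ?_) ht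
  · refine key.trans (le_of_eq ?_)
    rw [← intervalIntegral.integral_add, ← intervalIntegral.integral_const_mul]
    · rw [intervalIntegral.integral_of_le ht.1, intervalIntegral.integral_of_le ht.1]
      refine integral_congr_ae ?_
      filter_upwards [ae_restrict_of_ae_restrict_of_subset hsub (h.ae_isH1 hν).1,
        ae_restrict_of_ae_restrict_of_subset hsub (h'.ae_isH1 hν').1] with r h1 h2
      rw [tsum_mul_left, Summable.tsum_add h1 h2, gradSq, gradSq]
    · exact (intervalIntegrable_iff_integrableOn_Ioc_of_le ht.1).2
        ((h.ae_isH1 hν).2.mono_set hsub)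
    · exact (intervalIntegrable_iff_integrableOn_Ioc_of_le ht.1).2
        ((h'.ae_isH1 hν').2.mono_set hsub)
  · refine Summable.of_nonneg_of_le (fun k => integral_nonneg fun r => abs_nonneg _) (fun k => ?_)
      ((s1.add s2).mul_left 2)
    rw [← integral_add (i1 k).abs (i2 k).abs, ← integral_const_mul]
    refine integral_mono_of_nonneg (ae_of_all _ fun r => abs_nonneg _)
      (((i1 k).abs.add (i2 k).abs).const_mul 2) (ae_of_all _ fun r => ?_)
    have h0 := sqLen_nonneg k
    simp only [inner_sub_right]
    rw [abs_of_nonneg (by positivity), abs_of_nonneg (by positivity), abs_of_nonneg (by positivity)]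
    nlinarith [mul_nonneg h0 (sq_nonneg (⟪e k, θ r⟫ + ⟪e k, θ' r⟫))]
  · have := (s1.add s2).mul_left (4 * (ν + ν'))
    refine this.congr fun k => ?_
    rw [← integral_add (i1 k).abs (i2 k).abs, ← integral_const_mul]
    refine integral_congr_ae (ae_of_all _ fun r => ?_)
    have h0 := sqLen_nonneg k
    beta_reduce
    rw [abs_of_nonneg (by positivity), abs_of_nonneg (by positivity), abs_of_nonneg (by positivity)]
  · have h0 := sqLen_nonneg k
    rw [inner_sub_right]
    set x := ⟪e k, θ r⟫
    set y := ⟪e k, θ' r⟫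
    have h1 : (-(ν * sqLen k * x) + ν' * sqLen k * y) * (x - y) =
      sqLen k * (-(ν * x ^ 2) - ν' * y ^ 2 + (ν + ν') * (x * y)) := by ring
    rw [h1, abs_mul, abs_of_nonneg h0]
    have h2 : |-(ν * x ^ 2) - ν' * y ^ 2 + (ν + ν') * (x * y)| ≤ 2 * (ν + ν') * (x ^ 2 + y ^ 2) := by
      rw [abs_le]
      constructor
      · nlinarith [mul_nonneg (add_pos hν hν').le (sq_nonneg (x + y)),
          mul_nonneg hν.le (sq_nonneg y), mul_nonneg hν'.le (sq_nonneg x),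
          mul_nonneg hν.le (sq_nonneg x), mul_nonneg hν'.le (sq_nonneg y)]
      · nlinarith [mul_nonneg (add_pos hν hν').le (sq_nonneg (x - y)),
          mul_nonneg hν.le (sq_nonneg y), mul_nonneg hν'.le (sq_nonneg x),
          mul_nonneg hν.le (sq_nonneg x), mul_nonneg hν'.le (sq_nonneg y)]
    nlinarith [mul_le_mul_of_nonneg_left h2 h0]

end IsMode

/-- The inviscid solution obtained by vanishing viscosity. -/
theorem exists_inviscid [CompleteSpace H] (hsT : s ≤ T) {x : H} (hx : IsH1 e x) {L : ℝ}
    (hL0 : 0 ≤ L) (hL : ∀ᵐ r ∂(volume.restrict (Ioc s T)), S.GradBound L r) :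
    ∃ η, S.IsMode 0 s T η ∧ η s = x ∧ (∀ t ∈ Icc s T, ‖η t‖ ≤ ‖x‖) ∧
      Summable fun k => ∫ r in Ioc s T, |sqLen k * ⟪e k, η r⟫ ^ 2| := by
  set a : ℕ → ℝ := fun n => 1 / ((n : ℝ) + 1)
  have ha : ∀ n, 0 < a n := fun n => by positivity
  have ha1 : ∀ n, a n ≤ 1 := fun n => by
    simp only [a]; rw [div_le_one (by positivity)]; linarith [n.cast_nonneg (α := ℝ)]
  have ha0 : Tendsto a atTop (𝓝 0) := tendsto_one_div_add_atTop_nhds_zero_nat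
  choose θ hθ hθs using fun n => S.exists_isMode (ha n) hsT x
  set C := gradSq e x * (T - s) * Real.exp (2 * L * (T - s))
  have hts : 0 ≤ T - s := sub_nonneg.2 hsT
  have hC : ∀ n, ∀ t ∈ Icc s T, ∫ r in s..t, gradSq e (θ n r) ≤ C := by
    intro n t ht
    have h1 := (hθ n).integral_gradSq_le (ha n) (by rwa [hθs]) hL0 hL ht
    rw [hθs] at h1
    have := gradSq_nonneg e x
    have h2 : 0 ≤ t - s := sub_nonneg.2 ht.1
    have h3 : t - s ≤ T - s := by linarith [ht.2]
    refine h1.trans ?_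
    simp only [C]
    gcongr
  have hC0 : 0 ≤ C := by
    have := gradSq_nonneg e x
    positivity
  -- The gradients are bounded independently of the viscosity, so the distance of two approximations
  -- is controlled by `a n + a m`, uniformly in time.
  have hdist : ∀ n m, ∀ t ∈ Icc s T, ‖θ n t - θ m t‖ ^ 2 ≤ 8 * C * (a n + a m) := by
    intro n m t ht
    have h1 := (hθ n).norm_sub_sq_le (hθ m) (ha n) (ha m) (by rw [hθs, hθs]) ht
    have h2 := hC n t ht
    have h3 := hC m t ht
    have h4 := mul_le_mul_of_nonneg_left (add_le_add h2 h3) (add_pos (ha n) (ha m)).le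
    linarith
  have hcau : ∀ t ∈ Icc s T, CauchySeq fun n => θ n t := by
    intro t ht
    rw [Metric.cauchySeq_iff']
    intro ε hε
    have hlim : Tendsto (fun n => 16 * C * a n) atTop (𝓝 0) := by
      simpa using ha0.const_mul (16 * C)
    obtain ⟨N, hN⟩ := (hlim.eventually (gt_mem_nhds (show 0 < ε ^ 2 by positivity))).exists
    refine ⟨N, fun n hn => ?_⟩
    have han : a n ≤ a N := one_div_le_one_div_of_le (by positivity) (by gcongr)
    have h1 := hdist n N t ht
    rw [dist_eq_norm]
    refine lt_of_pow_lt_pow_left₀ 2 hε.le (h1.trans_lt ?_)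
    nlinarith [mul_le_mul_of_nonneg_left han hC0]
  have hex : ∀ t, ∃ z, t ∈ Icc s T → Tendsto (fun n => θ n t) atTop (𝓝 z) := by
    intro t
    by_cases ht : t ∈ Icc s T
    · obtain ⟨z, hz⟩ := cauchySeq_tendsto_of_complete (hcau t ht)
      exact ⟨z, fun _ => hz⟩
    · exact ⟨0, fun h => absurd h ht⟩
  choose η hη using hex
  have hdist' : ∀ n, ∀ t ∈ Icc s T, ‖θ n t - η t‖ ^ 2 ≤ 8 * C * (a n + 0) := by
    intro n t ht
    refine le_of_tendsto_of_tendsto' (((tendsto_const_nhds.sub (hη t ht)).norm).pow 2)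
      ((tendsto_const_nhds.add ha0).const_mul (8 * C)) fun m => hdist n m t ht
  have hunif : TendstoUniformlyOn θ η atTop (Icc s T) := by
    rw [Metric.tendstoUniformlyOn_iff]
    intro ε hε
    have hlim : Tendsto (fun n => 8 * C * (a n + 0)) atTop (𝓝 0) := by
      simpa using ha0.const_mul (8 * C)
    filter_upwards [hlim.eventually (gt_mem_nhds (show 0 < ε ^ 2 by positivity))] with n hn t ht
    rw [dist_comm, dist_eq_norm]
    exact lt_of_pow_lt_pow_left₀ 2 hε.le ((hdist' n t ht).trans_lt hn)
  have hηc : ContinuousOn η (Icc s T) :=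
    hunif.continuousOn (Eventually.of_forall fun n => (hθ n).cont).frequently
  have hs : s ∈ Icc s T := ⟨le_rfl, hsT⟩
  have hηs : η s = x := tendsto_nhds_unique (hη s hs) (by simp [hθs])
  have hθx : ∀ n, ∀ t ∈ Icc s T, ‖θ n t‖ ≤ ‖x‖ := by
    intro n t ht
    have := (hθ n).norm_le (ha n) le_rfl ht.1 ht.2
    rwa [hθs] at this
  have hM := S.M_nonneg
  have hin : ∀ k, ∀ t ∈ Icc s T, Tendsto (fun n => ⟪e k, θ n t⟫) atTop (𝓝 ⟪e k, η t⟫) :=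
    fun k t ht => ((innerSL ℝ (e k)).continuous.tendsto _).comp (hη t ht)
  refine ⟨η, ⟨hsT, hηc, S.intervalIntegrable_rhs hηc hsT 0, fun k t ht => ?_⟩, hηs,
    fun t ht => le_of_tendsto' (hη t ht).norm fun n => hθx n t ht, ?_⟩
  · have h1 : Tendsto (fun n => ∫ r in s..t, S.rhs (a n) (θ n) k r) atTop
        (𝓝 (∫ r in s..t, S.rhs 0 η k r)) := by
      refine intervalIntegral.tendsto_integral_filter_of_dominated_convergence
        (fun _ => sqLen k * ‖x‖ + √(sqLen k) * (S.M * ‖x‖)) (Eventually.of_forall fun n => ?_)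
        (Eventually.of_forall fun n => ae_of_all _ fun r hr => ?_) (by simp)
        (ae_of_all _ fun r hr => ?_)
      · rw [uIoc_of_le ht.1]
        exact (((intervalIntegrable_iff_integrableOn_Ioc_of_le hsT).1
          (Evolves.int (hθ n) k)).mono_set (Ioc_subset_Ioc_right ht.2)).1
      · rw [uIoc_of_le ht.1] at hr
        have hr' : r ∈ Icc s T := ⟨hr.1.le, hr.2.trans ht.2⟩
        have h2 := hθx n r hr'
        rw [rhs, Real.norm_eq_abs]
        refine (abs_add_le _ _).trans (add_le_add ?_ ((S.abs_F_le r k _).trans (by gcongr)))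
        rw [abs_neg, abs_mul, abs_of_nonneg (mul_nonneg (ha n).le (sqLen_nonneg k))]
        have h3 : |⟪e k, θ n r⟫| ≤ ‖x‖ := by
          have := abs_real_inner_le_norm (e k) (θ n r)
          rw [e.orthonormal.1 k, one_mul] at this
          exact this.trans h2
        exact mul_le_mul (mul_le_of_le_one_left (sqLen_nonneg k) (ha1 n)) h3 (abs_nonneg _)
          (sqLen_nonneg k)
      · rw [uIoc_of_le ht.1] at hr
        have hr' : r ∈ Icc s T := ⟨hr.1.le, hr.2.trans ht.2⟩
        have h2 := hη r hr'
        exact (((ha0.mul_const _).mul (hin k r hr')).neg).add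
          (((S.F r k).continuous.tendsto _).comp h2)
    refine tendsto_nhds_unique ?_ h1
    refine ((hin k t ht).sub (hin k s hs)).congr fun n => ?_
    exact Evolves.eq (hθ n) k t ht
  -- The `H¹` bound passes to the limit for every finite set of coefficients. It makes the inviscid
  -- solution regular enough for its transport energy to cancel in `norm_sq_le_of_forced`.
  · have hcoef : ∀ k, IntegrableOn (fun r => sqLen k * ⟪e k, η r⟫ ^ 2) (Ioc s T) := fun k =>
      ((continuousOn_const.mul ((continuousOn_const.inner hηc).pow
        2)).integrableOn_Icc).mono_set Ioc_subset_Icc_self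
    refine summable_of_sum_integral_le (C := ∫ _ in Ioc s T, (gradSq e x + 2 * L * C)) hcoef
      (fun k r => mul_nonneg (sqLen_nonneg k) (sq_nonneg _)) fun A => ?_
    refine setIntegral_mono_on (integrable_finsetSum _ fun k _ => hcoef k) (integrable_const _)
      measurableSet_Ioc fun t ht => ?_
    have ht' := Ioc_subset_Icc_self ht
    refine le_of_tendsto' (tendsto_finsetSum _ fun k _ =>
      ((hin k t ht').pow 2).const_mul (sqLen k)) fun n => ?_
    have hx' : IsH1 e (θ n s) := by rwa [hθs]
    have h1 := (hθ n).gradSq_add_le (ha n) hx' hL0 hL ht'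
    have h2 := Summable.sum_le_tsum A (fun k _ => mul_nonneg (sqLen_nonneg k) (sq_nonneg _))
      ((hθ n).isH1 (ha n) hx' ht')
    have h3 : 0 ≤ ∫ q in s..t, lapSq e (θ n q) :=
      intervalIntegral.integral_nonneg ht'.1 fun _ _ => lapSq_nonneg e _
    have h4 := mul_nonneg (mul_nonneg two_pos.le (ha n).le) h3
    have h5 := mul_le_mul_of_nonneg_left (hC n t ht') (mul_nonneg two_pos.le hL0)
    rw [hθs] at h1
    simp only [gradSq] at h1 h2 ⊢
    simp only [gradSq] at h5
    linarith

/-- A viscous solution stays close to the inviscid one as long as the dissipation is small. -/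
theorem exists_inviscid_near [CompleteSpace H] (h : S.IsMode ν s T θ) (hν : 0 < ν)
    (hx : IsH1 e (θ s)) {L : ℝ} (hL0 : 0 ≤ L)
    (hL : ∀ᵐ r ∂(volume.restrict (Ioc s T)), S.GradBound L r) :
    ∃ η, S.IsMode 0 s T η ∧ η s = θ s ∧ (∀ t ∈ Icc s T, ‖η t‖ ≤ ‖θ s‖) ∧
      ∀ t ∈ Icc s T, ∀ β : ℝ, 0 < β → ‖θ t - η t‖ ^ 2 ≤
        β * ν ^ 2 * (∫ r in s..t, lapSq e (θ r)) + 4 * (t - s) * ‖θ s‖ ^ 2 / β := by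
  obtain ⟨η, hη, hηs, hηn, hηsum⟩ := exists_inviscid h.le hx hL0 hL
  refine ⟨η, hη, hηs, hηn, fun t ht β hβ => ?_⟩
  obtain ⟨i1, s1, -⟩ := h.dissipation hν
  obtain ⟨i2, s2, -⟩ := h.dissipationH1 hν hx
  have hsub : Ioc s t ⊆ Ioc s T := Ioc_subset_Ioc_right ht.2
  have hEw := Evolves.sub h hη
  have hηi : ∀ k, IntegrableOn (fun r => sqLen k * ⟪e k, η r⟫ ^ 2) (Ioc s T) := fun k =>
    ((continuousOn_const.mul ((continuousOn_const.inner hη.cont).pow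
      2)).integrableOn_Icc).mono_set Ioc_subset_Icc_self
  have hwi : ∀ k, IntegrableOn (fun r => ⟪e k, θ r - η r⟫ ^ 2) (Ioc s T) := fun k =>
    (((continuousOn_const.inner hEw.cont).pow 2).integrableOn_Icc).mono_set Ioc_subset_Icc_self
  have hwn : ∀ r ∈ Icc s T, ‖θ r - η r‖ ^ 2 ≤ 4 * ‖θ s‖ ^ 2 := by
    intro r hr
    have h1 := h.norm_le hν le_rfl hr.1 hr.2
    have h2 := hηn r hr
    have h3 : ‖θ r - η r‖ ≤ 2 * ‖θ s‖ := (norm_sub_le _ _).trans (by linarith)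
    calc _ ≤ (2 * ‖θ s‖) ^ 2 := by gcongr
      _ = _ := by ring
  have hws : Summable fun k => ∫ r in Ioc s T, |⟪e k, θ r - η r⟫ ^ 2| := by
    refine summable_of_sum_integral_le (C := ∫ _ in Ioc s T, 4 * ‖θ s‖ ^ 2) hwi
      (fun k r => sq_nonneg _) fun A => ?_
    refine setIntegral_mono_on (integrable_finsetSum _ fun k _ => hwi k) (integrable_const _)
      measurableSet_Ioc fun r hr => ?_
    exact (sum_le_hasSum A (fun _ _ => sq_nonneg _) (hasSum_inner_sq e _)).trans
      (hwn r (Ioc_subset_Icc_self hr))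
  -- The difference is forced by `ν Δθ` alone. Young's inequality with parameter `β` separates the
  -- forcing from the difference, whose square is simply bounded by `4 ‖θ s‖²`.
  have key := norm_sq_le_of_forced (S := S) hEw (h := fun k r => -(ν * sqLen k * ⟪e k, θ r⟫))
    (b := fun k r => β * ν ^ 2 * (sqLen k * (sqLen k * ⟪e k, θ r⟫ ^ 2)) +
      1 / β * ⟪e k, θ r - η r⟫ ^ 2)
    (fun k r => by simp only [rhs, map_sub]; ring) (by simp [hηs]) ?_
    (fun k => Integrable.fun_add ((i2 k).const_mul _) ((hwi k).const_mul _)) ?_ (fun k r => ?_) ht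
  · refine key.trans ?_
    have hl : IntervalIntegrable (fun r => lapSq e (θ r)) volume s t :=
      (intervalIntegrable_iff_integrableOn_Ioc_of_le ht.1).2 ((h.ae_isH2 hν hx).2.mono_set hsub)
    calc _ = ∫ r in s..t, (β * ν ^ 2 * lapSq e (θ r) + 1 / β * ‖θ r - η r‖ ^ 2) := by
          rw [intervalIntegral.integral_of_le ht.1, intervalIntegral.integral_of_le ht.1]
          refine integral_congr_ae ?_
          filter_upwards [ae_restrict_of_ae_restrict_of_subset hsub (h.ae_isH2 hν hx).1] with r h1
          rw [Summable.tsum_add (h1.mul_left _) ((hasSum_inner_sq e _).summable.mul_left _),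
            tsum_mul_left, tsum_mul_left, (hasSum_inner_sq e _).tsum_eq, lapSq]
      _ ≤ ∫ r in s..t, (β * ν ^ 2 * lapSq e (θ r) + 1 / β * (4 * ‖θ s‖ ^ 2)) := by
          refine intervalIntegral.integral_mono_on ht.1 ((hl.const_mul _).add ?_)
            ((hl.const_mul _).add (by simp)) fun r hr => ?_
          · refine ContinuousOn.intervalIntegrable ?_
            rw [uIcc_of_le ht.1]
            exact (continuousOn_const.mul (hEw.cont.norm.pow 2)).mono (Icc_subset_Icc_right ht.2)
          · have := hwn r ⟨hr.1, hr.2.trans ht.2⟩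
            gcongr
      _ = _ := by
          rw [intervalIntegral.integral_add (hl.const_mul _) (by simp),
            intervalIntegral.integral_const_mul, intervalIntegral.integral_const, smul_eq_mul]
          ring
  · refine Summable.of_nonneg_of_le (fun k => integral_nonneg fun r => abs_nonneg _) (fun k => ?_)
      ((s1.add hηsum).mul_left 2)
    rw [← integral_add (i1 k).abs (hηi k).abs, ← integral_const_mul]
    refine integral_mono_of_nonneg (ae_of_all _ fun r => abs_nonneg _)
      (((i1 k).abs.add (hηi k).abs).const_mul 2) (ae_of_all _ fun r => ?_)
    have h0 := sqLen_nonneg k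
    simp only [inner_sub_right]
    rw [abs_of_nonneg (by positivity), abs_of_nonneg (by positivity), abs_of_nonneg (by positivity)]
    nlinarith [mul_nonneg h0 (sq_nonneg (⟪e k, θ r⟫ + ⟪e k, η r⟫))]
  · refine ((s2.mul_left (β * ν ^ 2)).add (hws.mul_left (1 / β))).congr fun k => ?_
    rw [← integral_const_mul, ← integral_const_mul,
      ← integral_add ((i2 k).abs.const_mul _) ((hwi k).abs.const_mul _)]
    refine integral_congr_ae (ae_of_all _ fun r => ?_)
    have h0 := sqLen_nonneg k
    beta_reduce
    rw [abs_of_nonneg (by positivity), abs_of_nonneg (by positivity), abs_of_nonneg (by positivity)]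
  · have h0 := sqLen_nonneg k
    set X := ν * sqLen k * ⟪e k, θ r⟫
    set Y := ⟪e k, θ r - η r⟫
    have h1 : β * ν ^ 2 * (sqLen k * (sqLen k * ⟪e k, θ r⟫ ^ 2)) = β * X ^ 2 := by
      simp only [X]; ring
    rw [h1, abs_mul, abs_neg]
    have h2 : β * X ^ 2 + 1 / β * Y ^ 2 - 2 * (|X| * |Y|) = (β * |X| - |Y|) ^ 2 / β := by
      rw [← sq_abs X, ← sq_abs Y]; field_simp; ring
    have : 0 ≤ (β * |X| - |Y|) ^ 2 / β := by positivity
    linarith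

end Drift

end

/-! ### Smooth functions on the torus and the Hartley basis -/

section

variable {d : ℕ}

/-- The projection `ℝ^d → 𝕋^d`. -/
noncomputable def toTorus (y : Vec d) : Torus d := fun i => ((y i : ℝ) : AddCircle (2 * Real.pi))

theorem lift_apply {F : Type*} (g : Torus d → F) (y : Vec d) : lift g y = g (toTorus y) := rfl

theorem toTorus_surjective : Function.Surjective (toTorus (d := d)) := by
  intro x
  choose y hy using fun i => QuotientAddGroup.mk_surjective (x i)
  exact ⟨WithLp.toLp 2 y, funext hy⟩

theorem toTorus_add_single (y : Vec d) (i : Fin d) (h : ℝ) :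
    toTorus (y + h • EuclideanSpace.single i 1) =
      toTorus y + Pi.single i (h : AddCircle (2 * Real.pi)) := by
  funext j
  by_cases hj : j = i
  · subst hj; simp [toTorus]
  · simp [toTorus, hj]

theorem isOpenQuotientMap_toTorus : IsOpenQuotientMap (toTorus (d := d)) := by
  refine ⟨toTorus_surjective, ?_, ?_⟩
  · exact continuous_pi fun i => (AddCircle.continuous_mk' _).comp (by fun_prop)
  · have h1 : IsOpenMap (Pi.map fun (_ : Fin d) (y : ℝ) => (y : AddCircle (2 * Real.pi))) :=
      IsOpenMap.piMap (fun _ => QuotientAddGroup.isOpenMap_coe)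
        (Eventually.of_forall fun _ => QuotientAddGroup.mk_surjective)
    exact h1.comp (PiLp.homeomorph 2 fun _ : Fin d => ℝ).isOpenMap

section Smooth

variable {F : Type*} [NormedAddCommGroup F] [NormedSpace ℝ F]

theorem IsSmooth.continuous {g : Torus d → F} (hg : IsSmooth g) : Continuous g :=
  isOpenQuotientMap_toTorus.continuous_comp_iff.1 (ContDiff.continuous hg)

variable {φ ψ : Torus d → ℝ}

theorem IsSmooth.hasDerivAt_lift {g : Torus d → F} (hg : IsSmooth g) (i : Fin d) (y : Vec d) :
    HasDerivAt (fun h : ℝ => g (toTorus y + Pi.single i (h : AddCircle (2 * Real.pi))))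
      (fderiv ℝ (lift g) y (EuclideanSpace.single i 1)) 0 := by
  have h1 : HasFDerivAt (lift g) (fderiv ℝ (lift g) y) (y + (0 : ℝ) • EuclideanSpace.single i 1) := by
    rw [zero_smul, add_zero]
    exact ((hg.differentiable (by simp)) y).hasFDerivAt
  have h2 : HasDerivAt (fun h : ℝ => y + h • EuclideanSpace.single i (1 : ℝ))
      (EuclideanSpace.single i 1) 0 := by
    simpa using ((hasDerivAt_id (0 : ℝ)).smul_const (EuclideanSpace.single i (1 : ℝ))).const_add y
  have h3 := h1.comp_hasDerivAt (0 : ℝ) h2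
  refine h3.congr_of_eventuallyEq (Eventually.of_forall fun h => ?_)
  simp only [Function.comp_apply, lift_apply, toTorus_add_single]

theorem IsSmooth.lift_pderiv (hφ : IsSmooth φ) (i : Fin d) :
    lift (pderiv i φ) = fun y => fderiv ℝ (lift φ) y (EuclideanSpace.single i 1) :=
  funext fun y => (hφ.hasDerivAt_lift i y).deriv

theorem IsSmooth.hasDerivAt (hφ : IsSmooth φ) (i : Fin d) (x : Torus d) (h : ℝ) :
    HasDerivAt (fun h : ℝ => φ (x + Pi.single i (h : AddCircle (2 * Real.pi))))
      (pderiv i φ (x + Pi.single i (h : AddCircle (2 * Real.pi)))) h := by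
  have key : ∀ x, HasDerivAt (fun h : ℝ => φ (x + Pi.single i (h : AddCircle (2 * Real.pi))))
      (pderiv i φ x) 0 := by
    intro x
    obtain ⟨y, rfl⟩ := toTorus_surjective x
    have := hφ.hasDerivAt_lift i y
    rwa [← this.deriv] at this
  have h1 := key (x + Pi.single i (h : AddCircle (2 * Real.pi)))
  rw [← sub_self h] at h1
  have h2 := HasDerivAt.comp_sub_const h h h1
  refine h2.congr_of_eventuallyEq (Eventually.of_forall fun q => ?_)
  beta_reduce
  rw [add_assoc, ← Pi.single_add, ← AddCircle.coe_add, add_sub_cancel]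

theorem IsSmooth.pderiv (hφ : IsSmooth φ) (i : Fin d) : IsSmooth (pderiv i φ) := by
  rw [IsSmooth, hφ.lift_pderiv i]
  exact (hφ.fderiv_right (m := ((⊤ : ℕ∞) : WithTop ℕ∞)) (by simp)).clm_apply contDiff_const

theorem IsSmooth.mul (hφ : IsSmooth φ) (hψ : IsSmooth ψ) : IsSmooth fun x => φ x * ψ x :=
  ContDiff.mul hφ hψ

theorem isSmooth_const (c : ℝ) : IsSmooth (d := d) fun _ => c :=
  (contDiff_const : ContDiff ℝ _ fun _ : Vec d => c)

theorem IsSmooth.const_mul (hφ : IsSmooth φ) (c : ℝ) : IsSmooth fun x => c * φ x :=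
  (isSmooth_const c).mul hφ

theorem isSmooth_sum {ι : Type*} {A : Finset ι} {f : ι → Torus d → ℝ}
    (hf : ∀ k ∈ A, IsSmooth (f k)) : IsSmooth fun x => ∑ k ∈ A, f k x :=
  ContDiff.sum (f := fun k => lift (f k)) hf

theorem IsSmooth.hasDerivAt_zero (hφ : IsSmooth φ) (i : Fin d) (x : Torus d) :
    HasDerivAt (fun h : ℝ => φ (x + Pi.single i (h : AddCircle (2 * Real.pi))))
      (AcceleratedFlow.pderiv i φ x) 0 := by
  simpa using hφ.hasDerivAt i x 0

theorem pderiv_mul (hφ : IsSmooth φ) (hψ : IsSmooth ψ) (i : Fin d) (x : Torus d) :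
    AcceleratedFlow.pderiv i (fun x => φ x * ψ x) x = pderiv i φ x * ψ x + φ x * pderiv i ψ x := by
  have := ((hφ.hasDerivAt_zero i x).fun_mul (hψ.hasDerivAt_zero i x)).deriv
  simpa [AcceleratedFlow.pderiv] using this

theorem pderiv_sum {ι : Type*} {A : Finset ι} {f : ι → Torus d → ℝ}
    (hf : ∀ k ∈ A, IsSmooth (f k)) (i : Fin d) (x : Torus d) :
    AcceleratedFlow.pderiv i (fun x => ∑ k ∈ A, f k x) x = ∑ k ∈ A, pderiv i (f k) x :=
  (HasDerivAt.fun_sum fun k hk => (hf k hk).hasDerivAt_zero i x).deriv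

theorem pderiv_const_mul (hφ : IsSmooth φ) (c : ℝ) (i : Fin d) (x : Torus d) :
    AcceleratedFlow.pderiv i (fun x => c * φ x) x = c * pderiv i φ x :=
  ((hφ.hasDerivAt_zero i x).const_mul c).deriv

theorem pderiv_comm (hφ : IsSmooth φ) (i j : Fin d) (x : Torus d) :
    AcceleratedFlow.pderiv i (AcceleratedFlow.pderiv j φ) x = pderiv j (pderiv i φ) x := by
  obtain ⟨y, rfl⟩ := toTorus_surjective x
  have hd : Differentiable ℝ (fderiv ℝ (lift φ)) :=
    (hφ.fderiv_right (m := ((⊤ : ℕ∞) : WithTop ℕ∞)) (by simp)).differentiable (by simp)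
  have key : ∀ i j, AcceleratedFlow.pderiv i (AcceleratedFlow.pderiv j φ) (toTorus y) =
      fderiv ℝ (fderiv ℝ (lift φ)) y (EuclideanSpace.single i 1) (EuclideanSpace.single j 1) := by
    intro i j
    have h1 := congrFun ((hφ.pderiv j).lift_pderiv i) y
    rw [lift_apply, hφ.lift_pderiv j] at h1
    rw [h1, fderiv_clm_apply (hd y) (by fun_prop)]
    simp
  rw [key, key]
  have hs : IsSymmSndFDerivAt ℝ (lift φ) y :=
    ContDiffAt.isSymmSndFDerivAt (n := ((⊤ : ℕ∞) : WithTop ℕ∞)) hφ.contDiffAt (by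
      simpa using (WithTop.coe_le_coe.2 (le_top : (2 : ℕ∞) ≤ ⊤)))
  exact hs _ _

theorem integrable_of_continuous {E : Type*} [NormedAddCommGroup E] {g : Torus d → E}
    (hg : Continuous g) : Integrable g :=
  hg.integrable_of_hasCompactSupport (HasCompactSupport.of_compactSpace g)

/-- The integral of a translate of `φ` does not depend on the translation; differentiating under the
integral gives the claim. -/
theorem integral_pderiv (hφ : IsSmooth φ) (i : Fin d) : ∫ x, AcceleratedFlow.pderiv i φ x = 0 := by
  have hc := (hφ.pderiv i).continuous
  obtain ⟨C, hC⟩ := isCompact_univ.exists_bound_of_continuousOn hc.continuousOn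
  have h1 := (hasDerivAt_integral_of_dominated_loc_of_deriv_le (μ := (volume : Measure (Torus d)))
    (F := fun (h : ℝ) x => φ (x + Pi.single i (h : AddCircle (2 * Real.pi))))
    (F' := fun (h : ℝ) x => AcceleratedFlow.pderiv i φ
      (x + Pi.single i (h : AddCircle (2 * Real.pi))))
    (x₀ := 0) (s := univ) (bound := fun _ => C) univ_mem
    (Eventually.of_forall fun h => (hφ.continuous.comp (by fun_prop)).aestronglyMeasurable)
    (integrable_of_continuous (hφ.continuous.comp (by fun_prop)))
    (hc.comp (by fun_prop)).aestronglyMeasurable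
    (ae_of_all _ fun x h _ => hC _ (mem_univ _)) (integrable_const _)
    (ae_of_all _ fun x h _ => hφ.hasDerivAt i x h)).2
  have h2 : ∀ h : ℝ, ∫ x : Torus d, φ (x + Pi.single i (h : AddCircle (2 * Real.pi))) = ∫ x, φ x :=
    fun h => integral_add_right_eq_self (μ := (volume : Measure (Torus d))) φ
      (Pi.single i (h : AddCircle (2 * Real.pi)))
  simp only [h2] at h1
  have h3 := h1.unique (hasDerivAt_const (0 : ℝ) _)
  simpa using h3

/-- Integration by parts. -/
theorem integral_mul_pderiv (hφ : IsSmooth φ) (hψ : IsSmooth ψ) (i : Fin d) :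
    ∫ x, φ x * AcceleratedFlow.pderiv i ψ x = -∫ x, pderiv i φ x * ψ x := by
  have h1 := integral_pderiv (hφ.mul hψ) i
  simp only [pderiv_mul hφ hψ] at h1
  rw [integral_add (f := fun x => AcceleratedFlow.pderiv i φ x * ψ x)
    (g := fun x => φ x * AcceleratedFlow.pderiv i ψ x)
    (integrable_of_continuous ((hφ.pderiv i).continuous.mul hψ.continuous))
    (integrable_of_continuous (hφ.continuous.mul (hψ.pderiv i).continuous))] at h1
  linarith

end Smooth

/-! ### A real orthonormal basis of trigonometric functions -/

section Hartley

/-- The character `exp(i k · x)`. -/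
noncomputable def character (k : Fin d → ℤ) (x : Torus d) : ℂ := ∏ i, fourier (k i) (x i)

/-- The function `cos(k · x) + sin(k · x)`. -/
noncomputable def cas (k : Fin d → ℤ) (x : Torus d) : ℝ := (character k x).re + (character k x).im

theorem character_toTorus (k : Fin d → ℤ) (y : Vec d) :
    character k (toTorus y) = Complex.exp ((∑ i, (k i : ℝ) * y i : ℝ) * Complex.I) := by
  have : ∀ i, fourier (k i) (toTorus y i) = Complex.exp (((k i : ℝ) * y i : ℝ) * Complex.I) := by
    intro i
    have h2 : (Real.pi : ℂ) ≠ 0 := by exact_mod_cast Real.pi_ne_zero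
    rw [toTorus, fourier_coe_apply]
    congr 1
    push_cast
    field_simp
  simp only [character, this]
  rw [← Complex.exp_sum]
  congr 1
  push_cast
  rw [Finset.sum_mul]

theorem cas_toTorus (k : Fin d → ℤ) (y : Vec d) : cas k (toTorus y) =
    Real.cos (∑ i, (k i : ℝ) * y i) + Real.sin (∑ i, (k i : ℝ) * y i) := by
  rw [cas, character_toTorus, Complex.exp_ofReal_mul_I_re, Complex.exp_ofReal_mul_I_im]

theorem isSmooth_cas (k : Fin d → ℤ) : IsSmooth (cas k) := by
  have : lift (cas k) = fun y : Vec d =>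
      Real.cos (∑ i, (k i : ℝ) * y i) + Real.sin (∑ i, (k i : ℝ) * y i) :=
    funext fun y => cas_toTorus k y
  rw [IsSmooth, this]
  have h : ContDiff ℝ ((⊤ : ℕ∞) : WithTop ℕ∞) fun y : Vec d => ∑ i, (k i : ℝ) * y i := by
    fun_prop
  exact (Real.contDiff_cos.comp h).add (Real.contDiff_sin.comp h)

/-- The derivative of `cos + sin` is `cos - sin`, which is `cos + sin` at the opposite argument;
hence the reflected index. -/
theorem pderiv_cas (k : Fin d → ℤ) (i : Fin d) (x : Torus d) :
    pderiv i (cas k) x = k i * cas (-k) x := by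
  obtain ⟨y, rfl⟩ := toTorus_surjective x
  set a := ∑ i, (k i : ℝ) * y i with ha
  have h1 : ∀ h : ℝ, cas k (toTorus y + Pi.single i (h : AddCircle (2 * Real.pi))) =
      Real.cos (a + k i * h) + Real.sin (a + k i * h) := by
    intro h
    rw [← toTorus_add_single, cas_toTorus]
    have : ∑ j, (k j : ℝ) * (y + h • EuclideanSpace.single i (1 : ℝ)) j = a + k i * h := by
      simp [mul_add, Finset.sum_add_distrib, ha]
    rw [this]
  have h2 : HasDerivAt (fun h : ℝ => a + k i * h) (k i : ℝ) 0 := by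
    simpa using ((hasDerivAt_id (0 : ℝ)).const_mul (k i : ℝ)).const_add a
  have h3 := (h2.cos.add h2.sin).deriv
  rw [pderiv, funext h1]
  have h4 : ∑ j, ((-k) j : ℝ) * y j = -a := by simp [ha]
  rw [cas_toTorus]
  simp only [Pi.neg_apply, Int.cast_neg, neg_mul, Finset.sum_neg_distrib, Real.cos_neg,
    Real.sin_neg, ← ha]
  refine h3.trans ?_
  simp only [mul_zero, add_zero]
  ring

theorem cas_zero (x : Torus d) : cas 0 x = 1 := by
  simp [cas, character]

/-- Up to a nonzero factor, `cas k` is a partial derivative of `cas (-k)`. -/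
theorem integral_cas {k : Fin d → ℤ} (hk : k ≠ 0) : ∫ x, cas k x = 0 := by
  obtain ⟨i, hi⟩ := Function.ne_iff.1 hk
  have h1 := integral_pderiv (isSmooth_cas (-k)) i
  simp only [pderiv_cas, neg_neg] at h1
  rw [integral_const_mul] at h1
  refine (mul_eq_zero.1 h1).resolve_left ?_
  simpa using hi

/-- This product formula gives the orthogonality relations and makes the span of the functions an
algebra. -/
theorem cas_mul_cas (k l : Fin d → ℤ) (x : Torus d) :
    cas k x * cas l x =
      1 / 2 * (cas (k - l) x + cas (l - k) x + cas (k + l) x - cas (-(k + l)) x) := by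
  obtain ⟨y, rfl⟩ := toTorus_surjective x
  simp only [cas_toTorus]
  set a := ∑ i, (k i : ℝ) * y i with ha
  set b := ∑ i, (l i : ℝ) * y i with hb
  have h1 : ∑ i, ((k - l) i : ℝ) * y i = a - b := by
    simp [ha, hb, sub_mul, Finset.sum_sub_distrib]
  have h2 : ∑ i, ((l - k) i : ℝ) * y i = b - a := by
    simp [ha, hb, sub_mul, Finset.sum_sub_distrib]
  have h3 : ∑ i, ((k + l) i : ℝ) * y i = a + b := by
    simp [ha, hb, add_mul, Finset.sum_add_distrib]
  have h4 : ∑ i, ((-(k + l)) i : ℝ) * y i = -(a + b) := by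
    rw [← h3]; simp [add_mul, Finset.sum_add_distrib]
  rw [h1, h2, h3, h4, Real.cos_neg, Real.sin_neg, Real.cos_sub, Real.cos_sub, Real.sin_sub,
    Real.sin_sub, Real.sin_add]
  ring

theorem volume_real_torus : (volume : Measure (Torus d)).real univ = (2 * Real.pi) ^ d := by
  rw [Measure.real, volume_pi, Measure.pi_univ]
  simp only [AddCircle.measure_univ, Finset.prod_const, Finset.card_univ, Fintype.card_fin]
  rw [ENNReal.toReal_pow, ENNReal.toReal_ofReal Real.two_pi_pos.le]

theorem integral_cas_mul_cas (k l : Fin d → ℤ) :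
    ∫ x, cas k x * cas l x = if k = l then (2 * Real.pi) ^ d else 0 := by
  simp only [cas_mul_cas]
  have hi : ∀ k, Integrable (cas (d := d) k) := fun k =>
    integrable_of_continuous (isSmooth_cas k).continuous
  rw [integral_const_mul,
    integral_sub (f := fun x => cas (k - l) x + cas (l - k) x + cas (k + l) x)
      (((hi _).fun_add (hi _)).fun_add (hi _)) (hi _),
    integral_add (f := fun x => cas (k - l) x + cas (l - k) x) ((hi _).fun_add (hi _)) (hi _),
    integral_add (hi _) (hi _)]
  have h0 : ∫ x : Torus d, cas 0 x = (2 * Real.pi) ^ d := by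
    simp [cas_zero, volume_real_torus]
  have h1 : ∫ x, cas (k + l) x = ∫ x, cas (-(k + l)) x := by
    by_cases h : k + l = 0
    · rw [h, neg_zero]
    · rw [integral_cas h, integral_cas (neg_ne_zero.2 h)]
  rw [h1, add_sub_cancel_right]
  split_ifs with h
  · rw [h, sub_self, h0]; ring
  · rw [integral_cas (sub_ne_zero.2 h), integral_cas (sub_ne_zero.2 (Ne.symm h))]; simp

/-- The function `cas k` as a continuous map. -/
noncomputable def casC (k : Fin d → ℤ) : C(Torus d, ℝ) := ⟨cas k, (isSmooth_cas k).continuous⟩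

/-- Stone-Weierstrass. Points are separated because `cas k` and `cas (-k)` together determine the
character `exp(i k·x)`, and the characters of the coordinate vectors determine `x`. -/
theorem span_casC_closure : (Submodule.span ℝ (range (casC (d := d)))).topologicalClosure = ⊤ := by
  set p := Submodule.span ℝ (range (casC (d := d)))
  have hmem : ∀ k, casC k ∈ p := fun k => Submodule.subset_span ⟨k, rfl⟩
  have hone : (1 : C(Torus d, ℝ)) ∈ p := by
    have : (1 : C(Torus d, ℝ)) = casC 0 := by ext x; simp [casC, cas_zero]
    rw [this]; exact hmem 0
  have hmul : ∀ x y, x ∈ p → y ∈ p → x * y ∈ p := by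
    intro x y hx hy
    have h1 : p * p ≤ p := by
      rw [Submodule.span_mul_span, Submodule.span_le]
      rintro _ ⟨_, ⟨k, rfl⟩, _, ⟨l, rfl⟩, rfl⟩
      have : casC k * casC l = (1 / 2 : ℝ) •
          (casC (k - l) + casC (l - k) + casC (k + l) - casC (-(k + l))) := by
        ext x; exact cas_mul_cas k l x
      simp only [SetLike.mem_coe, this]
      exact p.smul_mem _ (p.sub_mem (p.add_mem (p.add_mem (hmem _) (hmem _)) (hmem _)) (hmem _))
    exact h1 (Submodule.mul_mem_mul hx hy)
  have hsep : (p.toSubalgebra hone hmul).SeparatesPoints := by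
    intro x y hxy
    obtain ⟨i, hi⟩ := Function.ne_iff.1 hxy
    by_contra hcon
    have h1 : ∀ k, cas k x = cas k y := by
      intro k
      by_contra h
      exact hcon ⟨_, ⟨casC k, hmem k, rfl⟩, h⟩
    have hch : ∀ z : Torus d, character (Pi.single i 1) z = fourier 1 (z i) := by
      intro z
      rw [character, Finset.prod_eq_single i]
      · simp
      · intro j _ hj; simp [hj]
      · simp
    have hneg : ∀ (k : Fin d → ℤ) (z : Torus d),
        cas (-k) z = (character k z).re - (character k z).im := by
      intro k z
      have : character (-k) z = (starRingEnd ℂ) (character k z) := by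
        simp only [character, Pi.neg_apply, fourier_neg, map_prod]
      rw [cas, this, Complex.conj_re, Complex.conj_im, sub_eq_add_neg]
    have h2 := h1 (Pi.single i 1)
    have h3 := h1 (-Pi.single i 1)
    rw [hneg, hneg] at h3
    rw [cas, cas] at h2
    have h4 : character (Pi.single i 1) x = character (Pi.single i 1) y :=
      Complex.ext (by linarith) (by linarith)
    rw [hch, hch, fourier_one, fourier_one] at h4
    exact hi (AddCircle.injective_toCircle Real.two_pi_pos.ne' (Subtype.coe_injective h4))
  have := ContinuousMap.subalgebra_topologicalClosure_eq_top_of_separatesPoints _ hsep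
  exact congrArg Subalgebra.toSubmodule this

/-- The normalization constant of the Hartley basis. -/
noncomputable def casNorm (d : ℕ) : ℝ := (√((2 * Real.pi) ^ d))⁻¹

theorem casNorm_pos (d : ℕ) : 0 < casNorm d := by
  have := Real.pi_pos
  unfold casNorm
  positivity

theorem casNorm_sq (d : ℕ) : casNorm d * casNorm d * (2 * Real.pi) ^ d = 1 := by
  have h : 0 < (2 * Real.pi) ^ d := pow_pos Real.two_pi_pos d
  have hne := h.ne'
  rw [casNorm, ← mul_inv, Real.mul_self_sqrt h.le, inv_mul_cancel₀ hne]

/-- The normalized functions `cas k` in `L²`. -/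
noncomputable def casL2 (k : Fin d → ℤ) : L2 d :=
  ContinuousMap.toLp 2 volume ℝ (casNorm d • casC k)

theorem coeFn_casL2 (k : Fin d → ℤ) : casL2 k =ᵐ[volume] fun x => casNorm d * cas k x :=
  ContinuousMap.coeFn_toLp volume (casNorm d • casC k)

theorem orthonormal_casL2 : Orthonormal ℝ (casL2 (d := d)) := by
  classical
  rw [orthonormal_iff_ite]
  intro k l
  rw [casL2, casL2, ContinuousMap.inner_toLp]
  have : ∀ x : Torus d, (casNorm d • casC l) x * (starRingEnd ℝ) ((casNorm d • casC k) x) =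
      casNorm d * casNorm d * (cas k x * cas l x) := by
    intro x
    simp only [ContinuousMap.smul_apply, smul_eq_mul, conj_trivial, casC, ContinuousMap.coe_mk]
    ring
  simp only [this]
  rw [integral_const_mul, integral_cas_mul_cas]
  split_ifs
  · exact casNorm_sq d
  · simp

theorem span_casL2_closure : (Submodule.span ℝ (range (casL2 (d := d)))).topologicalClosure = ⊤ := by
  have h1 := (ContinuousMap.toLp_denseRange (p := 2) ℝ (volume : Measure (Torus d)) ℝ
    (by simp)).topologicalClosure_map_submodule (span_casC_closure (d := d))
  rw [Submodule.map_span] at h1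
  refine top_unique (h1.ge.trans (Submodule.topologicalClosure_mono ?_))
  rw [Submodule.span_le]
  rintro _ ⟨_, ⟨k, rfl⟩, rfl⟩
  have : casC k = (casNorm d)⁻¹ • (casNorm d • casC k) := by
    rw [smul_smul, inv_mul_cancel₀ (casNorm_pos d).ne', one_smul]
  rw [this, map_smul]
  exact Submodule.smul_mem _ _ (Submodule.subset_span ⟨k, rfl⟩)

/-- The Hartley basis of `L²(𝕋^d)`. -/
noncomputable def hartley (d : ℕ) : HilbertBasis (Fin d → ℤ) ℝ (L2 d) :=
  HilbertBasis.mk orthonormal_casL2 span_casL2_closure.ge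

theorem hartley_apply (k : Fin d → ℤ) : hartley d k = casL2 k := by
  rw [hartley, HilbertBasis.coe_mk]

theorem coeFn_hartley (k : Fin d → ℤ) : hartley d k =ᵐ[volume] fun x => casNorm d * cas k x := by
  rw [hartley_apply]; exact coeFn_casL2 k

end Hartley

end

/-! ### Multiplication operators and gradients -/

section

variable {d : ℕ}

theorem inner_L2_eq (x y : L2 d) : ⟪x, y⟫ = ∫ z, x z * y z := by
  rw [L2.inner_def]
  exact integral_congr_ae (ae_of_all _ fun z => by simp [mul_comm])

theorem integrable_mul_L2 (x y : L2 d) : Integrable fun z => x z * y z :=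
  (Lp.memLp x).integrable_mul (Lp.memLp y)

/-- A continuous function as an element of `L²`. -/
noncomputable def contL2 (φ : Torus d → ℝ) (h : Continuous φ) : L2 d :=
  ContinuousMap.toLp 2 volume ℝ ⟨φ, h⟩

theorem coeFn_contL2 {φ : Torus d → ℝ} (h : Continuous φ) : contL2 φ h =ᵐ[volume] φ :=
  ContinuousMap.coeFn_toLp volume ⟨φ, h⟩

theorem inner_contL2 {φ : Torus d → ℝ} (h : Continuous φ) (x : L2 d) :
    ⟪contL2 φ h, x⟫ = ∫ z, x z * φ z := by
  rw [inner_L2_eq]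
  refine integral_congr_ae ?_
  filter_upwards [coeFn_contL2 h] with z hz
  rw [hz, mul_comm]

theorem inner_hartley (k : Fin d → ℤ) (x : L2 d) :
    ⟪hartley d k, x⟫ = casNorm d * ∫ z, x z * cas k z := by
  rw [inner_L2_eq, ← integral_const_mul]
  refine integral_congr_ae ?_
  filter_upwards [coeFn_hartley k] with z hz
  rw [hz]; ring

theorem inner_hartley_contL2 {φ : Torus d → ℝ} (h : Continuous φ) (k : Fin d → ℤ) :
    ⟪hartley d k, contL2 φ h⟫ = casNorm d * ∫ z, φ z * cas k z := by
  rw [inner_hartley]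
  congr 1
  refine integral_congr_ae ?_
  filter_upwards [coeFn_contL2 h] with z hz
  rw [hz]

theorem inner_hartley_pderiv {φ : Torus d → ℝ} (hφ : IsSmooth φ) (j : Fin d) (k : Fin d → ℤ) :
    ⟪hartley d (-k), contL2 (pderiv j φ) (hφ.pderiv j).continuous⟫ =
      k j * ⟪hartley d k, contL2 φ hφ.continuous⟫ := by
  rw [inner_hartley_contL2, inner_hartley_contL2]
  have h1 := integral_mul_pderiv hφ (isSmooth_cas (-k)) j
  simp only [pderiv_cas, neg_neg] at h1
  have h2 : ∫ z, φ z * (((-k) j : ℤ) * cas k z) = -((k j : ℝ) * ∫ z, φ z * cas k z) := by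
    rw [← integral_const_mul, ← integral_neg]
    refine integral_congr_ae (ae_of_all _ fun z => ?_)
    simp only [Pi.neg_apply, Int.cast_neg]; ring
  rw [h2] at h1
  have h3 : ∫ z, pderiv j φ z * cas (-k) z = k j * ∫ z, φ z * cas k z := by linarith
  rw [h3]; ring

theorem IsSmooth.lap {φ : Torus d → ℝ} (hφ : IsSmooth φ) : IsSmooth (lap φ) :=
  isSmooth_sum (A := Finset.univ) (f := fun i => AcceleratedFlow.pderiv i (AcceleratedFlow.pderiv i φ))
    fun i _ => (hφ.pderiv i).pderiv i

theorem inner_hartley_lap {φ : Torus d → ℝ} (hφ : IsSmooth φ) (k : Fin d → ℤ) :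
    ⟪hartley d k, contL2 (lap φ) hφ.lap.continuous⟫ =
      -(sqLen k * ⟪hartley d k, contL2 φ hφ.continuous⟫) := by
  have h0 : contL2 (lap φ) hφ.lap.continuous =
      ∑ j, contL2 (pderiv j (pderiv j φ)) ((hφ.pderiv j).pderiv j).continuous := by
    simp only [contL2]
    rw [← map_sum]
    congr 1
    ext x
    simp [AcceleratedFlow.lap]
  rw [h0, inner_sum]
  have h1 : ∀ j, ⟪hartley d k, contL2 (pderiv j (pderiv j φ)) ((hφ.pderiv j).pderiv j).continuous⟫ =
      -((k j : ℝ) ^ 2 * ⟪hartley d k, contL2 φ hφ.continuous⟫) := by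
    intro j
    have h2 := inner_hartley_pderiv (hφ.pderiv j) j (-k)
    have h3 := inner_hartley_pderiv hφ j k
    rw [neg_neg] at h2
    rw [h2, h3]
    simp only [Pi.neg_apply, Int.cast_neg]; ring
  simp only [h1]
  rw [Finset.sum_neg_distrib, sqLen, Finset.sum_mul]

theorem isH1_contL2 {φ : Torus d → ℝ} (hφ : IsSmooth φ) :
    IsH1 (hartley d) (contL2 φ hφ.continuous) := by
  have : ∀ k, sqLen k * ⟪hartley d k, contL2 φ hφ.continuous⟫ ^ 2 =
      ∑ j, ⟪hartley d (-k), contL2 (pderiv j φ) (hφ.pderiv j).continuous⟫ ^ 2 := by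
    intro k
    simp only [inner_hartley_pderiv hφ, sqLen, Finset.sum_mul, mul_pow]
  unfold IsH1
  simp only [this]
  exact summable_sum fun j _ =>
    ((Equiv.neg (Fin d → ℤ)).hasSum_iff.2 (hasSum_inner_sq (hartley d) _)).summable

theorem summable_sqLen_sq_contL2 {φ : Torus d → ℝ} (hφ : IsSmooth φ) :
    Summable fun k => (sqLen k * ⟪hartley d k, contL2 φ hφ.continuous⟫) ^ 2 := by
  have := (hasSum_inner_sq (hartley d) (contL2 (lap φ) hφ.lap.continuous)).summable
  simpa only [inner_hartley_lap hφ, neg_sq] using this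

/-- Expansion of the pairing of an `L²` vector field with a gradient. -/
theorem hasSum_inner_pderiv (w : Fin d → L2 d) {φ : Torus d → ℝ} (hφ : IsSmooth φ) :
    HasSum (fun k => ⟪hartley d k, contL2 φ hφ.continuous⟫ *
        ∑ j, (k j : ℝ) * ⟪hartley d (-k), w j⟫)
      (∑ j, ⟪contL2 (pderiv j φ) (hφ.pderiv j).continuous, w j⟫) := by
  have h1 : ∀ j, HasSum (fun k => ⟪hartley d k, contL2 φ hφ.continuous⟫ *
      ((k j : ℝ) * ⟪hartley d (-k), w j⟫))
      ⟪contL2 (pderiv j φ) (hφ.pderiv j).continuous, w j⟫ := by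
    intro j
    have := (Equiv.neg (Fin d → ℤ)).hasSum_iff.2 ((hartley d).hasSum_inner_mul_inner
      (contL2 (pderiv j φ) (hφ.pderiv j).continuous) (w j))
    refine this.congr_fun fun k => ?_
    simp only [Function.comp_apply, Equiv.neg_apply]
    rw [real_inner_comm (hartley d (-k)) (contL2 (pderiv j φ) _), inner_hartley_pderiv hφ]
    ring
  have h2 := hasSum_sum fun j (_ : j ∈ Finset.univ) => h1 j
  simpa only [← Finset.mul_sum] using h2

theorem inner_grad (a : Vec d) (φ : Torus d → ℝ) (x : Torus d) :
    inner ℝ a (grad φ x) = ∑ j, a j * pderiv j φ x := by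
  simp [grad, PiLp.inner_apply, mul_comm]

/-- A velocity field, measurable, bounded by `M`, and divergence free, at all times. -/
structure IsRegular (w : ℝ → Torus d → Vec d) (M : ℝ) : Prop where
  meas : StronglyMeasurable fun z : ℝ × Torus d => w z.1 z.2
  bound : ∀ r x, ‖w r x‖ ≤ M
  div : ∀ r k, ∫ x, inner ℝ (w r x) (grad (cas k) x) = 0

/-- Multiplication by a bounded function. -/
noncomputable def mulOp (g : Torus d → ℝ) (hg : AEStronglyMeasurable g volume) (C : ℝ)
    (hC : ∀ x, ‖g x‖ ≤ C) : L2 d →L[ℝ] L2 d :=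
  LinearMap.mkContinuous
    { toFun := fun θ => ((Lp.memLp θ).of_le_mul (g := θ) (c := C)
        (f := fun x => g x * θ x) (hg.mul (Lp.aestronglyMeasurable θ))
        (ae_of_all _ fun x => by
          rw [norm_mul]; exact mul_le_mul_of_nonneg_right (hC x) (norm_nonneg _))).toLp
      map_add' := by
        intro θ η
        rw [← MemLp.toLp_add]
        refine MemLp.toLp_congr _ _ ?_
        filter_upwards [Lp.coeFn_add θ η] with x hx
        simp only [hx, Pi.add_apply]; ring
      map_smul' := by
        intro c θ
        rw [RingHom.id_apply, ← MemLp.toLp_const_smul]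
        refine MemLp.toLp_congr _ _ ?_
        filter_upwards [Lp.coeFn_smul c θ] with x hx
        simp only [hx, Pi.smul_apply, smul_eq_mul]; ring } C (by
      intro θ
      refine Lp.norm_le_mul_norm_of_ae_le_mul ?_
      filter_upwards [MemLp.coeFn_toLp ((Lp.memLp θ).of_le_mul (g := θ) (c := C)
        (f := fun x => g x * θ x) (hg.mul (Lp.aestronglyMeasurable θ))
        (ae_of_all _ fun x => by
          rw [norm_mul]; exact mul_le_mul_of_nonneg_right (hC x) (norm_nonneg _)))] with x hx
      simp only [LinearMap.coe_mk, AddHom.coe_mk]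
      rw [hx, norm_mul]
      exact mul_le_mul_of_nonneg_right (hC x) (norm_nonneg _))

theorem coeFn_mulOp {g : Torus d → ℝ} (hg : AEStronglyMeasurable g volume) {C : ℝ}
    (hC : ∀ x, ‖g x‖ ≤ C) (θ : L2 d) : mulOp g hg C hC θ =ᵐ[volume] fun x => g x * θ x := by
  simp only [mulOp, LinearMap.mkContinuous_apply, LinearMap.coe_mk, AddHom.coe_mk]
  exact MemLp.coeFn_toLp _

namespace IsRegular

variable {w : ℝ → Torus d → Vec d} {M : ℝ} (hw : IsRegular w M)

theorem meas_comp (hw : IsRegular w M) (r : ℝ) (j : Fin d) :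
    AEStronglyMeasurable (fun x => w r x j) volume := by
  have h1 : StronglyMeasurable fun x => w r x := hw.meas.comp_measurable measurable_prodMk_left
  exact ((EuclideanSpace.proj (𝕜 := ℝ) j).continuous.comp_stronglyMeasurable h1).aestronglyMeasurable

theorem bound_comp (hw : IsRegular w M) (r : ℝ) (j : Fin d) (x : Torus d) : ‖w r x j‖ ≤ M :=
  (PiLp.norm_apply_le (w r x) j).trans (hw.bound r x)

/-- Multiplication by a component of the velocity field. -/
noncomputable def op (hw : IsRegular w M) (r : ℝ) (j : Fin d) : L2 d →L[ℝ] L2 d :=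
  mulOp (fun x => w r x j) (hw.meas_comp r j) M (hw.bound_comp r j)

theorem coeFn_op (hw : IsRegular w M) (r : ℝ) (j : Fin d) (θ : L2 d) :
    hw.op r j θ =ᵐ[volume] fun x => w r x j * θ x := coeFn_mulOp _ _ θ

theorem memLp_comp (hw : IsRegular w M) (r : ℝ) (j : Fin d) :
    MemLp (fun x => w r x j) 2 volume :=
  MemLp.of_bound (hw.meas_comp r j) M (ae_of_all _ (hw.bound_comp r j))

theorem integral_inner_grad (hw : IsRegular w M) (r : ℝ) {φ : Torus d → ℝ} (hφ : IsSmooth φ) :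
    ∫ x, inner ℝ (w r x) (grad φ x) = ∑ j, ⟪contL2 (pderiv j φ) (hφ.pderiv j).continuous,
      (hw.memLp_comp r j).toLp⟫ := by
  have hae : ∀ j, ((hw.memLp_comp r j).toLp : Torus d → ℝ) =ᵐ[volume] fun x => w r x j :=
    fun j => MemLp.coeFn_toLp _
  simp only [inner_contL2, inner_grad]
  rw [integral_finsetSum]
  · refine Finset.sum_congr rfl fun j _ => integral_congr_ae ?_
    filter_upwards [hae j] with x hx
    rw [hx]
  · intro j _
    refine (integrable_mul_L2 (hw.memLp_comp r j).toLp
      (contL2 (pderiv j φ) (hφ.pderiv j).continuous)).congr ?_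
    filter_upwards [hae j, coeFn_contL2 (hφ.pderiv j).continuous] with x h1 h2
    rw [h1, h2]

/-- A divergence free field is orthogonal to all gradients. -/
theorem integral_grad_eq_zero (hw : IsRegular w M) (r : ℝ) {φ : Torus d → ℝ} (hφ : IsSmooth φ) :
    ∫ x, inner ℝ (w r x) (grad φ x) = 0 := by
  rw [hw.integral_inner_grad r hφ]
  refine (hasSum_inner_pderiv _ hφ).unique ?_
  -- Testing with `cas k` alone shows that each coefficient of the divergence vanishes, and these
  -- are the factors in the expansion for a general `φ`.
  have : ∀ k : Fin d → ℤ, ∑ j, (k j : ℝ) * ⟪hartley d (-k), (hw.memLp_comp r j).toLp⟫ = 0 := by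
    intro k
    have h1 := hw.div r k
    rw [hw.integral_inner_grad r (isSmooth_cas k)] at h1
    have h2 : ∀ j, ⟪contL2 (pderiv j (cas k)) ((isSmooth_cas k).pderiv j).continuous,
        (hw.memLp_comp r j).toLp⟫ = (casNorm d)⁻¹ *
          ((k j : ℝ) * ⟪hartley d (-k), (hw.memLp_comp r j).toLp⟫) := by
      intro j
      rw [inner_contL2, inner_hartley]
      simp only [pderiv_cas]
      have h3 : ∀ z, ((hw.memLp_comp r j).toLp : L2 d) z * (k j * cas (-k) z) =
          k j * (((hw.memLp_comp r j).toLp : L2 d) z * cas (-k) z) := fun z => by ring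
      simp only [h3]
      rw [integral_const_mul]
      have := (casNorm_pos d).ne'
      field_simp
    simp only [h2] at h1
    rw [← Finset.mul_sum] at h1
    exact (mul_eq_zero.1 h1).resolve_left (inv_ne_zero (casNorm_pos d).ne')
  simp only [this, mul_zero]
  exact hasSum_zero

theorem inner_op (hw : IsRegular w M) (r : ℝ) (j : Fin d) (y θ : L2 d) :
    ⟪y, hw.op r j θ⟫ = ∫ x, w r x j * (θ x * y x) := by
  rw [inner_L2_eq]
  refine integral_congr_ae ?_
  filter_upwards [hw.coeFn_op r j θ] with x hx
  rw [hx]; ring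

theorem integrable_op (hw : IsRegular w M) (r : ℝ) (j : Fin d) (y θ : L2 d) :
    Integrable fun x => w r x j * (θ x * y x) := by
  refine (integrable_mul_L2 (hw.op r j θ) y).congr ?_
  filter_upwards [hw.coeFn_op r j θ] with x hx
  rw [hx]; ring

/-- The transport term against a smooth function. -/
theorem sum_inner_op (hw : IsRegular w M) (r : ℝ) (θ : L2 d) {φ : Torus d → ℝ} (hφ : IsSmooth φ) :
    ∑ j, ⟪contL2 (pderiv j φ) (hφ.pderiv j).continuous, hw.op r j θ⟫ =
      ∫ x, θ x * inner ℝ (w r x) (grad φ x) := by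
  simp only [hw.inner_op, inner_grad]
  rw [← integral_finsetSum _ fun j _ => hw.integrable_op r j _ θ]
  have h : ∀ᵐ x ∂(volume : Measure (Torus d)), ∀ j : Fin d,
      contL2 (pderiv j φ) (hφ.pderiv j).continuous x = pderiv j φ x :=
    ae_all_iff.2 fun j => coeFn_contL2 _
  refine integral_congr_ae ?_
  filter_upwards [h] with x hx
  rw [Finset.mul_sum]
  refine Finset.sum_congr rfl fun j _ => ?_
  rw [hx j]; ring

end IsRegular

end

/-! ### Weak solutions and coefficients -/

section

variable {d : ℕ}

namespace IsRegular

variable {w : ℝ → Torus d → Vec d} {M : ℝ}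

theorem sum_inner_hartley_op (hw : IsRegular w M) (r : ℝ) (k : Fin d → ℤ) (θ : L2 d) :
    ∑ j, (k j : ℝ) * ⟪hartley d (-k), hw.op r j θ⟫ =
      casNorm d * ∫ x, θ x * inner ℝ (w r x) (grad (cas k) x) := by
  rw [← hw.sum_inner_op r θ (isSmooth_cas k), Finset.mul_sum]
  refine Finset.sum_congr rfl fun j _ => ?_
  rw [inner_contL2, inner_hartley]
  simp only [pderiv_cas]
  have h3 : ∀ z, hw.op r j θ z * (k j * cas (-k) z) =
      k j * (hw.op r j θ z * cas (-k) z) := fun z => by ring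
  simp only [h3]
  rw [integral_const_mul]
  ring

theorem grad_mul {φ ψ : Torus d → ℝ} (hφ : IsSmooth φ) (hψ : IsSmooth ψ) (a : Vec d)
    (x : Torus d) : inner ℝ a (grad (fun x => φ x * ψ x) x) =
      φ x * inner ℝ a (grad ψ x) + ψ x * inner ℝ a (grad φ x) := by
  simp only [inner_grad, pderiv_mul hφ hψ, Finset.mul_sum, ← Finset.sum_add_distrib]
  exact Finset.sum_congr rfl fun j _ => by ring

theorem integrable_mul_inner_grad (hw : IsRegular w M) (r : ℝ) (θ : L2 d) {φ : Torus d → ℝ}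
    (hφ : IsSmooth φ) : Integrable fun x => θ x * inner ℝ (w r x) (grad φ x) := by
  simp only [inner_grad, Finset.mul_sum]
  refine integrable_finsetSum _ fun j _ => ?_
  refine (hw.integrable_op r j (contL2 (pderiv j φ) (hφ.pderiv j).continuous) θ).congr ?_
  filter_upwards [coeFn_contL2 (hφ.pderiv j).continuous] with x hx
  rw [hx]; ring

theorem integrable_mul_inner_grad' (hw : IsRegular w M) (r : ℝ) {φ ψ : Torus d → ℝ}
    (hψ : Continuous ψ) (hφ : IsSmooth φ) :
    Integrable fun x => ψ x * inner ℝ (w r x) (grad φ x) := by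
  refine (hw.integrable_mul_inner_grad r (contL2 ψ hψ) hφ).congr ?_
  filter_upwards [coeFn_contL2 hψ] with x hx
  rw [hx]

/-- A divergence free field is orthogonal to the gradient of the product `φ ψ`. This is the source
of the skewness in `Drift`. -/
theorem integral_mul_inner_grad (hw : IsRegular w M) (r : ℝ) {φ ψ : Torus d → ℝ}
    (hφ : IsSmooth φ) (hψ : IsSmooth ψ) :
    ∫ x, φ x * inner ℝ (w r x) (grad ψ x) = -∫ x, ψ x * inner ℝ (w r x) (grad φ x) := by
  have h := hw.integral_grad_eq_zero r (hφ.mul hψ)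
  simp only [grad_mul hφ hψ] at h
  rw [integral_add (f := fun x => φ x * inner ℝ (w r x) (grad ψ x))
    (hw.integrable_mul_inner_grad' r hφ.continuous hψ)
    (hw.integrable_mul_inner_grad' r hψ.continuous hφ)] at h
  linarith

theorem sum_norm_op_sq_le (hw : IsRegular w M) (r : ℝ) (θ : L2 d) :
    ∑ j, ‖hw.op r j θ‖ ^ 2 ≤ M ^ 2 * ‖θ‖ ^ 2 := by
  have h1 : ∀ j, ‖hw.op r j θ‖ ^ 2 = ∫ x, hw.op r j θ x * hw.op r j θ x := fun j => by
    rw [← real_inner_self_eq_norm_sq, inner_L2_eq]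
  simp only [h1]
  rw [← integral_finsetSum _ fun j _ => integrable_mul_L2 _ _, ← real_inner_self_eq_norm_sq,
    inner_L2_eq, ← integral_const_mul]
  refine integral_mono_ae (integrable_finsetSum _ fun j _ => integrable_mul_L2 _ _)
    ((integrable_mul_L2 _ _).const_mul _) ?_
  filter_upwards [ae_all_iff.2 fun j => hw.coeFn_op r j θ] with x hx
  simp only [hx]
  have h2 : ∑ j, w r x j ^ 2 ≤ M ^ 2 := by
    have := EuclideanSpace.real_norm_sq_eq (w r x)
    rw [← this]
    exact pow_le_pow_left₀ (norm_nonneg _) (hw.bound r x) 2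
  calc ∑ j, w r x j * θ x * (w r x j * θ x) = (∑ j, w r x j ^ 2) * (θ x * θ x) := by
        rw [Finset.sum_mul]; exact Finset.sum_congr rfl fun j _ => by ring
    _ ≤ _ := mul_le_mul_of_nonneg_right h2 (mul_self_nonneg _)

theorem aestronglyMeasurable_inner_op (hw : IsRegular w M) (j : Fin d) (x y : L2 d) :
    AEStronglyMeasurable (fun r => ⟪y, hw.op r j x⟫) volume := by
  simp only [hw.inner_op]
  have h1 : StronglyMeasurable fun z : ℝ × Torus d => w z.1 z.2 j :=
    (EuclideanSpace.proj (𝕜 := ℝ) j).continuous.comp_stronglyMeasurable hw.meas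
  have h2 : StronglyMeasurable fun z : ℝ × Torus d => w z.1 z.2 j * (x z.2 * y z.2) :=
    h1.mul (((Lp.stronglyMeasurable x).mul (Lp.stronglyMeasurable y)).comp_measurable
      measurable_snd)
  exact h2.integral_prod_right'.aestronglyMeasurable

theorem M_nonneg (hw : IsRegular w M) : 0 ≤ M :=
  (norm_nonneg _).trans (hw.bound 0 0)

theorem skew_op (hw : IsRegular w M) (r : ℝ) (k l : Fin d → ℤ) :
    ∑ j, (k j : ℝ) * ⟪hartley d (-k), hw.op r j (hartley d l)⟫ =
      -∑ j, (l j : ℝ) * ⟪hartley d (-l), hw.op r j (hartley d k)⟫ := by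
  have h : ∀ k l : Fin d → ℤ, ∫ x, hartley d l x * inner ℝ (w r x) (grad (cas k) x) =
      casNorm d * ∫ x, cas l x * inner ℝ (w r x) (grad (cas k) x) := by
    intro k l
    rw [← integral_const_mul]
    refine integral_congr_ae ?_
    filter_upwards [coeFn_hartley l] with x hx
    rw [hx]; ring
  rw [hw.sum_inner_hartley_op, hw.sum_inner_hartley_op, h, h,
    hw.integral_mul_inner_grad r (isSmooth_cas l) (isSmooth_cas k)]
  ring

/-- The drift of a regular velocity field. -/
noncomputable def drift (hw : IsRegular w M) : Drift (hartley d) where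
  B := hw.op
  M := M
  M_nonneg := hw.M_nonneg
  bound := hw.sum_norm_op_sq_le
  meas := hw.aestronglyMeasurable_inner_op
  skew := hw.skew_op

theorem drift_F (hw : IsRegular w M) (r : ℝ) (k : Fin d → ℤ) (θ : L2 d) :
    hw.drift.F r k θ = casNorm d * ∫ x, θ x * inner ℝ (w r x) (grad (cas k) x) := by
  rw [Drift.F_apply]
  exact hw.sum_inner_hartley_op r k θ

theorem lap_cas (k : Fin d → ℤ) (x : Torus d) : lap (cas k) x = -(sqLen k * cas k x) := by
  have h : ∀ i, pderiv i (pderiv i (cas k)) x = -((k i : ℝ) ^ 2 * cas k x) := by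
    intro i
    rw [show pderiv i (cas k) = fun x => k i * cas (-k) x from funext fun x => pderiv_cas k i x,
      pderiv_const_mul (isSmooth_cas _), pderiv_cas, neg_neg]
    simp only [Pi.neg_apply, Int.cast_neg]; ring
  simp only [lap, h]
  rw [Finset.sum_neg_distrib, sqLen, Finset.sum_mul]

theorem integral_weak (hw : IsRegular w M) (ν r : ℝ) (x : L2 d) {φ : Torus d → ℝ}
    (hφ : IsSmooth φ) : ∫ z, x z * (ν * lap φ z + inner ℝ (w r z) (grad φ z)) =
      ν * ⟪contL2 (lap φ) hφ.lap.continuous, x⟫ + ∫ z, x z * inner ℝ (w r z) (grad φ z) := by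
  rw [inner_contL2, ← integral_const_mul, ← integral_add]
  · exact integral_congr_ae (ae_of_all _ fun z => by ring)
  · refine Integrable.const_mul ?_ ν
    refine (integrable_mul_L2 x (contL2 (lap φ) hφ.lap.continuous)).congr ?_
    filter_upwards [coeFn_contL2 hφ.lap.continuous] with z hz
    rw [hz]
  · exact hw.integrable_mul_inner_grad r x hφ

theorem rhs_eq (hw : IsRegular w M) (ν : ℝ) (θ : ℝ → L2 d) (k : Fin d → ℤ) (r : ℝ) :
    hw.drift.rhs ν θ k r = casNorm d *
      ∫ z, θ r z * (ν * lap (cas k) z + inner ℝ (w r z) (grad (cas k) z)) := by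
  rw [hw.integral_weak ν r _ (isSmooth_cas k), Drift.rhs, drift_F, inner_contL2, inner_hartley]
  simp only [lap_cas]
  have : ∀ z, θ r z * -(sqLen k * cas k z) = -sqLen k * (θ r z * cas k z) := fun z => by ring
  simp only [this]
  rw [integral_const_mul]
  ring

/-- Parseval for the weak formulation. All derivatives fall on `φ`, so that `θ r` need only be in
`L²`. -/
theorem hasSum_rhs (hw : IsRegular w M) (ν : ℝ) (θ : ℝ → L2 d) (r : ℝ) {φ : Torus d → ℝ}
    (hφ : IsSmooth φ) :
    HasSum (fun k => ⟪hartley d k, contL2 φ hφ.continuous⟫ * hw.drift.rhs ν θ k r)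
      (∫ z, θ r z * (ν * lap φ z + inner ℝ (w r z) (grad φ z))) := by
  rw [hw.integral_weak ν r _ hφ, ← hw.sum_inner_op r _ hφ]
  have h1 := ((hartley d).hasSum_inner_mul_inner
    (contL2 (lap φ) hφ.lap.continuous) (θ r)).mul_left ν
  have h2 := hasSum_inner_pderiv (fun j => hw.op r j (θ r)) hφ
  refine (h1.add h2).congr_fun fun k => ?_
  rw [Drift.rhs, Drift.F_apply, real_inner_comm (hartley d k) (contL2 (lap φ) _),
    inner_hartley_lap hφ]
  change _ * (_ + ∑ j, (k j : ℝ) * ⟪hartley d (-k), hw.op r j (θ r)⟫) = _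
  ring

/-- The partial sums of the weak formulation are bounded. -/
theorem exists_abs_sum_rhs_le (hw : IsRegular w M) (ν : ℝ) {φ : Torus d → ℝ} (hφ : IsSmooth φ) :
    ∃ C : ℝ, ∀ (θ : ℝ → L2 d) (r : ℝ) (A : Finset (Fin d → ℤ)),
      |∑ k ∈ A, ⟪hartley d k, contL2 φ hφ.continuous⟫ * hw.drift.rhs ν θ k r| ≤ C * ‖θ r‖ := by
  set e := hartley d
  set x := contL2 φ hφ.continuous
  set C1 := ∑' k, (sqLen k * ⟪e k, x⟫) ^ 2 with hC1
  set C2 := ∑' k, sqLen k * ⟪e k, x⟫ ^ 2 with hC2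
  have hs1 : Summable fun k => (sqLen k * ⟪e k, x⟫) ^ 2 := summable_sqLen_sq_contL2 hφ
  have hs2 : Summable fun k => sqLen k * ⟪e k, x⟫ ^ 2 := isH1_contL2 hφ
  refine ⟨|ν| * √C1 + √C2 * M, fun θ r A => ?_⟩
  have h1 : |∑ k ∈ A, (sqLen k * ⟪e k, x⟫) * ⟪e k, θ r⟫| ≤ √C1 * ‖θ r‖ := by
    refine abs_le_of_sq_le_sq ?_ (by positivity)
    rw [mul_pow, Real.sq_sqrt (tsum_nonneg fun k => sq_nonneg _)]
    refine (Finset.sum_mul_sq_le_sq_mul_sq _ _ _).trans ?_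
    exact mul_le_mul (hs1.sum_le_tsum A fun k _ => sq_nonneg _)
      (sum_le_hasSum A (fun k _ => sq_nonneg _) (hasSum_inner_sq e (θ r)))
      (Finset.sum_nonneg fun _ _ => sq_nonneg _) (tsum_nonneg fun k => sq_nonneg _)
  have h2 : |∑ k ∈ A, ⟪e k, x⟫ * hw.drift.F r k (θ r)| ≤ √C2 * (M * ‖θ r‖) := by
    refine abs_le_of_sq_le_sq ?_ (mul_nonneg (Real.sqrt_nonneg _)
      (mul_nonneg hw.M_nonneg (norm_nonneg _)))
    rw [mul_pow, Real.sq_sqrt (tsum_nonneg fun k => mul_nonneg (sqLen_nonneg k) (sq_nonneg _)),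
      mul_pow]
    refine (hw.drift.sum_mul_F_sq_le r _ _ _).trans ?_
    exact mul_le_mul_of_nonneg_right (hs2.sum_le_tsum A fun k _ =>
      mul_nonneg (sqLen_nonneg k) (sq_nonneg _)) (mul_nonneg (sq_nonneg _) (sq_nonneg _))
  have h3 : ∑ k ∈ A, ⟪e k, x⟫ * hw.drift.rhs ν θ k r =
      -(ν * ∑ k ∈ A, (sqLen k * ⟪e k, x⟫) * ⟪e k, θ r⟫) +
        ∑ k ∈ A, ⟪e k, x⟫ * hw.drift.F r k (θ r) := by
    rw [Finset.mul_sum, ← Finset.sum_neg_distrib, ← Finset.sum_add_distrib]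
    refine Finset.sum_congr rfl fun k _ => ?_
    rw [Drift.rhs]; ring
  rw [h3]
  refine (abs_add_le _ _).trans ?_
  rw [abs_neg, abs_mul, add_mul]
  refine add_le_add ?_ (h2.trans_eq (by ring))
  rw [mul_assoc]
  exact mul_le_mul_of_nonneg_left h1 (abs_nonneg _)

end IsRegular

/-- Weak solutions are the solutions of the system for the Fourier coefficients. -/
theorem isSolution_iff {v w : ℝ → Torus d → Vec d} {M ν s T : ℝ} (hw : IsRegular w M)
    (hsT : s ≤ T) (hvw : ∀ᵐ r ∂(volume.restrict (Ioc s T)), w r =ᵐ[volume] v r) {θ₀ : L2 d}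
    {θ : ℝ → L2 d} : IsSolution v ν s (Icc s T) θ₀ θ ↔ hw.drift.IsMode ν s T θ ∧ θ s = θ₀ := by
  have hcongr : ∀ φ : Torus d → ℝ, ∀ t ∈ Icc s T,
      ∫ r in s..t, ∫ x, θ r x * (ν * lap φ x + inner ℝ (v r x) (grad φ x)) =
      ∫ r in s..t, ∫ x, θ r x * (ν * lap φ x + inner ℝ (w r x) (grad φ x)) := by
    intro φ t ht
    refine intervalIntegral.integral_congr_ae_restrict ?_
    rw [uIoc_of_le ht.1]
    filter_upwards [ae_restrict_of_ae_restrict_of_subset (Ioc_subset_Ioc_right ht.2) hvw] with r hr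
    refine integral_congr_ae ?_
    filter_upwards [hr] with x hx
    rw [hx]
  constructor
  · intro h
    refine ⟨⟨hsT, h.continuousOn, fun k => hw.drift.intervalIntegrable_rhs h.continuousOn hsT ν k,
      fun k t ht => ?_⟩, h.initial⟩
    -- The system for the coefficients is the weak formulation tested with the basis functions.
    have h1 := h.weak (cas k) (isSmooth_cas k) t ht
    rw [hcongr _ t ht] at h1
    simp only [hw.rhs_eq]
    rw [intervalIntegral.integral_const_mul, ← h1, inner_hartley, inner_hartley, h.initial]
    ring
  · rintro ⟨h, rfl⟩
    refine ⟨h.cont, rfl, fun φ hφ t ht => ?_⟩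
    rw [hcongr _ t ht, ← inner_contL2 hφ.continuous, ← inner_contL2 hφ.continuous]
    have h1 := ((hartley d).hasSum_inner_mul_inner (contL2 φ hφ.continuous) (θ t)).sub
      ((hartley d).hasSum_inner_mul_inner (contL2 φ hφ.continuous) (θ s))
    refine h1.unique ?_
    obtain ⟨C, hC⟩ := hw.exists_abs_sum_rhs_le ν hφ
    obtain ⟨R, -, hR⟩ := exists_norm_le h.cont
    have hsub : Icc s t ⊆ Icc s T := Icc_subset_Icc_right ht.2
    have hint : ∀ k, IntervalIntegrable (hw.drift.rhs ν θ k) volume s t := fun k =>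
      hw.drift.intervalIntegrable_rhs (h.cont.mono hsub) ht.1 ν k
    -- Conversely, a general test function is expanded in the basis. The uniform bound on partial
    -- sums lets dominated convergence exchange the expansion with the time integral.
    have h2 : Tendsto (fun A : Finset (Fin d → ℤ) => ∫ r in s..t, ∑ k ∈ A,
        ⟪hartley d k, contL2 φ hφ.continuous⟫ * hw.drift.rhs ν θ k r) atTop
        (𝓝 (∫ r in s..t, ∫ x, θ r x * (ν * lap φ x + inner ℝ (w r x) (grad φ x)))) := by
      refine intervalIntegral.tendsto_integral_filter_of_dominated_convergence
        (fun _ => |C| * R) (Eventually.of_forall fun A => ?_) (Eventually.of_forall fun A => ?_)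
        (intervalIntegrable_const) ?_
      · exact Finset.aestronglyMeasurable_fun_sum A fun k _ =>
          ((hint k).def'.aestronglyMeasurable).const_mul _
      · refine ae_of_all _ fun r hr => ?_
        rw [uIoc_of_le ht.1] at hr
        have hr' : r ∈ Icc s T := ⟨hr.1.le, hr.2.trans ht.2⟩
        rw [Real.norm_eq_abs]
        refine (hC θ r A).trans ?_
        exact mul_le_mul (le_abs_self C) (hR r hr') (norm_nonneg _) (abs_nonneg _)
      · exact ae_of_all _ fun r _ => hw.hasSum_rhs ν θ r hφ
    refine Tendsto.congr (fun A => ?_) h2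
    rw [intervalIntegral.integral_finsetSum fun k _ => (hint k).const_mul _]
    refine Finset.sum_congr rfl fun k _ => ?_
    rw [intervalIntegral.integral_const_mul, ← h.eq k t ht]
    beta_reduce
    rw [real_inner_comm (hartley d k) (contL2 φ _)]
    ring

end

/-! ### Bounded flows -/

section

variable {d : ℕ}

/-- `v` is measurable, essentially bounded by `M`, and divergence free, for times in `J`. -/
structure IsBoundedFlow (v : ℝ → Torus d → Vec d) (J : Set ℝ) (M : ℝ) : Prop where
  nonneg : 0 ≤ M
  meas : AEStronglyMeasurable (fun z : ℝ × Torus d => v z.1 z.2)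
    ((volume.restrict J).prod volume)
  bound : ∀ᵐ z ∂((volume.restrict J).prod (volume : Measure (Torus d))), ‖v z.1 z.2‖ ≤ M
  div : ∀ φ : Torus d → ℝ, IsSmooth φ →
    ∀ᵐ t ∂(volume.restrict J), ∫ x, inner ℝ (v t x) (grad φ x) = 0

theorem IsBoundedFlow.mono {v : ℝ → Torus d → Vec d} {J J' : Set ℝ} {M : ℝ}
    (h : IsBoundedFlow v J M) (hJ : J' ⊆ J) : IsBoundedFlow v J' M := by
  have h1 : (volume.restrict J').prod (volume : Measure (Torus d)) ≤
      (volume.restrict J).prod volume :=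
    Measure.prod_mono (Measure.restrict_mono hJ le_rfl) le_rfl
  exact ⟨h.nonneg, h.meas.mono_measure h1, ae_mono h1 h.bound,
    fun φ hφ => ae_mono (Measure.restrict_mono hJ le_rfl) (h.div φ hφ)⟩

theorem IsFlow.isBoundedFlow {u : ℝ → Torus d → Vec d} (hu : IsFlow u) (T : ℝ) :
    ∃ M, IsBoundedFlow u (Icc 0 T) M := by
  obtain ⟨M, hM⟩ := hu.locallyBounded T
  have h0 : volume.restrict (Icc 0 T) ≤ volume.restrict (Ici (0 : ℝ)) :=
    Measure.restrict_mono Icc_subset_Ici_self le_rfl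
  refine ⟨max M 0, le_max_right _ _, hu.measurable.mono_measure (Measure.prod_mono h0 le_rfl),
    hM.mono fun z hz => hz.trans (le_max_left _ _), fun φ hφ => ae_mono h0 (hu.divergenceFree φ hφ)⟩

/-- A bounded divergence free flow has a version which is regular at all times. -/
theorem IsBoundedFlow.exists_isRegular {v : ℝ → Torus d → Vec d} {J : Set ℝ} {M : ℝ}
    (h : IsBoundedFlow v J M) :
    ∃ w, IsRegular w M ∧ ∀ᵐ r ∂(volume.restrict J), w r =ᵐ[volume] v r := by
  classical
  set w0 := h.meas.mk _ with hw0
  have hm0 : StronglyMeasurable w0 := h.meas.stronglyMeasurable_mk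
  -- The version is cut off where it exceeds `M`, which makes the bound hold everywhere.
  set w1 : ℝ × Torus d → Vec d := {z | ‖w0 z‖ ≤ M}.indicator w0 with hw1
  have hm1 : StronglyMeasurable w1 :=
    hm0.indicator (measurableSet_le hm0.norm.measurable measurable_const)
  set D : (Fin d → ℤ) → ℝ → ℝ := fun k r => ∫ x, inner ℝ (w1 (r, x)) (grad (cas k) x) with hD
  have hDm : ∀ k, StronglyMeasurable (D k) := by
    intro k
    have hg : StronglyMeasurable fun z : ℝ × Torus d => grad (cas k) z.2 := by
      refine Continuous.stronglyMeasurable ?_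
      refine (PiLp.continuous_toLp 2 _).comp (continuous_pi fun i => ?_)
      exact ((isSmooth_cas k).pderiv i).continuous.comp continuous_snd
    have hi : StronglyMeasurable fun z : ℝ × Torus d => (inner ℝ (w1 z) (grad (cas k) z.2) : ℝ) :=
      hm1.inner hg
    exact hi.integral_prod_right'
  -- The good times. There are only countably many conditions, so `G` is measurable and contains
  -- almost every time of `J`; the field is replaced by zero at all other times.
  set G : Set ℝ := {r | ∀ k, D k r = 0} with hG
  have hGm : MeasurableSet G := by
    have : G = ⋂ k, {r | D k r = 0} := by ext; simp [hG]
    rw [this]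
    exact MeasurableSet.iInter fun k => (hDm k).measurable (measurableSet_singleton 0)
  have hae : ∀ᵐ r ∂(volume.restrict J), (fun x => w1 (r, x)) =ᵐ[volume] v r := by
    have h1 : ∀ᵐ z ∂((volume.restrict J).prod (volume : Measure (Torus d))), w1 z = v z.1 z.2 := by
      filter_upwards [h.bound, h.meas.ae_eq_mk] with z hz hz'
      have hz2 : w0 z = v z.1 z.2 := hz'.symm
      have hz3 : z ∈ {z | ‖w0 z‖ ≤ M} := by change ‖w0 z‖ ≤ M; rw [hz2]; exact hz
      rw [hw1, indicator_of_mem hz3, hz2]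
    exact Measure.ae_ae_of_ae_prod h1
  have hGae : ∀ᵐ r ∂(volume.restrict J), r ∈ G := by
    have h2 : ∀ᵐ r ∂(volume.restrict J), ∀ k : Fin d → ℤ,
        ∫ x, inner ℝ (v r x) (grad (cas k) x) = 0 :=
      ae_all_iff.2 fun k => h.div _ (isSmooth_cas k)
    filter_upwards [hae, h2] with r hr hr2 k
    rw [← hr2 k]
    refine integral_congr_ae ?_
    filter_upwards [hr] with x hx
    rw [hx]
  refine ⟨fun r x => (Prod.fst ⁻¹' G).indicator w1 (r, x), ⟨?_, ?_, ?_⟩, ?_⟩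
  · exact hm1.indicator (measurable_fst hGm)
  · intro r x
    refine (norm_indicator_le_norm_self _ _).trans ?_
    by_cases hz : (r, x) ∈ {z | ‖w0 z‖ ≤ M}
    · rw [hw1, indicator_of_mem hz]; exact hz
    · rw [hw1, indicator_of_notMem hz, norm_zero]; exact h.nonneg
  · intro r k
    by_cases hr : r ∈ G
    · have : ∀ x, (Prod.fst ⁻¹' G).indicator w1 (r, x) = w1 (r, x) := fun x =>
        indicator_of_mem (by exact hr) _
      simp only [this]; exact hr k
    · have : ∀ x, (Prod.fst ⁻¹' G).indicator w1 (r, x) = 0 := fun x =>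
        indicator_of_notMem (by exact hr) _
      simp [this]
  · filter_upwards [hae, hGae] with r hr hr2
    filter_upwards [hr] with x hx
    rw [indicator_of_mem (by exact hr2)]; exact hx

theorem mem_L20_iff (θ : L2 d) : θ ∈ L20 d ↔ ⟪hartley d 0, θ⟫ = 0 := by
  rw [inner_hartley]
  simp only [cas_zero, mul_one, mul_eq_zero, (casNorm_pos d).ne', false_or]
  rfl

theorem grad_one (x : Torus d) : grad (fun _ : Torus d => (1 : ℝ)) x = 0 := by
  ext i; simp [grad, pderiv]

theorem lap_one (x : Torus d) : lap (fun _ : Torus d => (1 : ℝ)) x = 0 := by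
  have : ∀ i, pderiv i (fun _ : Torus d => (1 : ℝ)) = fun _ => 0 := fun i => by
    funext x; simp [pderiv]
  simp only [lap, this]
  simp [pderiv]

/-- The mean is conserved. -/
theorem IsSolution.mem_L20 {v : ℝ → Torus d → Vec d} {ν s : ℝ} {J : Set ℝ} {θ₀ : L2 d}
    {θ : ℝ → L2 d} (h : IsSolution v ν s J θ₀ θ) (h0 : θ₀ ∈ L20 d) {t : ℝ} (ht : t ∈ J) :
    θ t ∈ L20 d := by
  have h1 := h.weak (fun _ => 1) (isSmooth_const 1) t ht
  simp only [mul_one, grad_one, lap_one, inner_zero_right, mul_zero, add_zero, integral_zero,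
    intervalIntegral.integral_zero] at h1
  change ∫ x, θ₀ x = 0 at h0
  change ∫ x, θ t x = 0
  linarith

theorem IsSolution.mono {v : ℝ → Torus d → Vec d} {ν s : ℝ} {J J' : Set ℝ} {θ₀ : L2 d}
    {θ : ℝ → L2 d} (h : IsSolution v ν s J θ₀ θ) (hJ : J' ⊆ J) : IsSolution v ν s J' θ₀ θ :=
  ⟨h.continuousOn.mono hJ, h.initial, fun φ hφ t ht => h.weak φ hφ t (hJ ht)⟩

/-! ### Existence, decay, uniqueness and restarting of weak solutions -/

section Uniqueness

variable {v : ℝ → Torus d → Vec d} {M ν s T : ℝ} {θ₀ θ₁ : L2 d} {θ η : ℝ → L2 d}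

/-- One drift serves all diffusivities and all subintervals, so that solutions may be restricted and
restarted without changing the system. -/
theorem IsBoundedFlow.exists_drift (hv : IsBoundedFlow v (Icc s T) M) :
    ∃ S : Drift (hartley d), S.M = M ∧ ∀ ν a b θ₀ θ, s ≤ a → a ≤ b → b ≤ T →
      (IsSolution v ν a (Icc a b) θ₀ θ ↔ S.IsMode ν a b θ ∧ θ a = θ₀) := by
  obtain ⟨w, hw, hvw⟩ := hv.exists_isRegular
  refine ⟨hw.drift, rfl, fun ν a b θ₀ θ ha hab hb => isSolution_iff hw hab ?_⟩
  exact ae_restrict_of_ae_restrict_of_subset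
    (Ioc_subset_Icc_self.trans (Icc_subset_Icc ha hb)) hvw

theorem IsBoundedFlow.exists_isSolution (hv : IsBoundedFlow v (Icc s T) M) (hsT : s ≤ T)
    (hν : 0 < ν) (θ₀ : L2 d) : ∃ θ, IsSolution v ν s (Icc s T) θ₀ θ := by
  obtain ⟨S, -, hS⟩ := hv.exists_drift
  obtain ⟨θ, h1, h2⟩ := S.exists_isMode hν hsT θ₀
  exact ⟨θ, (hS ν s T θ₀ θ le_rfl hsT le_rfl).2 ⟨h1, h2⟩⟩

theorem IsBoundedFlow.norm_le (hv : IsBoundedFlow v (Icc s T) M) (hν : 0 < ν)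
    (h : IsSolution v ν s (Icc s T) θ₀ θ) {a b : ℝ} (ha : s ≤ a) (hab : a ≤ b) (hb : b ≤ T) :
    ‖θ b‖ ≤ ‖θ a‖ := by
  have hsT := ha.trans (hab.trans hb)
  obtain ⟨S, -, hS⟩ := hv.exists_drift
  exact ((hS ν s T θ₀ θ le_rfl hsT le_rfl).1 h).1.norm_le hν ha hab hb

theorem IsBoundedFlow.unique (hv : IsBoundedFlow v (Icc s T) M) (hν : 0 < ν)
    (h : IsSolution v ν s (Icc s T) θ₀ θ) (h' : IsSolution v ν s (Icc s T) θ₀ η) {t : ℝ}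
    (ht : t ∈ Icc s T) : θ t = η t := by
  have hsT := ht.1.trans ht.2
  obtain ⟨S, -, hS⟩ := hv.exists_drift
  have h1 := (hS ν s T θ₀ θ le_rfl hsT le_rfl).1 h
  have h2 := (hS ν s T θ₀ η le_rfl hsT le_rfl).1 h'
  exact h1.1.unique h2.1 hν (h1.2.trans h2.2.symm) ht

/-- Solutions may be restarted. -/
theorem IsBoundedFlow.restart (hv : IsBoundedFlow v (Icc s T) M)
    (h : IsSolution v ν s (Icc s T) θ₀ θ) {a b : ℝ} (ha : s ≤ a) (hab : a ≤ b) (hb : b ≤ T) :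
    IsSolution v ν a (Icc a b) (θ a) θ := by
  have hsT := ha.trans (hab.trans hb)
  obtain ⟨S, -, hS⟩ := hv.exists_drift
  have h1 := (hS ν s T θ₀ θ le_rfl hsT le_rfl).1 h
  exact (hS ν a b (θ a) θ ha hab hb).2 ⟨h1.1.mono ha hab hb, rfl⟩

end Uniqueness

/-- Solutions on a half open interval. -/
theorem exists_isSolution_Ico {v : ℝ → Torus d → Vec d} {ν s b : ℝ} (hν : 0 < ν) (hsb : s < b)
    (hv : ∀ T, s ≤ T → T < b → ∃ M, IsBoundedFlow v (Icc s T) M) (θ₀ : L2 d) :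
    ∃ θ, IsSolution v ν s (Ico s b) θ₀ θ := by
  have h1 : ∀ T, ∃ θ, s ≤ T → T < b → IsSolution v ν s (Icc s T) θ₀ θ := by
    intro T
    by_cases hT : s ≤ T ∧ T < b
    · obtain ⟨M, hM⟩ := hv T hT.1 hT.2
      obtain ⟨θ, hθ⟩ := hM.exists_isSolution hT.1 hν θ₀
      exact ⟨θ, fun _ _ => hθ⟩
    · exact ⟨0, fun h h' => absurd ⟨h, h'⟩ hT⟩
  choose Θ hΘ using h1
  -- By uniqueness the solutions on the intervals `Icc s T` are compatible, so their values at the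
  -- right ends define one solution.
  have hagree : ∀ T, s ≤ T → T < b → ∀ t ∈ Icc s T, Θ t t = Θ T t := by
    intro T hsT hT t ht
    obtain ⟨M, hM⟩ := hv t ht.1 (ht.2.trans_lt hT)
    exact hM.unique hν (hΘ t ht.1 (ht.2.trans_lt hT))
      ((hΘ T hsT hT).mono (Icc_subset_Icc_right ht.2)) ⟨ht.1, le_rfl⟩
  refine ⟨fun t => Θ t t, ?_, (hΘ s le_rfl hsb).initial, fun φ hφ t ht => ?_⟩
  · intro t ht
    obtain ⟨T, htT, hT⟩ := exists_between ht.2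
    have hsT := ht.1.trans htT.le
    have h2 : ContinuousWithinAt (fun t => Θ t t) (Icc s T) t :=
      ((hΘ T hsT hT).continuousOn.congr (hagree T hsT hT)) t ⟨ht.1, htT.le⟩
    refine h2.mono_of_mem_nhdsWithin ?_
    filter_upwards [self_mem_nhdsWithin, mem_nhdsWithin_of_mem_nhds (Iio_mem_nhds htT)] with q h3 h4
    exact ⟨h3.1, h4.le⟩
  · have h2 := (hΘ t ht.1 ht.2).weak φ hφ t ⟨ht.1, le_rfl⟩
    rw [h2]
    refine intervalIntegral.integral_congr fun r hr => ?_
    rw [uIcc_of_le ht.1] at hr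
    rw [hagree t ht.1 ht.2 r hr]

end

/-! ### Sobolev norms and the gradient bound -/

section

variable {d : ℕ}

/-! ### Sobolev norms in terms of the real basis -/

section Norms

theorem sqLen_neg (k : Fin d → ℤ) : sqLen (-k) = sqLen k := by
  simp [sqLen]

theorem sqLen_pos {k : Fin d → ℤ} (hk : k ≠ 0) : 0 < sqLen k := by
  obtain ⟨i, hi⟩ := Function.ne_iff.1 hk
  refine lt_of_lt_of_le ?_ (Finset.single_le_sum (f := fun i => (k i : ℝ) ^ 2)
    (fun i _ => sq_nonneg _) (Finset.mem_univ i))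
  have : (k i : ℝ) ≠ 0 := by simpa using hi
  positivity

theorem character_neg (k : Fin d → ℤ) (x : Torus d) :
    character (-k) x = (starRingEnd ℂ) (character k x) := by
  simp only [character, Pi.neg_apply, fourier_neg, map_prod]

theorem character_neg_eq_cas (k : Fin d → ℤ) (x : Torus d) : character (-k) x =
    (((cas k x + cas (-k) x) / 2 : ℝ) : ℂ) - (((cas k x - cas (-k) x) / 2 : ℝ) : ℂ) * Complex.I := by
  have h : cas (-k) x = (character k x).re - (character k x).im := by
    rw [cas, character_neg, Complex.conj_re, Complex.conj_im, sub_eq_add_neg]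
  rw [h, cas, character_neg]
  refine Complex.ext ?_ ?_
  · simp
  · simp

/-- The Fourier coefficient of a real function has half the sum and half the difference of the
coefficients at `k` and `-k` as real and imaginary parts, up to sign and normalization; the cross
terms cancel in the modulus. -/
theorem enorm_fourierC_sq (θ : L2 d) (k : Fin d → ℤ) :
    ‖fourierC θ k‖ₑ ^ 2 = ENNReal.ofReal (((2 * Real.pi) ^ d)⁻¹ *
      ((⟪hartley d k, θ⟫ ^ 2 + ⟪hartley d (-k), θ⟫ ^ 2) / 2)) := by
  have hpi : 0 < (2 * Real.pi) ^ d := pow_pos Real.two_pi_pos d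
  set a := ∫ x, θ x * cas k x with ha
  set b := ∫ x, θ x * cas (-k) x with hb
  have hint : ∀ k, Integrable fun x => θ x * cas k x := by
    intro k
    refine ((integrable_mul_L2 θ (casL2 k)).const_mul (casNorm d)⁻¹).congr ?_
    filter_upwards [coeFn_casL2 k] with x hx
    have := (casNorm_pos d).ne'
    rw [hx]
    field_simp
  have h1 : ∫ x : Torus d, (θ x : ℂ) * ∏ i, fourier (-(k i)) (x i) =
      (((a + b) / 2 : ℝ) : ℂ) - (((a - b) / 2 : ℝ) : ℂ) * Complex.I := by
    have h2 : ∀ x : Torus d, (θ x : ℂ) * ∏ i, fourier (-(k i)) (x i) =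
        (((θ x * cas k x + θ x * cas (-k) x) / 2 : ℝ) : ℂ) -
          (((θ x * cas k x - θ x * cas (-k) x) / 2 : ℝ) : ℂ) * Complex.I := by
      intro x
      have := character_neg_eq_cas k x
      simp only [character, Pi.neg_apply] at this
      rw [this]
      push_cast
      ring
    simp only [h2]
    have i1 := ((hint k).fun_add (hint (-k))).div_const 2
    have i2 : Integrable fun x => (θ x * cas k x - θ x * cas (-k) x) / 2 :=
      ((hint k).sub (hint (-k))).div_const 2
    rw [integral_sub i1.ofReal (i2.ofReal.mul_const _), integral_mul_const, integral_complex_ofReal,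
      integral_complex_ofReal, integral_div, integral_div, integral_add (hint k) (hint (-k)),
      integral_sub (hint k) (hint (-k))]
  have h3 : ‖fourierC θ k‖ ^ 2 = (((2 * Real.pi) ^ d)⁻¹ *
      ((⟪hartley d k, θ⟫ ^ 2 + ⟪hartley d (-k), θ⟫ ^ 2) / 2)) := by
    rw [fourierC, h1, norm_mul, mul_pow, Complex.norm_real, Real.norm_eq_abs, sq_abs,
      ← Complex.normSq_eq_norm_sq, inner_hartley, inner_hartley, ← ha, ← hb]
    have h4 : casNorm d ^ 2 = ((2 * Real.pi) ^ d)⁻¹ := by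
      have := casNorm_sq d
      field_simp
      rw [sq]; exact this
    rw [show (casNorm d * a) ^ 2 = ((2 * Real.pi) ^ d)⁻¹ * a ^ 2 by rw [mul_pow, h4],
      show (casNorm d * b) ^ 2 = ((2 * Real.pi) ^ d)⁻¹ * b ^ 2 by rw [mul_pow, h4]]
    generalize ((2 * Real.pi) ^ d)⁻¹ = q
    simp only [Complex.normSq_apply, Complex.sub_re, Complex.ofReal_re, Complex.mul_re,
      Complex.ofReal_im, Complex.I_re, Complex.I_im, Complex.sub_im, Complex.mul_im]
    ring
  rw [← h3, ← ofReal_norm, ENNReal.ofReal_pow (norm_nonneg _)]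

/-- For an even weight, averaging over `k` and `-k` does not change the sum. -/
theorem tsum_ofReal_mul_enorm_fourierC_sq (θ : L2 d) {m : (Fin d → ℤ) → ℝ} (hm : ∀ k, 0 ≤ m k)
    (hm' : ∀ k, m (-k) = m k) :
    ∑' k, ENNReal.ofReal ((2 * Real.pi) ^ d * m k) * ‖fourierC θ k‖ₑ ^ 2 =
      ∑' k, ENNReal.ofReal (m k * ⟪hartley d k, θ⟫ ^ 2) := by
  have hpi : 0 < (2 * Real.pi) ^ d := pow_pos Real.two_pi_pos d
  set t : (Fin d → ℤ) → ℝ≥0∞ := fun k => ENNReal.ofReal (m k * ⟪hartley d k, θ⟫ ^ 2 / 2) with ht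
  have h1 : ∀ k, ENNReal.ofReal ((2 * Real.pi) ^ d * m k) * ‖fourierC θ k‖ₑ ^ 2 = t k + t (-k) := by
    intro k
    have e1 : 0 ≤ m k := hm k
    rw [enorm_fourierC_sq, ← ENNReal.ofReal_mul (mul_nonneg hpi.le (hm k)), ht]
    beta_reduce
    rw [hm', ← ENNReal.ofReal_add (by positivity) (by positivity)]
    congr 1
    field_simp
  have h2 : ∀ k, ENNReal.ofReal (m k * ⟪hartley d k, θ⟫ ^ 2) = t k + t k := by
    intro k
    have e1 : 0 ≤ m k := hm k
    rw [ht, ← ENNReal.ofReal_add (by positivity) (by positivity), add_halves]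
  simp only [h1, h2]
  rw [ENNReal.tsum_add, ENNReal.tsum_add]
  congr 1
  exact (Equiv.neg (Fin d → ℤ)).tsum_eq t

theorem normH1_le {θ : L2 d} (h : IsH1 (hartley d) θ) :
    normH1 θ ≤ ENNReal.ofReal (‖θ‖ + √(gradSq (hartley d) θ)) := by
  have h0 : 0 ≤ gradSq (hartley d) θ := gradSq_nonneg _ _
  have h1 : HasSum (fun k => (1 + sqLen k) * ⟪hartley d k, θ⟫ ^ 2)
      (‖θ‖ ^ 2 + gradSq (hartley d) θ) := by
    simp only [add_mul, one_mul]
    exact (hasSum_inner_sq (hartley d) θ).add h.hasSum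
  have hn : ∀ k : Fin d → ℤ, 0 ≤ 1 + sqLen k := fun k => by linarith [sqLen_nonneg k]
  rw [normH1, tsum_ofReal_mul_enorm_fourierC_sq θ hn (fun k => by rw [sqLen_neg]),
    ← ENNReal.ofReal_tsum_of_nonneg (fun k => mul_nonneg (hn k) (sq_nonneg _)) h1.summable,
    h1.tsum_eq, ENNReal.ofReal_rpow_of_nonneg (by positivity) (by norm_num)]
  refine ENNReal.ofReal_le_ofReal ?_
  rw [← Real.sqrt_eq_rpow]
  refine Real.sqrt_le_iff.2 ⟨by positivity, ?_⟩
  have := Real.sq_sqrt h0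
  nlinarith [norm_nonneg θ, Real.sqrt_nonneg (gradSq (hartley d) θ)]

/-- Duality of `H¹` and `H⁻¹` by Cauchy-Schwarz. The zero mode is not seen by the homogeneous norm
of `η`, but it does not enter because `θ` has mean zero. -/
theorem inner_le_of_normHneg1_le {θ η : L2 d} (h : IsH1 (hartley d) θ) (hθ : θ ∈ L20 d) {c : ℝ}
    (hc : 0 ≤ c) (hη : normHneg1 η ≤ ENNReal.ofReal c) :
    |⟪θ, η⟫| ≤ c * √(gradSq (hartley d) θ) := by
  have hpi : 0 < (2 * Real.pi) ^ d := pow_pos Real.two_pi_pos d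
  have hn : ∀ k : Fin d → ℤ, 0 ≤ (sqLen k)⁻¹ := fun k => inv_nonneg.2 (sqLen_nonneg k)
  have h1 : ∑' k : Fin d → ℤ, ENNReal.ofReal ((sqLen k)⁻¹ * ⟪hartley d k, η⟫ ^ 2) ≤
      ENNReal.ofReal (c ^ 2) := by
    rw [← tsum_ofReal_mul_enorm_fourierC_sq η hn (fun k => by rw [sqLen_neg])]
    have h2 : normHneg1 η ^ (2 : ℝ) ≤ ENNReal.ofReal c ^ (2 : ℝ) :=
      ENNReal.rpow_le_rpow hη (by norm_num)
    rw [normHneg1, ← ENNReal.rpow_mul] at h2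
    norm_num at h2
    rw [ENNReal.ofReal_pow hc]
    refine le_trans (le_of_eq ?_) h2
    -- The term at `k = 0` vanishes because the inverse of zero is zero, so the sum over nonzero `k`
    -- is the sum over all `k`.
    refine (tsum_subtype_eq_of_support_subset (f := fun k : Fin d → ℤ =>
      ENNReal.ofReal ((2 * Real.pi) ^ d * (sqLen k)⁻¹) * ‖fourierC η k‖ₑ ^ 2)
      (s := {k | k ≠ 0}) ?_).symm.trans ?_
    · intro k hk
      change k ≠ 0
      rintro rfl
      simp [sqLen] at hk
    · rfl
  have h3 : ∀ A : Finset (Fin d → ℤ), |∑ k ∈ A, ⟪θ, hartley d k⟫ * ⟪hartley d k, η⟫| ≤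
      c * √(gradSq (hartley d) θ) := by
    intro A
    have h4 : ∑ k ∈ A, ⟪θ, hartley d k⟫ * ⟪hartley d k, η⟫ =
        ∑ k ∈ A, (√(sqLen k) * ⟪hartley d k, θ⟫) * ((√(sqLen k))⁻¹ * ⟪hartley d k, η⟫) := by
      refine Finset.sum_congr rfl fun k _ => ?_
      rw [real_inner_comm]
      by_cases hk : k = 0
      · subst hk
        rw [(mem_L20_iff θ).1 hθ]; simp
      · have : √(sqLen k) ≠ 0 := (Real.sqrt_pos.2 (sqLen_pos hk)).ne'
        field_simp
    have h5 : ∑ k ∈ A, (√(sqLen k) * ⟪hartley d k, θ⟫) ^ 2 ≤ gradSq (hartley d) θ := by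
      simp only [mul_pow, Real.sq_sqrt (sqLen_nonneg _)]
      exact h.sum_le_tsum A fun k _ => mul_nonneg (sqLen_nonneg k) (sq_nonneg _)
    have h6 : ∑ k ∈ A, ((√(sqLen k))⁻¹ * ⟪hartley d k, η⟫) ^ 2 ≤ c ^ 2 := by
      simp only [mul_pow, inv_pow, Real.sq_sqrt (sqLen_nonneg _)]
      rw [← ENNReal.ofReal_le_ofReal_iff (sq_nonneg c), ENNReal.ofReal_sum_of_nonneg fun k _ =>
        mul_nonneg (hn k) (sq_nonneg _)]
      exact (ENNReal.sum_le_tsum A).trans h1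
    rw [h4]
    refine abs_le_of_sq_le_sq ?_ (by positivity)
    refine (Finset.sum_mul_sq_le_sq_mul_sq _ _ _).trans ?_
    rw [mul_pow, Real.sq_sqrt (gradSq_nonneg _ _), mul_comm (c ^ 2)]
    exact mul_le_mul h5 h6 (Finset.sum_nonneg fun _ _ => sq_nonneg _) (gradSq_nonneg _ _)
  exact le_of_tendsto ((hartley d).hasSum_inner_mul_inner θ η).abs (Eventually.of_forall h3)

end Norms

/-! ### The gradient of the velocity controls the transport term in the `H¹` estimate -/

section GradBound

variable {w : ℝ → Torus d → Vec d} {M : ℝ}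

theorem IsSmooth.comp_apply {V : Torus d → Vec d} (hV : IsSmooth V) (j : Fin d) :
    IsSmooth fun x => V x j :=
  (EuclideanSpace.proj (𝕜 := ℝ) j).contDiff.comp hV

theorem IsSmooth.pderiv_comp_apply {V : Torus d → Vec d} (hV : IsSmooth V) (i j : Fin d)
    (y : Vec d) : AcceleratedFlow.pderiv i (fun x => V x j) (toTorus y) =
      fderiv ℝ (lift V) y (EuclideanSpace.single i 1) j := by
  have h1 := hV.hasDerivAt_lift i y
  have h2 := ((EuclideanSpace.proj (𝕜 := ℝ) j).hasFDerivAt.comp_hasDerivAt (0 : ℝ) h1).deriv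
  exact h2

theorem IsSmooth.abs_sum_pderiv_le {V : Torus d → Vec d} (hV : IsSmooth V) {L : ℝ}
    (hL : ∀ y, ‖fderiv ℝ (lift V) y‖ ≤ L) (a : Vec d) (x : Torus d) :
    |∑ i, ∑ j, AcceleratedFlow.pderiv i (fun x => V x j) x * (a i * a j)| ≤ L * ∑ i, a i ^ 2 := by
  obtain ⟨y, rfl⟩ := toTorus_surjective x
  have h1 : ∑ i, ∑ j, AcceleratedFlow.pderiv i (fun x => V x j) (toTorus y) * (a i * a j) =
      ⟪fderiv ℝ (lift V) y a, a⟫ := by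
    have h2 : a = ∑ i, a i • EuclideanSpace.single i (1 : ℝ) := by
      ext j
      simp [Finset.sum_apply, Pi.single_apply]
    have h3 : fderiv ℝ (lift V) y a =
        ∑ i, a i • fderiv ℝ (lift V) y (EuclideanSpace.single i (1 : ℝ)) := by
      conv_lhs => rw [h2]
      rw [map_sum]
      simp only [map_smul]
    rw [h3, sum_inner]
    refine Finset.sum_congr rfl fun i _ => ?_
    rw [inner_smul_left, PiLp.inner_apply, Finset.mul_sum]
    refine Finset.sum_congr rfl fun j _ => ?_
    rw [hV.pderiv_comp_apply]
    simp
    ring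
  rw [h1, ← EuclideanSpace.real_norm_sq_eq, sq, ← mul_assoc]
  exact (abs_real_inner_le_norm _ _).trans (mul_le_mul_of_nonneg_right
    ((ContinuousLinearMap.le_opNorm _ _).trans
      (mul_le_mul_of_nonneg_right (hL y) (norm_nonneg _))) (norm_nonneg _))

/-- One integration by parts moves a derivative from `lap p` onto the velocity and onto `grad p`.
The part with second derivatives of `p` is an antisymmetric form evaluated at equal arguments and
vanishes; only the gradient of the velocity is left. -/
theorem IsRegular.integral_mul_grad_lap_le (hw : IsRegular w M) {r : ℝ} {V : Torus d → Vec d}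
    (hV : IsSmooth V) (hwV : w r =ᵐ[volume] V) {L : ℝ} (hL : ∀ y, ‖fderiv ℝ (lift V) y‖ ≤ L)
    {p : Torus d → ℝ} (hp : IsSmooth p) :
    |∫ x, lap p x * inner ℝ (w r x) (grad p x)| ≤ L * ∑ i, ∫ x, pderiv i p x * pderiv i p x := by
  have hg : IsSmooth fun x => ∑ j, V x j * AcceleratedFlow.pderiv j p x :=
    isSmooth_sum fun j _ => (hV.comp_apply j).mul (hp.pderiv j)
  have hwi : ∀ φ ψ : Torus d → ℝ, ∫ x, φ x * inner ℝ (w r x) (grad ψ x) =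
      ∫ x, φ x * ∑ j, V x j * AcceleratedFlow.pderiv j ψ x := by
    intro φ ψ
    refine integral_congr_ae ?_
    filter_upwards [hwV] with x hx
    rw [hx, inner_grad]
  have h1 : ∫ x, lap p x * inner ℝ (w r x) (grad p x) = ∑ i, -∫ x, AcceleratedFlow.pderiv i p x *
      ∑ j, AcceleratedFlow.pderiv i (fun x => V x j) x * AcceleratedFlow.pderiv j p x := by
    rw [hwi]
    simp only [lap, Finset.sum_mul]
    rw [integral_finsetSum]
    swap
    · exact fun i _ => integrable_of_continuous
        (((hp.pderiv i).pderiv i).continuous.mul hg.continuous)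
    refine Finset.sum_congr rfl fun i _ => ?_
    have h2 := integral_mul_pderiv hg (hp.pderiv i) i
    simp only [mul_comm _ (AcceleratedFlow.pderiv i (AcceleratedFlow.pderiv i p) _)] at h2
    rw [h2, neg_inj]
    have h3 : ∀ x, AcceleratedFlow.pderiv i (fun x => ∑ j, V x j * AcceleratedFlow.pderiv j p x) x *
        AcceleratedFlow.pderiv i p x = AcceleratedFlow.pderiv i p x *
          (∑ j, AcceleratedFlow.pderiv i (fun x => V x j) x * AcceleratedFlow.pderiv j p x) +
        AcceleratedFlow.pderiv i p x *
          ∑ j, V x j * AcceleratedFlow.pderiv j (AcceleratedFlow.pderiv i p) x := by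
      intro x
      rw [pderiv_sum fun j _ => (hV.comp_apply j).mul (hp.pderiv j)]
      simp only [pderiv_mul (hV.comp_apply _) (hp.pderiv _), pderiv_comm hp i]
      rw [Finset.sum_add_distrib]
      ring
    simp only [h3]
    have h4 := hw.integral_mul_inner_grad r (hp.pderiv i) (hp.pderiv i)
    rw [hwi] at h4
    rw [integral_add
      (f := fun x => AcceleratedFlow.pderiv i p x * ∑ j, AcceleratedFlow.pderiv i (fun x => V x j) x
        * AcceleratedFlow.pderiv j p x)
      (g := fun x => AcceleratedFlow.pderiv i p x *
          ∑ j, V x j * AcceleratedFlow.pderiv j (AcceleratedFlow.pderiv i p) x)]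
    · linarith
    · refine integrable_of_continuous (Continuous.mul (hp.pderiv i).continuous ?_)
      exact (isSmooth_sum fun j _ => ((hV.comp_apply j).pderiv i).mul (hp.pderiv j)).continuous
    · refine integrable_of_continuous (Continuous.mul (hp.pderiv i).continuous ?_)
      exact (isSmooth_sum fun j _ => (hV.comp_apply j).mul ((hp.pderiv i).pderiv j)).continuous
  have hci : ∀ i, Continuous fun x => AcceleratedFlow.pderiv i p x *
      ∑ j, AcceleratedFlow.pderiv i (fun x => V x j) x * AcceleratedFlow.pderiv j p x := fun i =>
    (hp.pderiv i).continuous.mul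
      (isSmooth_sum fun j _ => ((hV.comp_apply j).pderiv i).mul (hp.pderiv j)).continuous
  have h5 : ∑ i, ∫ x, AcceleratedFlow.pderiv i p x * AcceleratedFlow.pderiv i p x =
      ∫ x, ∑ i, AcceleratedFlow.pderiv i p x * AcceleratedFlow.pderiv i p x := by
    rw [integral_finsetSum]
    exact fun i _ => integrable_of_continuous
      ((hp.pderiv i).continuous.mul (hp.pderiv i).continuous)
  rw [h1, Finset.sum_neg_distrib, abs_neg,
    ← integral_finsetSum _ fun i _ => integrable_of_continuous (hci i), h5, ← integral_const_mul]
  refine (abs_integral_le_integral_abs).trans (integral_mono ?_ ?_ fun x => ?_)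
  · exact (integrable_finsetSum _ fun i _ => integrable_of_continuous (hci i)).abs
  · exact (integrable_finsetSum _ fun i _ => integrable_of_continuous
      ((hp.pderiv i).continuous.mul (hp.pderiv i).continuous)).const_mul _
  · have := hV.abs_sum_pderiv_le hL (grad p x) x
    simp only [grad] at this
    refine le_of_eq_of_le ?_ (this.trans_eq ?_)
    · congr 1
      refine Finset.sum_congr rfl fun i _ => ?_
      rw [Finset.mul_sum]
      exact Finset.sum_congr rfl fun j _ => by ring
    · congr 1
      exact Finset.sum_congr rfl fun i _ => by ring

/-- The truncation is a trigonometric polynomial `p`, and the weight `sqLen` acts on it as minus the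
Laplacian, so that the form becomes the integral of `lap p` times the transport of `p`. -/
theorem IsRegular.gradBound (hw : IsRegular w M) {r : ℝ} {V : Torus d → Vec d}
    (hV : IsSmooth V) (hwV : w r =ᵐ[volume] V) {L : ℝ} (hL : ∀ y, ‖fderiv ℝ (lift V) y‖ ≤ L) :
    hw.drift.GradBound L r := by
  intro x A
  set e := hartley d
  set c := casNorm d
  set p : Torus d → ℝ := fun z => ∑ k ∈ A, (⟪e k, x⟫ * c) * cas k z with hpdef
  have hp : IsSmooth p := isSmooth_sum fun k _ => (isSmooth_cas k).const_mul _
  have hpd : ∀ i z, pderiv i p z = ∑ k ∈ A, (⟪e k, x⟫ * c) * pderiv i (cas k) z := by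
    intro i z
    rw [hpdef, pderiv_sum fun k _ => (isSmooth_cas k).const_mul _]
    exact Finset.sum_congr rfl fun k _ => pderiv_const_mul (isSmooth_cas k) _ i z
  have hlap : ∀ z, lap p z = ∑ k ∈ A, (⟪e k, x⟫ * c) * lap (cas k) z := by
    intro z
    simp only [lap, Finset.mul_sum]
    rw [Finset.sum_comm]
    refine Finset.sum_congr rfl fun i _ => ?_
    rw [show pderiv i p = fun z => ∑ k ∈ A, (⟪e k, x⟫ * c) * pderiv i (cas k) z from
      funext (hpd i), pderiv_sum fun k _ => ((isSmooth_cas k).pderiv i).const_mul _]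
    exact Finset.sum_congr rfl fun k _ => pderiv_const_mul ((isSmooth_cas k).pderiv i) _ i z
  have htr : ((trunc e A x : L2 d) : Torus d → ℝ) =ᵐ[volume] p := by
    have h1 : trunc e A x = contL2 p hp.continuous := by
      have : (⟨p, hp.continuous⟩ : C(Torus d, ℝ)) = ∑ k ∈ A, ⟪e k, x⟫ • (c • casC k) := by
        ext z
        simp [hpdef, casC, mul_assoc]
      rw [contL2, this, map_sum, trunc]
      refine Finset.sum_congr rfl fun k _ => ?_
      rw [map_smul, hartley_apply]
      rfl
    rw [h1]; exact coeFn_contL2 _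
  have hF : ∀ k, hw.drift.F r k (trunc e A x) = c * ∫ z, p z * inner ℝ (w r z) (grad (cas k) z) := by
    intro k
    rw [hw.drift_F]
    congr 1
    refine integral_congr_ae ?_
    filter_upwards [htr] with z hz
    rw [hz]
  have h1 : ∑ k ∈ A, sqLen k * ⟪e k, x⟫ * hw.drift.F r k (trunc e A x) =
      ∫ z, lap p z * inner ℝ (w r z) (grad p z) := by
    simp only [hlap, Finset.sum_mul]
    rw [integral_finsetSum]
    · refine Finset.sum_congr rfl fun k _ => ?_
      rw [hF, hw.integral_mul_inner_grad r hp (isSmooth_cas k)]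
      simp only [IsRegular.lap_cas]
      have : ∀ z, ⟪e k, x⟫ * c * -(sqLen k * cas k z) * inner ℝ (w r z) (grad p z) =
          -(sqLen k * ⟪e k, x⟫ * c) * (cas k z * inner ℝ (w r z) (grad p z)) := fun z => by ring
      simp only [this]
      rw [integral_const_mul]
      ring
    · intro k _
      exact hw.integrable_mul_inner_grad' r
        (((isSmooth_cas k).lap.const_mul (⟪e k, x⟫ * c)).continuous) hp
  have h2 : ∑ i, ∫ z, pderiv i p z * pderiv i p z = ∑ k ∈ A, sqLen k * ⟪e k, x⟫ ^ 2 := by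
    have h3 : ∑ i, ∫ z, pderiv i p z * pderiv i p z = -∫ z, p z * lap p z := by
      simp only [lap, Finset.mul_sum]
      rw [integral_finsetSum, ← Finset.sum_neg_distrib]
      swap
      · exact fun i _ => integrable_of_continuous
          (hp.continuous.mul ((hp.pderiv i).pderiv i).continuous)
      refine Finset.sum_congr rfl fun i _ => ?_
      rw [integral_mul_pderiv hp (hp.pderiv i) i, neg_neg]
    rw [h3]
    simp only [hlap, Finset.mul_sum]
    rw [integral_finsetSum, ← Finset.sum_neg_distrib]
    swap
    · exact fun k _ => integrable_of_continuous
        (hp.continuous.mul ((isSmooth_cas k).lap.const_mul _).continuous)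
    refine Finset.sum_congr rfl fun k hk => ?_
    have h4 : c * ∫ z, p z * cas k z = ⟪e k, x⟫ := by
      have := inner_trunc e A x k
      rw [if_pos hk] at this
      rw [← this, inner_hartley]
      congr 1
      refine integral_congr_ae ?_
      filter_upwards [htr] with z hz
      rw [hz]
    have h5 : ∀ z, p z * (⟪e k, x⟫ * c * lap (cas k) z) =
        -(sqLen k * ⟪e k, x⟫ * c) * (p z * cas k z) := by
      intro z
      rw [IsRegular.lap_cas]; ring
    simp only [h5]
    rw [integral_const_mul]
    linear_combination sqLen k * ⟪e k, x⟫ * h4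
  rw [h1, ← h2]
  exact (le_abs_self _).trans (hw.integral_mul_grad_lap_le hV hwV hL hp)

end GradBound

end

/-! ### Construction of time changes -/

section

section Construction

/-- The times `1 - 2⁻ⁿ`. -/
noncomputable def dyad (n : ℕ) : ℝ := 1 - (1 / 2) ^ n

theorem dyad_zero : dyad 0 = 0 := by simp [dyad]

theorem dyad_lt_one (n : ℕ) : dyad n < 1 := by
  have : (0 : ℝ) < (1 / 2) ^ n := by positivity
  unfold dyad; linarith

theorem dyad_succ (n : ℕ) : dyad (n + 1) = dyad n + (1 / 2) ^ (n + 1) := by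
  unfold dyad; ring

theorem dyad_mono : Monotone dyad :=
  monotone_nat_of_le_succ fun n => by
    rw [dyad_succ]; linarith [show (0 : ℝ) < (1 / 2) ^ (n + 1) by positivity]

theorem dyad_nonneg (n : ℕ) : 0 ≤ dyad n := by
  rw [← dyad_zero]; exact dyad_mono (Nat.zero_le n)

theorem tendsto_dyad : Tendsto dyad atTop (𝓝 1) := by
  have := (tendsto_pow_atTop_nhds_zero_of_lt_one (r := (1 / 2 : ℝ)) (by norm_num)
    (by norm_num)).const_sub 1
  rw [sub_zero] at this
  exact this

theorem exists_lt_dyad {t : ℝ} (ht : t < 1) : ∃ n, t < dyad n :=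
  (tendsto_dyad.eventually (lt_mem_nhds ht)).exists

/-- The middle of the interval from `dyad n` to `dyad (n + 1)`. -/
noncomputable def midDyad (n : ℕ) : ℝ := dyad n + (1 / 2) ^ (n + 2)

theorem dyad_le_midDyad (n : ℕ) : dyad n ≤ midDyad n := by
  unfold midDyad; linarith [show (0 : ℝ) < (1 / 2) ^ (n + 2) by positivity]

theorem dyad_succ_eq (n : ℕ) : dyad (n + 1) = midDyad n + (1 / 2) ^ (n + 2) := by
  rw [midDyad, dyad_succ]; ring

theorem midDyad_le (n : ℕ) : midDyad n ≤ dyad (n + 1) := by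
  rw [dyad_succ_eq]; linarith [show (0 : ℝ) < (1 / 2) ^ (n + 2) by positivity]

variable (l : ℕ → ℝ)

/-- A smooth step function: the jump from `l n` to `l (n + 1)` takes place after `dyad (n + 1)`. -/
noncomputable def smoothStep (t : ℝ) : ℝ :=
  l 0 + ∑' n, (l (n + 1) - l n) * Real.smoothTransition ((t - dyad (n + 1)) * 2 ^ (n + 3))

/-- A partial sum of `smoothStep`. -/
noncomputable def smoothStepTrunc (N : ℕ) (t : ℝ) : ℝ := l 0 +
  ∑ n ∈ Finset.range N, (l (n + 1) - l n) * Real.smoothTransition ((t - dyad (n + 1)) * 2 ^ (n + 3))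

/-- The jump with index `n` starts only at `dyad (n + 1)`, so on this range all jumps with `n ≥ N`
are still zero and the series is a finite sum. -/
theorem smoothStep_eq {N : ℕ} {t : ℝ} (ht : t ≤ dyad (N + 1)) :
    smoothStep l t = smoothStepTrunc l N t := by
  rw [smoothStep, smoothStepTrunc, tsum_eq_sum (s := Finset.range N)]
  intro n hn
  rw [Finset.mem_range, not_lt] at hn
  rw [Real.smoothTransition.zero_of_nonpos, mul_zero]
  have := dyad_mono (Nat.succ_le_succ hn)
  exact mul_nonpos_of_nonpos_of_nonneg (by linarith [show dyad (N + 1) ≤ dyad (n + 1) from this])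
    (by positivity)

theorem contDiff_smoothStepTrunc (N : ℕ) :
    ContDiff ℝ ((⊤ : ℕ∞) : WithTop ℕ∞) (smoothStepTrunc l N) := by
  refine contDiff_const.add (ContDiff.sum fun n _ => contDiff_const.mul ?_)
  exact Real.smoothTransition.contDiff.comp ((contDiff_id.sub contDiff_const).mul contDiff_const)

variable {l}

theorem smoothStepTrunc_le (hl : Monotone l) (N : ℕ) (t : ℝ) : smoothStepTrunc l N t ≤ l N := by
  have h : ∑ n ∈ Finset.range N, (l (n + 1) - l n) = l N - l 0 := Finset.sum_range_sub l N
  have h2 : ∑ n ∈ Finset.range N, (l (n + 1) - l n) *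
      Real.smoothTransition ((t - dyad (n + 1)) * 2 ^ (n + 3)) ≤
        ∑ n ∈ Finset.range N, (l (n + 1) - l n) :=
    Finset.sum_le_sum fun n _ => mul_le_of_le_one_right (sub_nonneg.2 (hl n.le_succ))
      (Real.smoothTransition.le_one _)
  rw [smoothStepTrunc]; linarith

theorem le_smoothStepTrunc (hl : Monotone l) (N : ℕ) (t : ℝ) : l 0 ≤ smoothStepTrunc l N t :=
  le_add_of_nonneg_right (Finset.sum_nonneg fun n _ =>
    mul_nonneg (sub_nonneg.2 (hl n.le_succ)) (Real.smoothTransition.nonneg _))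

/-- The jump with index `n` takes a time `2^(-(n+3))`, half the length of the dyadic interval from
`dyad (n + 1)`, so it is complete at `midDyad (n + 1)`. -/
theorem smoothStepTrunc_eq {N : ℕ} {t : ℝ} (ht : midDyad N ≤ t) : smoothStepTrunc l N t = l N := by
  have h : ∑ n ∈ Finset.range N, (l (n + 1) - l n) *
      Real.smoothTransition ((t - dyad (n + 1)) * 2 ^ (n + 3)) =
        ∑ n ∈ Finset.range N, (l (n + 1) - l n) := by
    refine Finset.sum_congr rfl fun n hn => ?_
    rw [Real.smoothTransition.one_of_one_le, mul_one]
    have h1 : midDyad (n + 1) ≤ t := by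
      refine le_trans ?_ ht
      rcases (Nat.succ_le_of_lt (Finset.mem_range.1 hn)).eq_or_lt with h | h
      · exact (congrArg midDyad h).le
      · exact (midDyad_le _).trans ((dyad_mono h).trans (dyad_le_midDyad N))
    have h2 : (1 / 2 : ℝ) ^ (n + 3) * 2 ^ (n + 3) = 1 := by
      rw [← mul_pow]; norm_num
    rw [← h2]
    refine mul_le_mul_of_nonneg_right ?_ (by positivity)
    unfold midDyad at h1
    linarith [show (1 / 2 : ℝ) ^ (n + 1 + 2) = (1 / 2) ^ (n + 3) from rfl]
  rw [smoothStepTrunc, h, Finset.sum_range_sub]; ring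

/-- A time change whose derivative is at most `l n` on the `n`-th dyadic interval, with equality
on its second half. -/
theorem exists_isTimeChange (hl : Monotone l) (h0 : 0 < l 0) {c : ℝ} (hc : 0 < c)
    (hlc : ∀ n, c * 2 ^ n ≤ l n) :
    ∃ σ : ℝ → ℝ, IsTimeChange σ ∧
      (∀ n, ∀ t ∈ Icc (dyad n) (dyad (n + 1)), derivWithin σ (Ico 0 1) t ≤ l n) ∧
      (∀ n, ∀ t ∈ Icc (midDyad n) (dyad (n + 1)), derivWithin σ (Ico 0 1) t = l n) ∧
      ∀ n, ∀ t ∈ Icc (midDyad n) (dyad (n + 1)), σ t = σ (midDyad n) + l n * (t - midDyad n) := by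
  set σ : ℝ → ℝ := fun t => ∫ r in (0 : ℝ)..t, smoothStep l r with hσ
  set ρ : ℕ → ℝ → ℝ := smoothStepTrunc l
  have hρc : ∀ N, Continuous (ρ N) := fun N => (contDiff_smoothStepTrunc l N).continuous
  have hσN : ∀ N, ∀ t ≤ dyad (N + 1), σ t = ∫ r in (0 : ℝ)..t, ρ N r := by
    intro N t ht
    refine intervalIntegral.integral_congr fun r hr => smoothStep_eq l ?_
    exact hr.2.trans (max_le (dyad_nonneg _) ht)
  have hN : ∀ t < 1, ∃ N, t < dyad (N + 1) := by
    intro t ht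
    obtain ⟨n, hn⟩ := exists_lt_dyad ht
    exact ⟨n, hn.trans_le (dyad_mono n.le_succ)⟩
  have hev : ∀ N, ∀ t < dyad (N + 1), σ =ᶠ[𝓝 t] fun t => ∫ r in (0 : ℝ)..t, ρ N r := by
    intro N t ht
    filter_upwards [Iio_mem_nhds ht] with q hq using hσN N q (le_of_lt hq)
  have hdN : ∀ N t, HasDerivAt (fun t => ∫ r in (0 : ℝ)..t, ρ N r) (ρ N t) t := fun N t =>
    (hρc N).integral_hasStrictDerivAt 0 t |>.hasDerivAt
  have hd : ∀ t < 1, HasDerivAt σ (smoothStep l t) t := by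
    intro t ht
    obtain ⟨N, hNt⟩ := hN t ht
    rw [smoothStep_eq l hNt.le]
    exact (hdN N t).congr_of_eventuallyEq (hev N t hNt)
  have hdw : ∀ t ∈ Ico (0 : ℝ) 1, derivWithin σ (Ico 0 1) t = smoothStep l t := fun t ht =>
    (hd t ht.2).hasDerivWithinAt.derivWithin (uniqueDiffOn_Ico 0 1 t ht)
  have hpos : ∀ t < 1, 0 < smoothStep l t := by
    intro t ht
    obtain ⟨N, hNt⟩ := hN t ht
    rw [smoothStep_eq l hNt.le]
    exact h0.trans_le (le_smoothStepTrunc hl N t)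
  have hmono : StrictMonoOn σ (Ico 0 1) := by
    refine strictMonoOn_of_deriv_pos (convex_Ico 0 1)
      (fun t ht => (hd t ht.2).continuousAt.continuousWithinAt) fun t ht => ?_
    rw [interior_Ico] at ht
    rw [(hd t ht.2).deriv]; exact hpos t ht.2
  have hI : ∀ n, dyad n ∈ Ico (0 : ℝ) 1 := fun n => ⟨dyad_nonneg n, dyad_lt_one n⟩
  have hm : ∀ n, midDyad n ∈ Ico (0 : ℝ) 1 := fun n =>
    ⟨(dyad_nonneg n).trans (dyad_le_midDyad n), (midDyad_le n).trans_lt (dyad_lt_one _)⟩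
  have hlin : ∀ n, ∀ t ∈ Icc (midDyad n) (dyad (n + 1)),
      σ t = σ (midDyad n) + l n * (t - midDyad n) := by
    intro n t ht
    rw [hσN n t ht.2, hσN n _ (midDyad_le n),
      ← intervalIntegral.integral_add_adjacent_intervals (b := midDyad n)
        ((hρc n).intervalIntegrable _ _) ((hρc n).intervalIntegrable _ _)]
    congr 1
    rw [intervalIntegral.integral_congr (g := fun _ => l n)]
    · rw [intervalIntegral.integral_const, smul_eq_mul, mul_comm]
    · intro r hr
      rw [uIcc_of_le ht.1] at hr
      exact smoothStepTrunc_eq hr.1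
  have hσ0 : σ 0 = 0 := intervalIntegral.integral_same
  -- The second half of each dyadic interval contributes `l n * 2^(-(n+2)) ≥ c / 4` to `σ`. Hence
  -- `σ` is unbounded, and it is onto by the intermediate value theorem.
  have hgrow : ∀ n : ℕ, n * (c / 4) ≤ σ (dyad n) := by
    intro n
    induction n with
    | zero => rw [dyad_zero, hσ0]; simp
    | succ n ih =>
      have h1 := hlin n (dyad (n + 1)) ⟨midDyad_le n, le_rfl⟩
      have h2 := hmono.monotoneOn (hI n) (hm n) (dyad_le_midDyad n)
      have h3 : c / 4 ≤ l n * (dyad (n + 1) - midDyad n) := by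
        rw [dyad_succ_eq, add_sub_cancel_left]
        have h4 : (2 : ℝ) ^ n * (1 / 2) ^ (n + 2) = 1 / 4 := by
          rw [pow_add, ← mul_assoc, ← mul_pow]; norm_num
        calc c / 4 = c * (2 ^ n * (1 / 2) ^ (n + 2)) := by rw [h4]; ring
          _ = (c * 2 ^ n) * (1 / 2) ^ (n + 2) := by ring
          _ ≤ _ := mul_le_mul_of_nonneg_right (hlc n) (by positivity)
      push_cast
      linarith
  refine ⟨σ, ⟨?_, ⟨?_, hmono.injOn, ?_⟩, ?_⟩, ?_, ?_, hlin⟩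
  · intro t ht
    obtain ⟨N, hNt⟩ := hN t ht.2
    refine (ContDiffAt.congr_of_eventuallyEq ?_ (hev N t hNt)).contDiffWithinAt
    have : ContDiff ℝ ((⊤ : ℕ∞) : WithTop ℕ∞) fun t => ∫ r in (0 : ℝ)..t, ρ N r := by
      rw [contDiff_infty_iff_deriv]
      refine ⟨fun t => (hdN N t).differentiableAt, ?_⟩
      rw [show deriv (fun t => ∫ r in (0 : ℝ)..t, ρ N r) = ρ N from
        funext fun t => (hdN N t).deriv]
      exact contDiff_smoothStepTrunc l N
    exact this.contDiffAt
  · intro t ht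
    have := hmono.monotoneOn ⟨le_rfl, one_pos⟩ ht ht.1
    rwa [hσ0] at this
  · intro y hy
    obtain ⟨n, hn⟩ := exists_nat_ge (y / (c / 4))
    have h1 : y ≤ σ (dyad n) := by
      refine le_trans ?_ (hgrow n)
      rwa [div_le_iff₀ (by positivity)] at hn
    have h2 : ContinuousOn σ (Icc 0 (dyad n)) := fun t ht =>
      (hd t (ht.2.trans_lt (dyad_lt_one n))).continuousAt.continuousWithinAt
    obtain ⟨t, ht, rfl⟩ := intermediate_value_Icc (dyad_nonneg n) h2 ⟨by rw [hσ0]; exact hy, h1⟩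
    exact ⟨t, ⟨ht.1, ht.2.trans_lt (dyad_lt_one n)⟩, rfl⟩
  · intro t ht
    rw [hdw t ht]; exact hpos t ht.2
  · intro n t ht
    rw [hdw t ⟨(dyad_nonneg n).trans ht.1, ht.2.trans_lt (dyad_lt_one _)⟩, smoothStep_eq l ht.2]
    exact smoothStepTrunc_le hl n t
  · intro n t ht
    rw [hdw t ⟨(hm n).1.trans ht.1, ht.2.trans_lt (dyad_lt_one _)⟩, smoothStep_eq l ht.2]
    exact smoothStepTrunc_eq ht.1

end Construction

end

/-! ### Accelerated flows -/

section

variable {d : ℕ} {σ : ℝ → ℝ}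

namespace IsTimeChange

theorem hasDerivWithinAt (h : IsTimeChange σ) {t : ℝ} (ht : t ∈ Ico (0 : ℝ) 1) :
    HasDerivWithinAt σ (derivWithin σ (Ico 0 1) t) (Ico 0 1) t :=
  ((h.smooth t ht).differentiableWithinAt (by simp)).hasDerivWithinAt

theorem continuousOn_deriv (h : IsTimeChange σ) :
    ContinuousOn (derivWithin σ (Ico 0 1)) (Ico 0 1) :=
  h.smooth.continuousOn_derivWithin (uniqueDiffOn_Ico 0 1) (by simp)

theorem strictMonoOn (h : IsTimeChange σ) : StrictMonoOn σ (Ico 0 1) := by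
  refine strictMonoOn_of_deriv_pos (convex_Ico 0 1) h.smooth.continuousOn fun t ht => ?_
  have ht' := interior_subset ht
  rw [interior_Ico] at ht
  have := h.deriv_pos t ht'
  rwa [derivWithin_of_mem_nhds (Ico_mem_nhds ht.1 ht.2)] at this

theorem nonneg (h : IsTimeChange σ) {t : ℝ} (ht : t ∈ Ico (0 : ℝ) 1) : 0 ≤ σ t :=
  h.bijOn.mapsTo ht

theorem measurable_indicator (h : IsTimeChange σ) : Measurable ((Ico 0 1).indicator σ) := by
  classical
  rw [← Set.piecewise_eq_indicator]
  exact h.smooth.continuousOn.measurable_piecewise continuousOn_const measurableSet_Ico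

theorem measurable_indicator_deriv (h : IsTimeChange σ) :
    Measurable ((Ico 0 1).indicator (derivWithin σ (Ico 0 1))) := by
  classical
  rw [← Set.piecewise_eq_indicator]
  exact h.continuousOn_deriv.measurable_piecewise continuousOn_const measurableSet_Ico

/-- By the change of variables formula the integral of `σ'` over the preimage of a null set is zero,
and `σ' > 0`. Through this, properties of `u` at almost every time pass to the accelerated flow. The
indicator makes the map measurable on the whole line. -/
theorem quasiMeasurePreserving (h : IsTimeChange σ) :
    Measure.QuasiMeasurePreserving ((Ico 0 1).indicator σ) (volume.restrict (Ico 0 1))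
      (volume.restrict (Ici 0)) := by
  refine ⟨h.measurable_indicator, Measure.AbsolutelyContinuous.mk fun N hN hN0 => ?_⟩
  rw [Measure.map_apply h.measurable_indicator hN]
  have h1 := lintegral_image_eq_lintegral_abs_deriv_mul measurableSet_Ico
    (fun t ht => h.hasDerivWithinAt ht) h.bijOn.injOn (N.indicator 1)
  rw [h.bijOn.image_eq, lintegral_indicator_one hN, hN0] at h1
  have hm : AEMeasurable (fun t => ENNReal.ofReal |derivWithin σ (Ico 0 1) t| *
      N.indicator 1 (σ t)) (volume.restrict (Ico 0 1)) := by
    refine AEMeasurable.congr (f := fun t =>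
      ENNReal.ofReal |(Ico 0 1).indicator (derivWithin σ (Ico 0 1)) t| *
        N.indicator 1 ((Ico 0 1).indicator σ t)) ?_ ?_
    · refine (h.measurable_indicator_deriv.norm.ennreal_ofReal.mul ?_).aemeasurable
      exact (measurable_one.indicator hN).comp h.measurable_indicator
    · filter_upwards [ae_restrict_mem measurableSet_Ico] with t ht
      rw [indicator_of_mem ht, indicator_of_mem ht]
  have h2 := (lintegral_eq_zero_iff' hm).1 h1.symm
  have h3 : ∀ᵐ t ∂(volume.restrict (Ico (0 : ℝ) 1)), t ∉ (Ico 0 1).indicator σ ⁻¹' N := by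
    filter_upwards [h2, ae_restrict_mem measurableSet_Ico] with t ht htI hcon
    rw [mem_preimage, indicator_of_mem htI] at hcon
    simp only [Pi.zero_apply, indicator_of_mem hcon, Pi.one_apply, mul_one,
      ENNReal.ofReal_eq_zero] at ht
    exact absurd ht (not_le.2 (abs_pos.2 (h.deriv_pos t htI).ne'))
  rw [ae_iff] at h3
  simp only [not_not] at h3
  exact h3

theorem ae_comp (h : IsTimeChange σ) {P : ℝ → Prop}
    (hP : ∀ᵐ r ∂(volume.restrict (Ici (0 : ℝ))), P r) :
    ∀ᵐ t ∂(volume.restrict (Ico (0 : ℝ) 1)), P (σ t) := by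
  filter_upwards [h.quasiMeasurePreserving.ae hP, ae_restrict_mem measurableSet_Ico] with t ht htI
  rwa [indicator_of_mem htI] at ht

theorem ae_comp_restrict (h : IsTimeChange σ) {P : ℝ → Prop} {T : ℝ} (hT : T ∈ Ico (0 : ℝ) 1)
    (hP : ∀ᵐ r ∂(volume.restrict (Icc 0 (σ T))), P r) :
    ∀ᵐ t ∂(volume.restrict (Icc (0 : ℝ) T)), P (σ t) := by
  have h1 : ∀ᵐ r ∂(volume.restrict (Ici (0 : ℝ))), r ≤ σ T → P r := by
    rw [ae_restrict_iff' measurableSet_Icc] at hP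
    rw [ae_restrict_iff' measurableSet_Ici]
    filter_upwards [hP] with r hr h0 h1 using hr ⟨h0, h1⟩
  have hsub : Icc 0 T ⊆ Ico (0 : ℝ) 1 := fun t ht => ⟨ht.1, ht.2.trans_lt hT.2⟩
  filter_upwards [ae_restrict_of_ae_restrict_of_subset hsub (h.ae_comp h1),
    ae_restrict_mem measurableSet_Icc] with t ht htI
  exact ht (h.strictMonoOn.monotoneOn (hsub htI) hT htI.2)

end IsTimeChange

theorem grad_inner_smul (c : ℝ) (a b : Vec d) : inner ℝ (c • a) b = c * inner ℝ a b := by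
  rw [inner_smul_left]; rfl

/-- The accelerated flow is locally bounded before time `1`. -/
theorem IsFlow.isBoundedFlow_accel {u : ℝ → Torus d → Vec d} (hu : IsFlow u) (h : IsTimeChange σ)
    {T : ℝ} (hT : T < 1) : ∃ M, IsBoundedFlow (accel u σ) (Icc 0 T) M := by
  rcases lt_or_ge T 0 with hT0 | hT0
  · refine ⟨0, le_rfl, ?_, ?_, fun φ _ => ?_⟩ <;> simp [Icc_eq_empty (not_le.2 hT0)]
  have hTI : T ∈ Ico (0 : ℝ) 1 := ⟨hT0, hT⟩
  have hsub : Icc 0 T ⊆ Ico (0 : ℝ) 1 := fun t ht => ⟨ht.1, ht.2.trans_lt hT⟩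
  have hle : volume.restrict (Icc 0 T) ≤ volume.restrict (Ico (0 : ℝ) 1) :=
    Measure.restrict_mono hsub le_rfl
  obtain ⟨M, hM⟩ := hu.isBoundedFlow (σ T)
  obtain ⟨C, hC0, hC⟩ := exists_norm_le (h.continuousOn_deriv.mono hsub)
  have hq : Measure.QuasiMeasurePreserving (Prod.map ((Ico 0 1).indicator σ)
      (id : Torus d → Torus d))
      ((volume.restrict (Ico 0 1)).prod volume) ((volume.restrict (Ici 0)).prod volume) :=
    MeasureTheory.QuasiMeasurePreserving.prodMap h.quasiMeasurePreserving
      (Measure.QuasiMeasurePreserving.id _)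
  have hmemI : ∀ᵐ z ∂((volume.restrict (Ico (0 : ℝ) 1)).prod (volume : Measure (Torus d))),
      z.1 ∈ Ico (0 : ℝ) 1 :=
    Measure.quasiMeasurePreserving_fst.ae (ae_restrict_mem measurableSet_Ico)
  refine ⟨C * M, mul_nonneg hC0 hM.nonneg, ?_, ?_, ?_⟩
  · have h1 := hu.measurable.comp_quasiMeasurePreserving hq
    have h2 : AEStronglyMeasurable (fun z : ℝ × Torus d =>
        (Ico 0 1).indicator (derivWithin σ (Ico 0 1)) z.1)
        ((volume.restrict (Ico 0 1)).prod volume) :=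
      (h.measurable_indicator_deriv.comp measurable_fst).aestronglyMeasurable
    refine AEStronglyMeasurable.mono_measure ?_ (Measure.prod_mono hle le_rfl)
    refine (h2.smul h1).congr ?_
    filter_upwards [hmemI] with z hz
    simp [accel, indicator_of_mem hz]
  · have hb : ∀ᵐ z ∂((volume.restrict (Ici (0 : ℝ))).prod (volume : Measure (Torus d))),
        z.1 ≤ σ T → ‖u z.1 z.2‖ ≤ M := by
      have h1 := hM.bound
      have e1 : (volume.restrict (Icc 0 (σ T))).prod (volume : Measure (Torus d)) =
          (volume.prod volume).restrict (Icc 0 (σ T) ×ˢ univ) := by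
        rw [← Measure.prod_restrict, Measure.restrict_univ]
      have e2 : (volume.restrict (Ici (0 : ℝ))).prod (volume : Measure (Torus d)) =
          (volume.prod volume).restrict (Ici (0 : ℝ) ×ˢ univ) := by
        rw [← Measure.prod_restrict, Measure.restrict_univ]
      rw [e1, ae_restrict_iff' (measurableSet_Icc.prod MeasurableSet.univ)] at h1
      rw [e2, ae_restrict_iff' (measurableSet_Ici.prod MeasurableSet.univ)]
      filter_upwards [h1] with z hz h2 h3 using hz ⟨⟨h2.1, h3⟩, mem_univ _⟩
    have hb2 := ae_mono (Measure.prod_mono hle le_rfl) (hq.ae hb)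
    have hmemT : ∀ᵐ z ∂((volume.restrict (Icc (0 : ℝ) T)).prod (volume : Measure (Torus d))),
        z.1 ∈ Icc (0 : ℝ) T :=
      Measure.quasiMeasurePreserving_fst.ae (ae_restrict_mem measurableSet_Icc)
    filter_upwards [hb2, hmemT] with z hz hzT
    have hzI := hsub hzT
    simp only [Prod.map_fst, Prod.map_snd, id, indicator_of_mem hzI] at hz
    rw [accel, norm_smul]
    exact mul_le_mul (hC _ hzT) (hz (h.strictMonoOn.monotoneOn hzI hTI hzT.2)) (norm_nonneg _) hC0
  · intro φ hφ
    filter_upwards [h.ae_comp_restrict hTI (hM.div φ hφ)] with t ht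
    simp only [accel, grad_inner_smul]
    rw [integral_const_mul, ht, mul_zero]

/-- A solution for the accelerated flow on an interval where the acceleration is constant is a
solution for the original flow in the accelerated time. -/
theorem IsSolution.of_accel {u : ℝ → Torus d → Vec d} {ν a b l : ℝ} {θ₀ : L2 d} {θ : ℝ → L2 d}
    (hl : 0 < l)
    (hσ : ∀ t ∈ Icc a b, σ t = σ a + l * (t - a))
    (hσ' : ∀ t ∈ Icc a b, derivWithin σ (Ico 0 1) t = l)
    (h : IsSolution (accel u σ) ν a (Icc a b) θ₀ θ) :
    IsSolution u (ν / l) (σ a) (Icc (σ a) (σ a + l * (b - a))) θ₀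
      (fun q => θ (a + (q - σ a) / l)) := by
  have hmap : ∀ q ∈ Icc (σ a) (σ a + l * (b - a)), a + (q - σ a) / l ∈ Icc a b := by
    intro q hq
    refine ⟨le_add_of_nonneg_right (div_nonneg (sub_nonneg.2 hq.1) hl.le), ?_⟩
    have : (q - σ a) / l ≤ b - a := by
      rw [div_le_iff₀ hl]; linarith [hq.2]
    linarith
  refine ⟨h.continuousOn.comp (by fun_prop) hmap, by simpa using h.initial, fun φ hφ q hq => ?_⟩
  have h1 := h.weak φ hφ _ (hmap q hq)
  rw [h1]
  set g : ℝ → ℝ := fun r => ∫ x, θ (a + (r - σ a) / l) x *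
    (ν / l * lap φ x + inner ℝ (u r x) (grad φ x)) with hg
  -- Substitution of the linear time change. The factor `l` cancels the acceleration of the velocity
  -- and divides the diffusivity.
  have h2 := intervalIntegral.smul_integral_comp_add_mul (a := a) (b := a + (q - σ a) / l) g l
    (σ a - l * a)
  have e1 : σ a - l * a + l * a = σ a := by ring
  have e2 : σ a - l * a + l * (a + (q - σ a) / l) = q := by field_simp; ring
  rw [e1, e2, smul_eq_mul] at h2
  rw [← h2, ← intervalIntegral.integral_const_mul]
  refine intervalIntegral.integral_congr fun r hr => ?_
  rw [uIcc_of_le (hmap q hq).1] at hr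
  have hr' : r ∈ Icc a b := ⟨hr.1, hr.2.trans (hmap q hq).2⟩
  have e3 : σ a - l * a + l * r = σ r := by rw [hσ r hr']; ring
  have e4 : a + (σ r - σ a) / l = r := by rw [hσ r hr']; field_simp; ring
  simp only [hg, e3, e4, accel, hσ' r hr', grad_inner_smul]
  rw [← integral_const_mul]
  refine integral_congr_ae (ae_of_all _ fun x => ?_)
  field_simp

theorem exists_solNormLE_of_dissTime_lt {u : ℝ → Torus d → Vec d} {ν s c : ℝ} (hs : 0 ≤ s)
    (h : dissTime u ν < ENNReal.ofReal c) :
    ∃ t, s ≤ t ∧ t - s < c ∧ SolNormLE u ν s t (1 / 2) := by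
  have h1 : (⨅ t ∈ {t : ℝ | s ≤ t ∧ SolNormLE u ν s t (1 / 2)}, ENNReal.ofReal (t - s)) <
      ENNReal.ofReal c :=
    lt_of_le_of_lt (le_iSup₂ (f := fun (s : ℝ) (_ : s ∈ Ici (0 : ℝ)) =>
      ⨅ t ∈ {t : ℝ | s ≤ t ∧ SolNormLE u ν s t (1 / 2)}, ENNReal.ofReal (t - s)) s hs) h
  simp only [iInf_lt_iff] at h1
  obtain ⟨t, ht, h2⟩ := h1
  refine ⟨t, ht.1, ?_, ht.2⟩
  by_contra hcon
  exact absurd h2 (not_lt.2 (ENNReal.ofReal_le_ofReal (not_lt.1 hcon)))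

/-- A flow accelerated faster and faster on dyadic intervals dissipates everything at time `1`. -/
theorem totallyDiffusive_accel {u : ℝ → Torus d → Vec d} (hu : IsFlow u) (h : IsTimeChange σ)
    {l : ℕ → ℝ} (hl : ∀ n, 0 < l n)
    (hσ' : ∀ n, ∀ t ∈ Icc (midDyad n) (dyad (n + 1)), derivWithin σ (Ico 0 1) t = l n)
    (hσ : ∀ n, ∀ t ∈ Icc (midDyad n) (dyad (n + 1)),
      σ t = σ (midDyad n) + l n * (t - midDyad n))
    (hd : ∀ ν : ℝ, 0 < ν → ∀ᶠ n in atTop,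
      dissTime u (ν / l n) < ENNReal.ofReal (l n * (1 / 2) ^ (n + 2))) :
    TotallyDiffusive (accel u σ) := by
  intro ν hν s hs θ₀ hθ₀
  have hb : ∀ T, s ≤ T → T < 1 → ∃ M, IsBoundedFlow (accel u σ) (Icc s T) M := by
    intro T _ hT
    obtain ⟨M, hM⟩ := hu.isBoundedFlow_accel h hT
    exact ⟨M, hM.mono (Icc_subset_Icc_left hs.1)⟩
  refine ⟨exists_isSolution_Ico hν hs.2 hb θ₀, fun θ hθ => ?_⟩
  have hanti : ∀ a b, s ≤ a → a ≤ b → b < 1 → ‖θ b‖ ≤ ‖θ a‖ := by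
    intro a b ha hab hb1
    obtain ⟨M, hM⟩ := hb b (ha.trans hab) hb1
    exact hM.norm_le hν (hθ.mono fun t ht => ⟨ht.1, ht.2.trans_lt hb1⟩) ha hab le_rfl
  -- Only the second half of the dyadic interval is used, where the acceleration is constant. In the
  -- first half it is enough that the norm does not increase.
  have hhalf : ∀ n, s ≤ dyad n → dissTime u (ν / l n) < ENNReal.ofReal (l n * (1 / 2) ^ (n + 2)) →
      ‖θ (dyad (n + 1))‖ ≤ 1 / 2 * ‖θ (dyad n)‖ := by
    intro n hn hdn
    have hsm := hn.trans (dyad_le_midDyad n)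
    have hm0 : 0 ≤ midDyad n := hs.1.trans hsm
    have hm1 : midDyad n < 1 := (midDyad_le n).trans_lt (dyad_lt_one _)
    obtain ⟨t, hst, htc, ht⟩ := exists_solNormLE_of_dissTime_lt (h.nonneg ⟨hm0, hm1⟩) hdn
    obtain ⟨M, hM⟩ := hb (dyad (n + 1)) (hsm.trans (midDyad_le n)) (dyad_lt_one _)
    have h1 := hM.restart (hθ.mono fun t ht => ⟨ht.1, ht.2.trans_lt (dyad_lt_one _)⟩) hsm
      (midDyad_le n) le_rfl
    have h2 := h1.of_accel (hl n) (hσ n) (hσ' n)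
    rw [dyad_succ_eq, add_sub_cancel_left] at h2
    have h3 := ht _ (hθ.mem_L20 hθ₀ ⟨hsm, hm1⟩) _
      (h2.mono (Icc_subset_Icc_right (by linarith)))
    -- The moment in original time at which the norm has been halved, read in accelerated time; the
    -- assumption on the dissipation time places it before `dyad (n + 1)`.
    set q := midDyad n + (t - σ (midDyad n)) / l n with hq
    have hq0 : midDyad n ≤ q := le_add_of_nonneg_right (div_nonneg (sub_nonneg.2 hst) (hl n).le)
    have hq1 : q ≤ dyad (n + 1) := by
      have : (t - σ (midDyad n)) / l n ≤ (1 / 2) ^ (n + 2) := by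
        rw [div_le_iff₀ (hl n)]; linarith
      rw [dyad_succ_eq]; linarith
    calc ‖θ (dyad (n + 1))‖ ≤ ‖θ q‖ := hanti _ _ (hsm.trans hq0) hq1 (dyad_lt_one _)
      _ ≤ 1 / 2 * ‖θ (midDyad n)‖ := h3
      _ ≤ 1 / 2 * ‖θ (dyad n)‖ := by
        linarith [hanti _ _ hn (dyad_le_midDyad n) hm1]
  obtain ⟨n1, hn1⟩ := exists_lt_dyad hs.2
  obtain ⟨n2, hn2⟩ := eventually_atTop.1 (hd ν hν)
  set n0 := max n1 n2
  have hsn : ∀ m, s ≤ dyad (n0 + m) := fun m =>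
    hn1.le.trans (dyad_mono ((le_max_left _ _).trans (Nat.le_add_right _ _)))
  have hgeo : ∀ m, ‖θ (dyad (n0 + m))‖ ≤ (1 / 2) ^ m * ‖θ (dyad n0)‖ := by
    intro m
    induction m with
    | zero => simp
    | succ m ih =>
      have := hhalf (n0 + m) (hsn m) (hn2 _ ((le_max_right _ _).trans (Nat.le_add_right _ _)))
      rw [pow_succ, ← add_assoc]
      linarith
  rw [tendsto_zero_iff_norm_tendsto_zero]
  have hlim : Tendsto (fun m : ℕ => (1 / 2 : ℝ) ^ m * ‖θ (dyad n0)‖) atTop (𝓝 0) := by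
    have := (tendsto_pow_atTop_nhds_zero_of_lt_one (r := (1 / 2 : ℝ)) (by norm_num)
      (by norm_num)).mul_const ‖θ (dyad n0)‖
    rwa [zero_mul] at this
  rw [Metric.tendsto_nhds]
  intro ε hε
  obtain ⟨m, hm⟩ := (hlim.eventually (gt_mem_nhds hε)).exists
  have hnear : Ioo (dyad (n0 + m)) 1 ∈ 𝓝[<] (1 : ℝ) :=
    Ioo_mem_nhdsLT (dyad_lt_one _)
  filter_upwards [hnear] with t ht
  rw [Real.dist_eq, sub_zero, abs_of_nonneg (norm_nonneg _)]
  exact ((hanti _ _ (hsn m) ht.1.le ht.2).trans (hgeo m)).trans_lt hm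

end

/-! ### Relaxation enhancing flows -/

section

variable {d : ℕ} {u : ℝ → Torus d → Vec d}

theorem hartley_mem_L20 {k : Fin d → ℤ} (hk : k ≠ 0) : hartley d k ∈ L20 d := by
  classical
  rw [mem_L20_iff]
  have := (hartley d).orthonormal
  rw [orthonormal_iff_ite] at this
  rw [this, if_neg (Ne.symm hk)]

/-- Dissipation is not faster than the decay of a single Fourier mode. -/
theorem IsFlow.exists_le_dissTime (hd : 1 ≤ d) (hu : IsFlow u) :
    ∃ M : ℝ, 0 < M ∧ ∀ b : ℝ, 0 < b → ENNReal.ofReal (1 / (2 * (b + M))) ≤ dissTime u b := by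
  obtain ⟨M, hM⟩ := hu.isBoundedFlow 1
  have hM0 := hM.nonneg
  refine ⟨M + 1, by linarith, fun b hb => ?_⟩
  have hM1 : (0 : ℝ) < b + (M + 1) := by linarith
  refine le_trans ?_ (le_iSup₂ (f := fun (s : ℝ) (_ : s ∈ Ici (0 : ℝ)) =>
      ⨅ t ∈ {t : ℝ | s ≤ t ∧ SolNormLE u b s t (1 / 2)}, ENNReal.ofReal (t - s)) 0 self_mem_Ici)
  refine le_iInf₂ fun t ht => ENNReal.ofReal_le_ofReal ?_
  obtain ⟨ht0, ht⟩ := ht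
  rw [sub_zero]
  -- The velocity bound was taken on the time interval from `0` to `1`; a later `t` exceeds the
  -- claimed lower bound anyway, since `M + 1 ≥ 1`.
  rcases le_or_gt 1 t with h1 | h1
  · refine le_trans ?_ h1
    rw [div_le_one (by linarith)]
    linarith
  set k : Fin d → ℤ := Pi.single ⟨0, hd⟩ 1 with hk
  have hk0 : k ≠ 0 := by simp [hk]
  have hks : sqLen k = 1 := by
    rw [sqLen, Finset.sum_eq_single ⟨0, hd⟩]
    · simp [hk]
    · intro i _ hi; simp [hk, hi]
    · simp
  have hMt := hM.mono (Icc_subset_Icc_right h1.le : Icc 0 t ⊆ Icc 0 1)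
  obtain ⟨S, hSM, hS⟩ := hMt.exists_drift
  obtain ⟨θ, hθ, hθ0⟩ := S.exists_isMode hb ht0 (hartley d k)
  have hsol := (hS b 0 t _ θ le_rfl ht0 le_rfl).2 ⟨hθ, hθ0⟩
  have hnorm : ‖hartley d k‖ = 1 := (hartley d).orthonormal.1 k
  have h2 := ht _ (hartley_mem_L20 hk0) θ hsol
  rw [hnorm, mul_one] at h2
  have hle : ∀ r ∈ Icc 0 t, ‖θ r‖ ≤ 1 := fun r hr => by
    have := hθ.norm_le hb le_rfl hr.1 hr.2
    rwa [hθ0, hnorm] at this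
  have h3 := hθ.eq k t ⟨ht0, le_rfl⟩
  -- The coefficient of the chosen mode, with `|k| = 1`, starts at `1` and changes at speed at most
  -- `b + M + 1`. Halving the norm forces it down to `1/2`, which takes at least the stated time.
  have h4 : ‖∫ r in (0 : ℝ)..t, S.rhs b θ k r‖ ≤ (b + (M + 1)) * |t - 0| := by
    refine intervalIntegral.norm_integral_le_of_norm_le_const fun r hr => ?_
    rw [uIoc_of_le ht0] at hr
    have hr' := hle r ⟨hr.1.le, hr.2⟩
    have h5 := S.abs_F_le r k (θ r)
    rw [hks, Real.sqrt_one, one_mul, hSM] at h5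
    have h6 : |⟪hartley d k, θ r⟫| ≤ 1 := by
      refine (abs_real_inner_le_norm _ _).trans ?_
      rw [hnorm, one_mul]; exact hr'
    rw [Drift.rhs, hks, Real.norm_eq_abs]
    refine (abs_add_le _ _).trans (add_le_add ?_ (h5.trans ?_))
    · rw [abs_neg, abs_mul, mul_one, abs_of_pos hb]
      exact mul_le_of_le_one_right hb.le h6
    · nlinarith
  rw [← h3, hθ0, real_inner_self_eq_norm_sq, hnorm, sub_zero, abs_of_nonneg ht0,
    Real.norm_eq_abs] at h4
  have h7 : ⟪hartley d k, θ t⟫ ≤ 1 / 2 := by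
    refine (real_inner_le_norm _ _).trans ?_
    rw [hnorm, one_mul]; exact h2
  have h8 := neg_abs_le (⟪hartley d k, θ t⟫ - 1 ^ 2)
  rw [div_le_iff₀ (by linarith)]
  nlinarith

theorem ofReal_mul_dissTime_le_relaxFun {a b : ℝ} (hb : 0 ≤ b) (hab : b ≤ a) :
    ENNReal.ofReal b * dissTime u b ≤ relaxFun u a :=
  le_iSup₂ (f := fun (b : ℝ) (_ : b ∈ Icc 0 a) => ENNReal.ofReal b * dissTime u b) b ⟨hb, hab⟩

theorem relaxInv_mono {y z : ℝ} (h : y ≤ z) : relaxInv u y ≤ relaxInv u z :=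
  biSup_mono fun _ ha => ⟨ha.1, ha.2.trans (ENNReal.ofReal_le_ofReal h)⟩

/-- If `f(a) ≤ y`, the lower bound for the dissipation time gives `a / (2 (a + M)) ≤ y`; with `y ≤
1/4` this is `a ≤ a/2 + 2 M y`. Besides finiteness, the linear bound in `y` makes the rates of
acceleration grow like `2^n` at least. -/
theorem IsFlow.exists_relaxInv_le (hd : 1 ≤ d) (hu : IsFlow u) : ∃ M : ℝ, 0 < M ∧
    ∀ y : ℝ, 0 ≤ y → y ≤ 1 / 4 → relaxInv u y ≤ ENNReal.ofReal (4 * M * y) := by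
  obtain ⟨M, hM0, hM⟩ := hu.exists_le_dissTime hd
  refine ⟨M, hM0, fun y hy0 hy => iSup₂_le fun a ha => ENNReal.ofReal_le_ofReal ?_⟩
  obtain ⟨ha0, ha⟩ := ha
  rcases ha0.eq_or_lt with rfl | ha1
  · positivity
  have h1 : ENNReal.ofReal (a * (1 / (2 * (a + M)))) ≤ ENNReal.ofReal y := by
    rw [ENNReal.ofReal_mul ha0]
    exact (mul_le_mul_right (hM a ha1) _).trans ((ofReal_mul_dissTime_le_relaxFun ha0 le_rfl).trans ha)
  rw [ENNReal.ofReal_le_ofReal_iff hy0, mul_one_div, div_le_iff₀ (by positivity)] at h1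
  nlinarith

theorem RelaxationEnhancing.relaxInv_pos (h : RelaxationEnhancing u) {y : ℝ} (hy : 0 < y) :
    0 < relaxInv u y := by
  have h1 := h.eventually (gt_mem_nhds (ENNReal.ofReal_pos.2 hy))
  obtain ⟨δ, hδ, h2⟩ := mem_nhdsGT_iff_exists_Ioo_subset.1 h1
  have hδ0 : (0 : ℝ) < δ := hδ
  refine lt_of_lt_of_le (ENNReal.ofReal_pos.2 (half_pos hδ0)) ?_
  refine le_iSup₂ (f := fun (a : ℝ) (_ : a ∈ {a : ℝ | 0 ≤ a ∧ relaxFun u a ≤ ENNReal.ofReal y}) =>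
    ENNReal.ofReal a) (δ / 2) ⟨(half_pos hδ0).le, iSup₂_le fun b hb => ?_⟩
  rcases hb.1.eq_or_lt with rfl | hb0
  -- At `b = 0` the product is `0`, even if the dissipation time is infinite.
  · simp
  · have : b ∈ Ioo 0 δ := ⟨hb0, hb.2.trans_lt (half_lt_self hδ0)⟩
    exact le_of_lt (h2 this)

/-- Below `relaxInv`, the relaxation function is small. -/
theorem ofReal_mul_dissTime_le_of_lt_relaxInv {a y : ℝ} (ha : 0 ≤ a)
    (h : ENNReal.ofReal a < relaxInv u y) :
    ENNReal.ofReal a * dissTime u a ≤ ENNReal.ofReal y := by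
  simp only [relaxInv, lt_iSup_iff] at h
  obtain ⟨b, hb, hab⟩ := h
  exact (ofReal_mul_dissTime_le_relaxFun ha (ENNReal.ofReal_lt_ofReal_iff'.1 hab).1.le).trans hb.2

/-- The argument of `relaxInv` in the rate of acceleration. -/
noncomputable def rateArg (t : ℝ) : ℝ := (1 - t) / (4 * (absLog t + 1))

theorem absLog_nonneg (t : ℝ) : 0 ≤ absLog t := abs_nonneg _

theorem rateArg_pos {t : ℝ} (ht : t < 1) : 0 < rateArg t :=
  div_pos (sub_pos.2 ht) (by linarith [absLog_nonneg t])

theorem absLog_eq {t : ℝ} (ht : t ∈ Ico (0 : ℝ) 1) : absLog t = -Real.logb 2 (1 - t) :=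
  abs_of_nonpos (Real.logb_nonpos (by norm_num) (by linarith [ht.2]) (by linarith [ht.1]))

theorem absLog_dyad (n : ℕ) : absLog (dyad n) = n := by
  rw [absLog_eq ⟨dyad_nonneg n, dyad_lt_one n⟩, dyad, sub_sub_cancel, one_div, inv_pow,
    Real.logb_inv, neg_neg, Real.logb_pow, Real.logb_self_eq_one (by norm_num), mul_one]

theorem absLog_monotoneOn : MonotoneOn absLog (Ico 0 1) := by
  intro s hs t ht hst
  rw [absLog_eq hs, absLog_eq ht, neg_le_neg_iff]
  exact Real.logb_le_logb_of_le (by norm_num) (by linarith [ht.2]) (by linarith)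

theorem rateArg_antitoneOn : AntitoneOn rateArg (Ico 0 1) := by
  intro s hs t ht hst
  have h1 := absLog_monotoneOn hs ht hst
  have h2 := absLog_nonneg s
  unfold rateArg
  exact div_le_div₀ (by linarith [hs.2]) (by linarith) (by linarith) (by linarith)

theorem rateArg_le {t : ℝ} (ht : t ∈ Ico (0 : ℝ) 1) : rateArg t ≤ 1 / 4 := by
  have h2 := absLog_nonneg t
  rw [rateArg, div_le_iff₀ (by linarith)]
  linarith [ht.1]

theorem exists_mem_Ico_dyad {t : ℝ} (ht : t ∈ Ico (0 : ℝ) 1) :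
    ∃ n, t ∈ Ico (dyad n) (dyad (n + 1)) := by
  classical
  have h := exists_lt_dyad ht.2
  have h1 := Nat.find_spec h
  obtain ⟨n, hn⟩ : ∃ n, Nat.find h = n + 1 := by
    refine Nat.exists_eq_succ_of_ne_zero fun h0 => ?_
    rw [h0, dyad_zero] at h1
    exact absurd ht.1 (not_le.2 h1)
  refine ⟨n, not_lt.1 (Nat.find_min h (by omega)), ?_⟩
  rwa [hn] at h1

/-- Composition with a time change and multiplication by a small weight do not increase the norm. -/
theorem linftyNorm_accel_le {X : Type*} [NormedAddCommGroup X] [NormedSpace ℝ X]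
    (ι : X →ₗ[ℝ] (Torus d →ₘ[(volume : Measure (Torus d))] Vec d)) {σ : ℝ → ℝ}
    (h : IsTimeChange σ) {c : ℝ → ℝ} (hc : AEMeasurable c (volume.restrict (Ico 0 1)))
    (hc0 : ∀ t ∈ Ico (0 : ℝ) 1, 0 ≤ c t)
    (hc1 : ∀ t ∈ Ico (0 : ℝ) 1, c t * derivWithin σ (Ico 0 1) t ≤ 1) :
    linftyNorm ι (Ico 0 1) (fun t x => c t • accel u σ t x) ≤ linftyNorm ι (Ici 0) u := by
  refine le_iInf₂ fun V hV => ?_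
  obtain ⟨hVm, hVu⟩ := hV
  set D := derivWithin σ (Ico 0 1)
  have hDm : AEStronglyMeasurable D (volume.restrict (Ico 0 1)) := by
    refine h.measurable_indicator_deriv.aestronglyMeasurable.congr ?_
    filter_upwards [ae_restrict_mem measurableSet_Ico] with t ht
    rw [indicator_of_mem ht]
  have hcomp : AEStronglyMeasurable (fun t => V (σ t)) (volume.restrict (Ico 0 1)) := by
    refine (hVm.comp_quasiMeasurePreserving h.quasiMeasurePreserving).congr ?_
    filter_upwards [ae_restrict_mem measurableSet_Ico] with t ht
    rw [Function.comp_apply, indicator_of_mem ht]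
  have h1 : AEStronglyMeasurable (fun t => (c t * D t) • V (σ t)) (volume.restrict (Ico 0 1)) :=
    (hc.aestronglyMeasurable.mul hDm).smul hcomp
  have h2 : ∀ᵐ t ∂(volume.restrict (Ico (0 : ℝ) 1)),
      (ι ((c t * D t) • V (σ t)) : Torus d → Vec d) =ᵐ[volume] fun x => c t • accel u σ t x := by
    filter_upwards [h.ae_comp hVu] with t ht
    rw [map_smul]
    filter_upwards [ht, AEEqFun.coeFn_smul (c t * D t) (ι (V (σ t)))] with x hx hx2
    rw [hx2, Pi.smul_apply, hx, accel, mul_smul]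
  refine (iInf₂_le (fun t => (c t * D t) • V (σ t)) ⟨h1, h2⟩).trans ?_
  rw [eLpNorm_exponent_top, eLpNorm_exponent_top]
  refine eLpNormEssSup_le_of_ae_enorm_bound ?_
  filter_upwards [h.ae_comp (enorm_ae_le_eLpNormEssSup V (volume.restrict (Ici 0))),
    ae_restrict_mem measurableSet_Ico] with t ht htI
  refine le_trans ?_ ht
  rw [enorm_smul]
  refine mul_le_of_le_one_left zero_le ?_
  rw [Real.enorm_eq_ofReal (mul_nonneg (hc0 t htI) (h.deriv_pos t htI).le)]
  exact ENNReal.ofReal_le_one.2 (hc1 t htI)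

theorem IsFlow.relaxInv_lt_top (hd : 1 ≤ d) (hu : IsFlow u) {t : ℝ} (ht : t ∈ Ico (0 : ℝ) 1) :
    relaxInv u (rateArg t) < ∞ := by
  obtain ⟨M, -, hM⟩ := hu.exists_relaxInv_le hd
  exact (hM _ (rateArg_pos ht.2).le (rateArg_le ht)).trans_lt ENNReal.ofReal_lt_top

/-- Total diffusion with the rate of acceleration given by the relaxation function. -/
theorem exists_isTimeChange_of_relaxationEnhancing (hd : 1 ≤ d) (hu : IsFlow u)
    (h : RelaxationEnhancing u) : ∃ σ : ℝ → ℝ, IsTimeChange σ ∧ TotallyDiffusive (accel u σ) ∧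
      ∀ t ∈ Ico (0 : ℝ) 1, (relaxInv u (rateArg t)).toReal / (2 * (absLog t + 1)) *
        derivWithin σ (Ico 0 1) t ≤ 1 := by
  have hI : ∀ n, dyad n ∈ Ico (0 : ℝ) 1 := fun n => ⟨dyad_nonneg n, dyad_lt_one n⟩
  set R : ℕ → ℝ := fun n => (relaxInv u (rateArg (dyad n))).toReal with hR
  have hRpos : ∀ n, 0 < R n := fun n => ENNReal.toReal_pos
    (h.relaxInv_pos (rateArg_pos (dyad_lt_one n))).ne' (hu.relaxInv_lt_top hd (hI n)).ne
  have hRmono : ∀ s ∈ Ico (0 : ℝ) 1, ∀ t ∈ Ico (0 : ℝ) 1, s ≤ t →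
      (relaxInv u (rateArg t)).toReal ≤ (relaxInv u (rateArg s)).toReal := fun s hs t ht hst =>
    ENNReal.toReal_mono (hu.relaxInv_lt_top hd hs).ne (relaxInv_mono (rateArg_antitoneOn hs ht hst))
  have harg : ∀ n : ℕ, rateArg (dyad n) = (1 / 2) ^ n / (4 * (n + 1)) := by
    intro n
    rw [rateArg, absLog_dyad, dyad, sub_sub_cancel]
  -- The reciprocal of the weight of the theorem at `dyad n`. The weight decreases, so its product
  -- with `σ' ≤ l n` on the dyadic interval is at most `1`.
  set l : ℕ → ℝ := fun n => 2 * (n + 1) / R n with hl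
  have hlpos : ∀ n, 0 < l n := fun n => div_pos (by positivity) (hRpos n)
  have hlmono : Monotone l := by
    refine monotone_nat_of_le_succ fun n => ?_
    have h1 : R (n + 1) ≤ R n := hRmono _ (hI n) _ (hI _) (dyad_mono n.le_succ)
    refine div_le_div₀ (by positivity) ?_ (hRpos _) h1
    push_cast; linarith
  obtain ⟨M, hM0, hM⟩ := hu.exists_relaxInv_le hd
  have hlow : ∀ n : ℕ, 2 / M * 2 ^ n ≤ l n := by
    intro n
    have h1 : R n ≤ 4 * M * rateArg (dyad n) := by
      refine ENNReal.toReal_le_of_le_ofReal ?_ (hM _ (rateArg_pos (dyad_lt_one n)).le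
        (rateArg_le (hI n)))
      have := rateArg_pos (dyad_lt_one n)
      positivity
    rw [harg] at h1
    rw [hl, le_div_iff₀ (hRpos n)]
    have h2 : 4 * M * ((1 / 2) ^ n / (4 * ((n : ℝ) + 1))) = M * (1 / 2) ^ n / (n + 1) := by
      field_simp
    rw [h2] at h1
    have h3 : (2 : ℝ) ^ n * (1 / 2) ^ n = 1 := by rw [← mul_pow]; norm_num
    calc 2 / M * 2 ^ n * R n ≤ 2 / M * 2 ^ n * (M * (1 / 2) ^ n / (n + 1)) :=
          mul_le_mul_of_nonneg_left h1 (by positivity)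
      _ = 2 * (2 ^ n * (1 / 2) ^ n) / (n + 1) := by field_simp
      _ = 2 / (n + 1) := by rw [h3, mul_one]
      _ ≤ 2 := div_le_self (by norm_num) (by linarith [(Nat.cast_nonneg n : (0 : ℝ) ≤ n)])
      _ ≤ 2 * (n + 1) := by linarith [(Nat.cast_nonneg n : (0 : ℝ) ≤ n)]
  obtain ⟨σ, hσ, hσle, hσeq, hσlin⟩ :=
    exists_isTimeChange hlmono (hlpos 0) (div_pos two_pos hM0) hlow
  refine ⟨σ, hσ, totallyDiffusive_accel hu hσ hlpos hσeq hσlin fun ν hν => ?_, fun t ht => ?_⟩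
  -- `n > ν` puts the rescaled diffusivity below `R n`, and `n > 1 / ν` makes the available time
  -- exceed the bound that `R n` provides for the dissipation time.
  · obtain ⟨N, hN⟩ := exists_nat_gt (max ν (1 / ν))
    filter_upwards [eventually_ge_atTop N] with n hn
    have hnN : (N : ℝ) ≤ n := by exact_mod_cast hn
    have h1 : ν < n := (le_max_left _ _).trans_lt (hN.trans_le hnN)
    have h2 : 1 / ν < n := (le_max_right _ _).trans_lt (hN.trans_le hnN)
    rw [div_lt_iff₀ hν] at h2
    set a := ν / l n with ha
    have ha0 : 0 < a := div_pos hν (hlpos n)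
    have haR : a < R n := by
      rw [ha, hl, div_div_eq_mul_div, div_lt_iff₀ (by positivity)]
      nlinarith [hRpos n]
    have h3 : ENNReal.ofReal a < relaxInv u (rateArg (dyad n)) := by
      rw [← ENNReal.ofReal_toReal (hu.relaxInv_lt_top hd (hI n)).ne]
      exact (ENNReal.ofReal_lt_ofReal_iff (hRpos n)).2 haR
    have h4 := ofReal_mul_dissTime_le_of_lt_relaxInv ha0.le h3
    have h5 : rateArg (dyad n) < a * (l n * (1 / 2) ^ (n + 2)) := by
      have : a * (l n * (1 / 2) ^ (n + 2)) = ν * (1 / 2) ^ n / 4 := by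
        have := (hlpos n).ne'
        rw [ha]; field_simp; ring
      rw [this, harg, div_lt_div_iff₀ (by positivity) (by norm_num)]
      have h6 : (0 : ℝ) < (1 / 2) ^ n := by positivity
      nlinarith
    have h6 : ENNReal.ofReal a * dissTime u a <
        ENNReal.ofReal a * ENNReal.ofReal (l n * (1 / 2) ^ (n + 2)) := by
      refine h4.trans_lt ?_
      rw [← ENNReal.ofReal_mul ha0.le]
      exact (ENNReal.ofReal_lt_ofReal_iff (lt_trans (rateArg_pos (dyad_lt_one n)) h5)).2 h5
    exact lt_of_mul_lt_mul_left' h6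
  · obtain ⟨n, hn⟩ := exists_mem_Ico_dyad ht
    have h1 := hRmono _ (hI n) t ht hn.1
    have h2 := absLog_monotoneOn (hI n) ht hn.1
    rw [absLog_dyad] at h2
    have h3 := hσle n t ⟨hn.1, hn.2.le⟩
    have h4 : (relaxInv u (rateArg t)).toReal / (2 * (absLog t + 1)) ≤ R n / (2 * (n + 1)) :=
      div_le_div₀ (hRpos n).le h1 (by positivity) (by linarith)
    calc _ ≤ R n / (2 * (n + 1)) * l n :=
          mul_le_mul h4 h3 (hσ.deriv_pos t ht).le (div_nonneg (hRpos n).le (by positivity))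
      _ = 1 := by
        have := (hRpos n).ne'
        rw [hl]; field_simp

theorem aemeasurable_rate (hd : 1 ≤ d) (hu : IsFlow u) :
    AEMeasurable (fun t => (relaxInv u (rateArg t)).toReal / (2 * (absLog t + 1)))
      (volume.restrict (Ico 0 1)) := by
  refine aemeasurable_restrict_of_antitoneOn measurableSet_Ico fun s hs t ht hst => ?_
  have := absLog_nonneg s
  exact div_le_div₀ ENNReal.toReal_nonneg (ENNReal.toReal_mono (hu.relaxInv_lt_top hd hs).ne
    (relaxInv_mono (rateArg_antitoneOn hs ht hst))) (by linarith)
    (by linarith [absLog_monotoneOn hs ht hst])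

end

/-! ### Decay for mixing flows -/

section

/-- A function is at most its average at some point, which may be chosen outside any null set. -/
theorem exists_mul_le_integral {f : ℝ → ℝ} {P : ℝ → Prop} {a b : ℝ} (hab : a < b)
    (hf : IntegrableOn f (Ioc a b)) (hP : ∀ᵐ r ∂(volume.restrict (Ioc a b)), P r) :
    ∃ t ∈ Ioc a b, P t ∧ (b - a) * f t ≤ ∫ r in a..b, f r := by
  have hN : (volume.restrict (Ioc a b)) {r | ¬(P r ∧ r ∈ Ioc a b)} = 0 := by
    rw [← ae_iff]
    filter_upwards [hP, ae_restrict_mem measurableSet_Ioc] with r h1 h2 using ⟨h1, h2⟩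
  have hne : volume.restrict (Ioc a b) ≠ 0 := by
    rw [Ne, Measure.restrict_eq_zero, Real.volume_Ioc]
    exact (ENNReal.ofReal_pos.2 (sub_pos.2 hab)).ne'
  obtain ⟨t, ht, h1⟩ := exists_notMem_null_le_average hne hf hN
  have ht' : P t ∧ t ∈ Ioc a b := by
    by_contra hcon
    exact ht hcon
  refine ⟨t, ht'.2, ht'.1, ?_⟩
  rw [setAverage_eq, Real.volume_real_Ioc_of_le hab.le, smul_eq_mul, inv_mul_eq_div,
    le_div_iff₀ (sub_pos.2 hab)] at h1
  rw [intervalIntegral.integral_of_le hab.le]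
  linarith

variable {d : ℕ} {u : ℝ → Torus d → Vec d}

/-- The gain of norm decay over one mixing time. -/
noncomputable def decayGain (L T : ℝ) : ℝ := 1 / (6144 * (1 + L * T))

theorem decayGain_pos {L T : ℝ} (hL : 0 ≤ L) (hT : 1 ≤ T) : 0 < decayGain L T := by
  have : 0 ≤ L * T := by positivity
  unfold decayGain; positivity

theorem decayGain_le {L T : ℝ} (hL : 0 ≤ L) (hT : 1 ≤ T) : decayGain L T ≤ 1 / 6144 := by
  have : 0 ≤ L * T := by positivity
  unfold decayGain
  exact one_div_le_one_div_of_le (by norm_num) (by linarith)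

theorem add_mul_le_of_sq_le {x y z A : ℝ} (hx : x ^ 2 ≤ A) (hy : y ^ 2 ≤ A) (hz : z ^ 2 ≤ A) :
    (x + y) * z ≤ 2 * A := by
  nlinarith [sq_nonneg (x - z), sq_nonneg (y - z)]

set_option maxHeartbeats 1000000 in
/-- A smooth mixing flow reduces the `L²` norm over a few mixing times. -/
theorem IsFlow.norm_sq_le_of_mixing (hu : IsFlow u) {L : ℝ} (hL0 : 0 ≤ L)
    (hL : ∀ᵐ t ∂(volume.restrict (Ici (0 : ℝ))), IsSmooth (u t) ∧
      ∀ y, ‖fderiv ℝ (lift (u t)) y‖ ≤ L)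
    {K p ν T a : ℝ} (hK : 0 < K) (hp : 0 < p) (hmix : ExpMixing u K p) (hν : 0 < ν) (hν1 : ν ≤ 1)
    (hKν : 8 * (K * ν) ≤ 1) (hT : 1 ≤ T) (hTν : Real.exp (-(T ^ p) / K) ≤ ν ^ 2) (ha : 0 ≤ a)
    {θ₀ : L2 d} (hθ₀ : θ₀ ∈ L20 d) {θ : ℝ → L2 d}
    (hθ : IsSolution u ν a (Icc a (a + 3 * T)) θ₀ θ) :
    ‖θ (a + 3 * T)‖ ^ 2 ≤ (1 - decayGain L T) * ‖θ₀‖ ^ 2 := by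
  set e := hartley d
  set b := a + 3 * T with hb
  set δ := decayGain L T with hδ
  have hδ0 : 0 < δ := decayGain_pos hL0 hT
  have hδ1 : δ ≤ 1 / 6144 := decayGain_le hL0 hT
  set E := ‖θ₀‖ ^ 2 with hE
  have hE0 : 0 ≤ E := sq_nonneg _
  -- If the norm does not drop, the energy identity makes the total dissipation on the interval at
  -- most `δ * E`.
  by_contra! hcon
  have hab : a ≤ b := by rw [hb]; linarith
  obtain ⟨M, hM⟩ := hu.isBoundedFlow b
  obtain ⟨w, hw, hwu⟩ := hM.exists_isRegular
  have hwI : ∀ s t, 0 ≤ s → t ≤ b → ∀ᵐ r ∂(volume.restrict (Ioc s t)), w r =ᵐ[volume] u r :=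
    fun s t hs ht => ae_restrict_of_ae_restrict_of_subset
      (Ioc_subset_Icc_self.trans (Icc_subset_Icc hs ht)) hwu
  have hgb : ∀ s t, 0 ≤ s → t ≤ b →
      ∀ᵐ r ∂(volume.restrict (Ioc s t)), hw.drift.GradBound L r := by
    intro s t hs ht
    have hsub : Ioc s t ⊆ Ici (0 : ℝ) := fun r hr => hs.trans hr.1.le
    filter_upwards [hwI s t hs ht, ae_restrict_of_ae_restrict_of_subset hsub hL] with r h1 h2
    exact hw.gradBound h2.1 h1 h2.2
  obtain ⟨hmode, hθa⟩ := (isSolution_iff hw hab (hwI a b ha le_rfl)).1 hθ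
  have hnle : ∀ t ∈ Icc a b, ‖θ t‖ ^ 2 ≤ E := fun t ht => by
    have := hmode.norm_le hν le_rfl ht.1 ht.2
    rw [hθa] at this
    exact pow_le_pow_left₀ (norm_nonneg _) this 2
  obtain ⟨hH1, hgi⟩ := hmode.ae_isH1 hν
  have hgii : ∀ s t, a ≤ s → s ≤ t → t ≤ b →
      IntervalIntegrable (fun r => gradSq e (θ r)) volume s t := fun s t hs hst ht =>
    (intervalIntegrable_iff_integrableOn_Ioc_of_le hst).2 (hgi.mono_set (Ioc_subset_Ioc hs ht))
  have htot : 2 * ν * ∫ r in a..b, gradSq e (θ r) ≤ δ * E := by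
    have h1 := hmode.energy hν ⟨hab, le_rfl⟩
    rw [hθa] at h1
    linarith
  have hpart : ∀ s t, a ≤ s → s ≤ t → t ≤ b →
      ν * ∫ r in s..t, gradSq e (θ r) ≤ δ * E / 2 := by
    intro s t hs hst ht
    have h1 : ∫ r in s..t, gradSq e (θ r) ≤ ∫ r in a..b, gradSq e (θ r) :=
      intervalIntegral.integral_mono_interval hs hst ht
        (Eventually.of_forall fun r => gradSq_nonneg e _) (hgii a b le_rfl hab le_rfl)
    have h2 := mul_le_mul_of_nonneg_left h1 hν.le
    linarith
  have hpick : ∀ s, a ≤ s → s + T ≤ b → ∃ t ∈ Ioc s (s + T), IsH1 e (θ t) ∧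
      ν * gradSq e (θ t) ≤ δ * E / (2 * T) := by
    intro s hs hst
    have hsub : Ioc s (s + T) ⊆ Ioc a b := Ioc_subset_Ioc hs hst
    obtain ⟨t, ht, h1, h2⟩ := exists_mul_le_integral (f := fun r => gradSq e (θ r))
      (by linarith : s < s + T) (hgi.mono_set hsub)
      (ae_restrict_of_ae_restrict_of_subset hsub hH1)
    refine ⟨t, ht, h1, ?_⟩
    rw [add_sub_cancel_left] at h2
    have h3 := hpart s (s + T) hs (by linarith) hst
    rw [le_div_iff₀ (by linarith)]
    have h4 := mul_le_mul_of_nonneg_left h2 hν.le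
    linarith
  -- Two times of moderate gradient, in the first and in the last third, hence at least `T` apart:
  -- long enough for the mixing.
  obtain ⟨t₀, ht₀, hH0, hg0⟩ := hpick a le_rfl (by rw [hb]; linarith)
  obtain ⟨t₁, ht₁, hH1', hg1⟩ := hpick (a + 2 * T) (by linarith) (by rw [hb]; linarith)
  have h01 : t₀ + T ≤ t₁ := by linarith [ht₀.2, ht₁.1]
  have h01' : t₀ ≤ t₁ := by linarith
  have ht1b : t₁ ≤ b := by rw [hb]; linarith [ht₁.2]
  have h0pos : 0 ≤ t₀ := ha.trans ht₀.1.le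
  have hmode' := hmode.mono ht₀.1.le h01' ht1b
  have hgb' := hgb t₀ t₁ h0pos ht1b
  have hsmall : ∀ g : ℝ, ν * g ≤ δ * E / (2 * T) → g ≤ E / ν := by
    intro g hg
    rw [le_div_iff₀ hν]
    have : δ * E / (2 * T) ≤ E := by
      rw [div_le_iff₀ (by linarith)]
      linarith [mul_le_mul_of_nonneg_right hδ1 hE0, mul_le_mul_of_nonneg_left hT hE0]
    linarith
  -- The `H¹` estimate between the two times, multiplied by `ν`: the initial gradient and the
  -- stretching by the flow are both controlled by the dissipation.
  have hlap : ν ^ 2 * ∫ r in t₀..t₁, lapSq e (θ r) ≤ δ * E * (1 / (4 * T) + L / 2) := by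
    have h1 := hmode'.gradSq_add_le hν hH0 hL0 hgb' ⟨h01', le_rfl⟩
    have h2 := gradSq_nonneg e (θ t₁)
    have h3 := hpart t₀ t₁ ht₀.1.le h01' ht1b
    have h4 : 2 * ν * ∫ r in t₀..t₁, lapSq e (θ r) ≤
        gradSq e (θ t₀) + 2 * L * ∫ r in t₀..t₁, gradSq e (θ r) := by linarith
    have h5 := mul_le_mul_of_nonneg_left h4 hν.le
    have h6 := mul_le_mul_of_nonneg_left h3 hL0
    have h7 : δ * E / (2 * T) = δ * E * (1 / (4 * T)) * 2 := by field_simp; norm_num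
    rw [h7] at hg0
    linarith
  obtain ⟨η, hη, hη0, -, hηd⟩ := Drift.exists_inviscid_near hmode' hν hH0 hL0 hgb'
  have hdiff : ‖θ t₁ - η t₁‖ ^ 2 ≤ E / 16 := by
    -- With `β = 384 T` the term with `1 / β` is at most `12 T E / (384 T) = E / 32`. The other term
    -- is `δ E (96 + 192 L T)`, and this is at most `E / 32` because `6144 = 32 * 192` in
    -- `decayGain`.
    have h1 := hηd t₁ ⟨h01', le_rfl⟩ (384 * T) (by linarith)
    have h2 : 384 * T * ν ^ 2 * ∫ r in t₀..t₁, lapSq e (θ r) ≤ E / 32 := by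
      have h3 := mul_le_mul_of_nonneg_left hlap (by linarith : 0 ≤ 384 * T)
      have h4 : 384 * T * (δ * E * (1 / (4 * T) + L / 2)) = δ * E * (96 + 192 * (L * T)) := by
        field_simp; ring
      have h5 : δ * (6144 * (1 + L * T)) = 1 := by
        have : 0 ≤ L * T := by positivity
        rw [hδ, decayGain]; field_simp
      have h6 : 0 ≤ δ * E := by positivity
      have h7 : δ * E * (96 + 192 * (L * T)) ≤ E / 32 := by
        have h8 : E / 32 = E / 32 * (δ * (6144 * (1 + L * T))) := by rw [h5, mul_one]
        rw [h8]; linarith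
      linarith
    have h3 : 4 * (t₁ - t₀) * ‖θ t₀‖ ^ 2 / (384 * T) ≤ E / 32 := by
      rw [div_le_iff₀ (by linarith)]
      have h4 : t₁ - t₀ ≤ 3 * T := by linarith [ht₀.1, ht₁.2]
      have h5 := hnle t₀ ⟨ht₀.1.le, h01'.trans ht1b⟩
      have h6 : (t₁ - t₀) * ‖θ t₀‖ ^ 2 ≤ 3 * T * E :=
        mul_le_mul h4 h5 (sq_nonneg _) (by linarith)
      linarith
    linarith
  have hηsol : IsSolution u 0 t₀ (Icc t₀ t₁) (θ t₀) η :=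
    (isSolution_iff hw h01' (hwI t₀ t₁ h0pos ht1b)).2 ⟨hη, hη0⟩
  have hm0 : θ t₀ ∈ L20 d := hθ.mem_L20 hθ₀ ⟨ht₀.1.le, h01'.trans ht1b⟩
  have hm1 : θ t₁ ∈ L20 d := hθ.mem_L20 hθ₀ ⟨ht₀.1.le.trans h01', ht1b⟩
  have hmixed := hmix t₀ t₁ h0pos h01' (θ t₀) hm0 η hηsol
  set G0 := √(gradSq e (θ t₀)) with hG0
  set G1 := √(gradSq e (θ t₁)) with hG1
  have hN : normHneg1 (η t₁) ≤ ENNReal.ofReal (K * ν ^ 2 * (‖θ t₀‖ + G0)) := by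
    refine hmixed.trans ?_
    rw [ENNReal.ofReal_mul (p := K * ν ^ 2) (by positivity)]
    refine mul_le_mul' (ENNReal.ofReal_le_ofReal (mul_le_mul_of_nonneg_left ?_ hK.le))
      (normH1_le hH0)
    refine le_trans (Real.exp_le_exp.2 ?_) hTν
    have h1 : T ^ p ≤ (t₁ - t₀) ^ p := Real.rpow_le_rpow (by linarith) (by linarith) hp.le
    exact div_le_div_of_nonneg_right (neg_le_neg h1) hK.le
  have hin := inner_le_of_normHneg1_le hH1' hm1
    (mul_nonneg (by positivity) (add_nonneg (norm_nonneg _) (Real.sqrt_nonneg _))) hN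
  have hG0s : G0 ^ 2 ≤ E / ν := by
    rw [hG0, Real.sq_sqrt (gradSq_nonneg _ _)]; exact hsmall _ hg0
  have hG1s : G1 ^ 2 ≤ E / ν := by
    rw [hG1, Real.sq_sqrt (gradSq_nonneg _ _)]; exact hsmall _ hg1
  have hEν : E ≤ E / ν := le_div_self hE0 hν hν1
  have hn0 : ‖θ t₀‖ ^ 2 ≤ E := hnle t₀ ⟨ht₀.1.le, h01'.trans ht1b⟩
  -- Each of the two `H¹` norms costs a factor `ν^(-1/2)`; the mixing factor `ν²` pays for both and
  -- leaves `2 K ν ≤ 1/4`.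
  have hin2 : ⟪θ t₁, η t₁⟫ ≤ E / 4 := by
    refine (le_abs_self _).trans (hin.trans ?_)
    have h1 : (‖θ t₀‖ + G0) * G1 ≤ 2 * (E / ν) :=
      add_mul_le_of_sq_le (hn0.trans hEν) hG0s hG1s
    calc K * ν ^ 2 * (‖θ t₀‖ + G0) * G1 = K * ν ^ 2 * ((‖θ t₀‖ + G0) * G1) := by ring
      _ ≤ K * ν ^ 2 * (2 * (E / ν)) := mul_le_mul_of_nonneg_left h1 (by positivity)
      _ = 2 * (K * ν) * E := by field_simp
      _ ≤ E / 4 := by linarith [mul_le_mul_of_nonneg_right hKν hE0]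
  have hin3 : ⟪θ t₁, θ t₁ - η t₁⟫ ≤ E / 4 := by
    refine (real_inner_le_norm _ _).trans ?_
    have h1 := hnle t₁ ⟨ht₀.1.le.trans h01', ht1b⟩
    linarith [two_mul_le_add_sq ‖θ t₁‖ (4 * ‖θ t₁ - η t₁‖)]
  -- Both terms are at most `E / 4`, so the norm has dropped to `E / 2` at time `t₁`, contrary to
  -- the assumption.
  have hsum : ‖θ t₁‖ ^ 2 = ⟪θ t₁, η t₁⟫ + ⟪θ t₁, θ t₁ - η t₁⟫ := by
    rw [← inner_add_right, add_sub_cancel, real_inner_self_eq_norm_sq]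
  have hfin : ‖θ b‖ ^ 2 ≤ ‖θ t₁‖ ^ 2 :=
    pow_le_pow_left₀ (norm_nonneg _) (hmode.norm_le hν (ht₀.1.le.trans h01') ht1b le_rfl) 2
  linarith [mul_le_mul_of_nonneg_right hδ1 hE0]

/-- Exponentially mixing smooth flows have a short dissipation time. -/
theorem IsFlow.dissTime_le_of_mixing (hu : IsFlow u) {L : ℝ} (hL0 : 0 ≤ L)
    (hL : ∀ᵐ t ∂(volume.restrict (Ici (0 : ℝ))), IsSmooth (u t) ∧
      ∀ y, ‖fderiv ℝ (lift (u t)) y‖ ≤ L)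
    {K p ν T : ℝ} (hK : 0 < K) (hp : 0 < p) (hmix : ExpMixing u K p) (hν : 0 < ν) (hν1 : ν ≤ 1)
    (hKν : 8 * (K * ν) ≤ 1) (hT : 1 ≤ T) (hTν : Real.exp (-(T ^ p) / K) ≤ ν ^ 2) :
    dissTime u ν ≤ ENNReal.ofReal (55296 * (1 + L) * T ^ 2) := by
  set δ := decayGain L T with hδ
  have hδ0 : 0 < δ := decayGain_pos hL0 hT
  have hδ1 : δ ≤ 1 / 6144 := decayGain_le hL0 hT
  -- At least `2 / δ` steps give `(1 - δ)^N ≤ e^(-2) ≤ 1/4` for the squared norm, so the norm is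
  -- halved. At most `3 / δ` steps of length `3T` give the constant `55296 = 3 * 6144 * 3`.
  obtain ⟨N, hN1, hN2⟩ : ∃ N : ℕ, 2 / δ ≤ N ∧ N ≤ 3 / δ := by
    refine ⟨⌈2 / δ⌉₊, Nat.le_ceil _, ?_⟩
    refine (Nat.ceil_lt_add_one (by positivity)).le.trans ?_
    rw [le_div_iff₀ hδ0, add_mul, div_mul_cancel₀ _ hδ0.ne']
    linarith
  refine iSup₂_le fun s hs => ?_
  have hs0 : (0 : ℝ) ≤ s := hs
  have h3T : 0 ≤ 3 * T := by linarith
  refine (iInf₂_le (s + N * (3 * T)) ⟨le_add_of_nonneg_right (by positivity), ?_⟩).trans ?_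
  rotate_left
  · intro θ₀ hθ₀ θ hθ
    obtain ⟨M, hM⟩ := hu.isBoundedFlow (s + N * (3 * T))
    have hMs := hM.mono (Icc_subset_Icc_left hs0 : Icc s (s + N * (3 * T)) ⊆ _)
    have hstep : ∀ n ≤ N, ‖θ (s + n * (3 * T))‖ ^ 2 ≤ (1 - δ) ^ n * ‖θ₀‖ ^ 2 := by
      intro n
      induction n with
      | zero => intro _; simp [hθ.initial]
      | succ n ih =>
        intro hn
        have h1 : (n : ℝ) + 1 ≤ N := by exact_mod_cast hn
        have h2 : s + n * (3 * T) + 3 * T ≤ s + N * (3 * T) := by nlinarith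
        have h4 : s ≤ s + n * (3 * T) := le_add_of_nonneg_right (by positivity)
        have h3 := hMs.restart hθ h4 (by linarith : s + n * (3 * T) ≤ s + n * (3 * T) + 3 * T) h2
        have h5 := hu.norm_sq_le_of_mixing hL0 hL hK hp hmix hν hν1 hKν hT hTν
          (hs0.trans h4) (hθ.mem_L20 hθ₀ ⟨h4, by linarith⟩) h3
        have h6 : s + ((n + 1 : ℕ) : ℝ) * (3 * T) = s + n * (3 * T) + 3 * T := by push_cast; ring
        rw [← hδ] at h5
        rw [h6, pow_succ (1 - δ) n]
        refine h5.trans ?_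
        have h7 := mul_le_mul_of_nonneg_left (ih (by omega)) (by linarith : 0 ≤ 1 - δ)
        linarith
    have h1 := hstep N le_rfl
    have h2 : (1 - δ) ^ N ≤ 1 / 4 := by
      have h3 : (1 - δ) ^ N ≤ Real.exp (-2) := by
        calc (1 - δ) ^ N ≤ Real.exp (-δ) ^ N :=
              pow_le_pow_left₀ (by linarith) (Real.one_sub_le_exp_neg δ) N
          _ = Real.exp (-(δ * N)) := by rw [← Real.exp_nat_mul]; congr 1; ring
          _ ≤ _ := by
            refine Real.exp_le_exp.2 (neg_le_neg ?_)
            rw [div_le_iff₀ hδ0] at hN1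
            linarith
      have h4 : (4 : ℝ) ≤ Real.exp 2 := by
        have := Real.add_one_le_exp (1 : ℝ)
        have h5 : Real.exp 2 = Real.exp 1 * Real.exp 1 := by rw [← Real.exp_add]; norm_num
        rw [h5]; nlinarith
      rw [Real.exp_neg] at h3
      refine h3.trans ?_
      rw [one_div]
      exact inv_anti₀ (by norm_num) h4
    have h5 : ‖θ (s + N * (3 * T))‖ ^ 2 ≤ (1 / 2 * ‖θ₀‖) ^ 2 := by
      refine h1.trans ?_
      nlinarith [sq_nonneg ‖θ₀‖]
    exact (pow_le_pow_iff_left₀ (norm_nonneg _) (by positivity) two_ne_zero).1 h5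
  · refine ENNReal.ofReal_le_ofReal ?_
    rw [add_sub_cancel_left]
    have h1 : 3 / δ = 18432 * (1 + L * T) := by
      have : 0 ≤ L * T := by positivity
      rw [hδ, decayGain]; field_simp; norm_num
    rw [h1] at hN2
    have h2 : 1 + L * T ≤ (1 + L) * T := by linarith
    calc N * (3 * T) ≤ 18432 * ((1 + L) * T) * (3 * T) :=
          mul_le_mul_of_nonneg_right (hN2.trans (by linarith)) h3T
      _ = 55296 * (1 + L) * T ^ 2 := by ring

end

/-! ### Mixing flows -/

section

variable {d : ℕ} {u : ℝ → Torus d → Vec d}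

theorem LinftySmooth.exists_fderiv_le (h : LinftySmooth (Ici 0) u) : ∃ L : ℝ, 0 ≤ L ∧
    ∀ᵐ t ∂(volume.restrict (Ici (0 : ℝ))), IsSmooth (u t) ∧
      ∀ y, ‖fderiv ℝ (lift (u t)) y‖ ≤ L := by
  obtain ⟨L, hL⟩ := h.2 1
  refine ⟨max L 0, le_max_right _ _, ?_⟩
  filter_upwards [h.1, hL] with t h1 h2
  refine ⟨h1, fun y => ?_⟩
  have := h2 y
  rw [norm_iteratedFDeriv_one] at this
  exact this.trans (le_max_left _ _)

/-- The dissipation time of a mixing flow grows at most like a power of the logarithm. -/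
theorem IsFlow.exists_dissTime_le_log (hu : IsFlow u) (hs : LinftySmooth (Ici 0) u) {K p : ℝ}
    (hK : 0 < K) (hp : 0 < p) (hmix : ExpMixing u K p) :
    ∃ C : ℝ, 0 < C ∧ ∃ ν₀ : ℝ, 0 < ν₀ ∧ ∀ ν : ℝ, 0 < ν → ν < ν₀ →
      dissTime u ν ≤ ENNReal.ofReal (C * (-Real.log ν) ^ (2 / p)) := by
  obtain ⟨L, hL0, hL⟩ := hs.exists_fderiv_le
  -- The three thresholds for `ν` ensure in turn `ν ≤ 1`, `8 K ν ≤ 1` and `T ≥ 1`.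
  refine ⟨55296 * (1 + L) * (2 * K) ^ (2 / p), by positivity,
    min 1 (min (1 / (8 * K)) (Real.exp (-(1 / (2 * K))))), by positivity, fun ν hν hν0 => ?_⟩
  obtain ⟨h1, h2⟩ := lt_min_iff.1 hν0
  obtain ⟨h2, h3⟩ := lt_min_iff.1 h2
  rw [lt_div_iff₀ (by positivity)] at h2
  have hlog : 1 ≤ 2 * K * -Real.log ν := by
    have h4 := (Real.log_lt_iff_lt_exp hν).2 h3
    have h5 : 1 / (2 * K) < -Real.log ν := by linarith
    rw [div_lt_iff₀ (by positivity)] at h5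
    linarith
  have hlog0 : 0 < -Real.log ν := pos_of_mul_pos_right (by linarith) (by positivity : 0 ≤ 2 * K)
  -- The mixing time after which the exponential factor equals `ν²`.
  set T := (2 * K * -Real.log ν) ^ (1 / p) with hT
  have hTp : T ^ p = 2 * K * -Real.log ν := by
    rw [hT, ← Real.rpow_mul (by linarith), one_div_mul_cancel hp.ne', Real.rpow_one]
  have hT1 : 1 ≤ T := Real.one_le_rpow hlog (by positivity)
  have hexp : Real.exp (-(T ^ p) / K) ≤ ν ^ 2 := by
    have h4 : -(T ^ p) / K = Real.log ν + Real.log ν := by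
      rw [hTp]; field_simp; ring
    rw [h4, Real.exp_add, Real.exp_log hν, sq]
  refine (hu.dissTime_le_of_mixing hL0 hL hK hp hmix hν h1.le (by linarith) hT1 hexp).trans ?_
  refine ENNReal.ofReal_le_ofReal (le_of_eq ?_)
  have h5 : T ^ 2 = (2 * K) ^ (2 / p) * (-Real.log ν) ^ (2 / p) := by
    rw [← Real.mul_rpow (by positivity) hlog0.le, hT, ← Real.rpow_natCast,
      ← Real.rpow_mul (by linarith)]
    congr 1
    push_cast; ring
  rw [h5]; ring

theorem lift_smul (c : ℝ) (g : Torus d → Vec d) : lift (fun x => c • g x) = c • lift g := rfl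

/-- A bounded weight preserves uniform smoothness of an accelerated flow. -/
theorem LinftySmooth.accel {σ : ℝ → ℝ} (h : LinftySmooth (Ici 0) u) (hσ : IsTimeChange σ)
    {c : ℝ → ℝ} {C : ℝ} (hc0 : ∀ t ∈ Ico (0 : ℝ) 1, 0 ≤ c t)
    (hc : ∀ t ∈ Ico (0 : ℝ) 1, c t * derivWithin σ (Ico 0 1) t ≤ C) :
    LinftySmooth (Ico 0 1) (fun t x => c t • accel u σ t x) := by
  have heq : ∀ t, (fun x => c t • AcceleratedFlow.accel u σ t x) =
      fun x => (c t * derivWithin σ (Ico 0 1) t) • u (σ t) x := fun t =>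
    funext fun x => by rw [AcceleratedFlow.accel, mul_smul]
  refine ⟨?_, fun k => ?_⟩
  · filter_upwards [hσ.ae_comp h.1] with t ht
    rw [heq]
    exact ContDiff.const_smul _ ht
  · obtain ⟨M, hM⟩ := h.2 k
    refine ⟨C * M, ?_⟩
    filter_upwards [hσ.ae_comp h.1, hσ.ae_comp hM, ae_restrict_mem measurableSet_Ico]
      with t h1 h2 ht y
    have h3 : ContDiff ℝ ((⊤ : ℕ∞) : WithTop ℕ∞) (lift (u (σ t))) := h1
    have h4 : ContDiffAt ℝ (k : WithTop ℕ∞) (lift (u (σ t))) y :=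
      (h3.of_le (by exact_mod_cast le_top)).contDiffAt
    have h5 : 0 ≤ c t * derivWithin σ (Ico 0 1) t :=
      mul_nonneg (hc0 t ht) (hσ.deriv_pos t ht).le
    rw [heq, lift_smul, iteratedFDeriv_const_smul_apply h4, norm_smul, Real.norm_of_nonneg h5]
    exact mul_le_mul (hc t ht) (h2 y) (norm_nonneg _) (h5.trans (hc t ht))

/-- It compares the rate, a power of `n + 1`, with the weight of the theorem, where `1` is added
outside the power. Bounding `n + 1` by `2 n` requires `n ≥ 1`, so `n = 0` is separate. -/
theorem add_one_rpow_le {q : ℝ} (hq : 0 ≤ q) (n : ℕ) :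
    ((n : ℝ) + 1) ^ q ≤ 2 ^ q * ((n : ℝ) ^ q + 1) := by
  have h2 : (0 : ℝ) < 2 ^ q := by positivity
  rcases Nat.eq_zero_or_pos n with rfl | hn
  · have h3 : (1 : ℝ) ≤ 2 ^ q := Real.one_le_rpow (by norm_num) hq
    have h4 : (0 : ℝ) ≤ 0 ^ q := Real.rpow_nonneg le_rfl q
    simp only [Nat.cast_zero, zero_add, Real.one_rpow]
    nlinarith
  · have h1 : (1 : ℝ) ≤ n := by exact_mod_cast hn
    have h3 : ((n : ℝ) + 1) ^ q ≤ (2 * n) ^ q :=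
      Real.rpow_le_rpow (by positivity) (by linarith) hq
    rw [Real.mul_rpow (by norm_num) (by positivity)] at h3
    linarith

/-- The dyadic rates for mixing flows outgrow the dissipation time. -/
theorem eventually_log_rpow_lt {C ν₀ ν p : ℝ} (hC : 0 < C) (hν₀ : 0 < ν₀) (hp : 0 < p)
    (hν : 0 < ν) {l : ℕ → ℝ} (hl : ∀ n : ℕ, l n = 2 ^ n * ((n : ℝ) + 1) ^ (2 + 2 / p)) :
    ∀ᶠ n in atTop, ν / l n < ν₀ ∧
      C * (-Real.log (ν / l n)) ^ (2 / p) < l n * (1 / 2) ^ (n + 2) := by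
  set q := 2 + 2 / p with hq
  have hq0 : 0 < q := by positivity
  set A := 1 + q + |Real.log ν| with hA
  have hA0 : 0 < A := by positivity
  -- The three conditions make the rescaled diffusivity smaller than `ν₀`, make it at most `1` so
  -- that its logarithm has a sign, and let the surplus factor `(n+1)² / 4` of the available time
  -- beat the constant `C A^(2/p)`.
  obtain ⟨N, hN⟩ := exists_nat_gt (max (ν / ν₀) (max ν (4 * C * A ^ (2 / p))))
  filter_upwards [eventually_ge_atTop N] with n hn
  have hnN : (N : ℝ) ≤ n := by exact_mod_cast hn
  have hN' := hN.trans_le hnN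
  obtain ⟨h1, h2⟩ := max_lt_iff.1 hN'
  obtain ⟨h2, h3⟩ := max_lt_iff.1 h2
  have hn0 : (0 : ℝ) ≤ n := Nat.cast_nonneg n
  have hn1 : (0 : ℝ) < (n : ℝ) + 1 := by linarith
  have hr1 : (1 : ℝ) ≤ ((n : ℝ) + 1) ^ q := Real.one_le_rpow (by linarith) hq0.le
  have hl2 : (2 : ℝ) ^ n ≤ l n := by
    rw [hl]; exact le_mul_of_one_le_right (by positivity) hr1
  have hln : (n : ℝ) < l n := by
    have : (n : ℝ) < 2 ^ n := by exact_mod_cast Nat.lt_two_pow_self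
    linarith
  have hl0 : 0 < l n := by linarith
  have hlog : -Real.log (ν / l n) = n * Real.log 2 + q * Real.log (n + 1) - Real.log ν := by
    rw [Real.log_div hν.ne' hl0.ne', hl, Real.log_mul (by positivity) (by positivity),
      Real.log_pow, Real.log_rpow hn1]
    ring
  -- As `l n` is exponential up to a power, the logarithm of the rescaled diffusivity grows linearly
  -- in `n`; `A` collects the constants for fixed `ν`.
  have hlog1 : -Real.log (ν / l n) ≤ A * (n + 1) := by
    rw [hlog, hA]
    have e1 : Real.log 2 ≤ 1 := by
      have := Real.log_le_sub_one_of_pos (show (0 : ℝ) < 2 by norm_num)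
      linarith
    have e2 : Real.log ((n : ℝ) + 1) ≤ n + 1 := by
      have := Real.log_le_sub_one_of_pos hn1
      linarith
    have e3 := neg_abs_le (Real.log ν)
    have e4 := abs_nonneg (Real.log ν)
    have e5 := mul_le_mul_of_nonneg_left e1 hn0
    have e6 := mul_le_mul_of_nonneg_left e2 hq0.le
    have e7 := mul_nonneg e4 hn0
    linarith
  have hlog0 : 0 ≤ -Real.log (ν / l n) := by
    have : ν / l n ≤ 1 := by rw [div_le_one hl0]; linarith
    have := Real.log_nonpos (div_pos hν hl0).le this
    linarith
  refine ⟨?_, ?_⟩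
  · rw [div_lt_iff₀ hν₀] at h1
    rw [div_lt_iff₀ hl0]
    nlinarith
  · have h4 : l n * (1 / 2) ^ (n + 2) = ((n : ℝ) + 1) ^ (2 / p) * ((n + 1) ^ 2 / 4) := by
      have h5 : (2 : ℝ) ^ n * (1 / 2) ^ (n + 2) = 1 / 4 := by
        rw [pow_add, ← mul_assoc, ← mul_pow]; norm_num
      have h6 : ((n : ℝ) + 1) ^ q = (n + 1) ^ 2 * ((n : ℝ) + 1) ^ (2 / p) := by
        rw [hq, Real.rpow_add hn1]
        norm_cast
      rw [hl, h6]
      linear_combination ((n + 1) ^ 2 * ((n : ℝ) + 1) ^ (2 / p)) * h5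
    rw [h4]
    calc C * (-Real.log (ν / l n)) ^ (2 / p) ≤ C * (A * (n + 1)) ^ (2 / p) :=
          mul_le_mul_of_nonneg_left (Real.rpow_le_rpow hlog0 hlog1 (by positivity)) hC.le
      _ = ((n : ℝ) + 1) ^ (2 / p) * (C * A ^ (2 / p)) := by
          rw [Real.mul_rpow hA0.le hn1.le]; ring
      _ < _ := by
          refine mul_lt_mul_of_pos_left ?_ (Real.rpow_pos_of_pos hn1 _)
          nlinarith

/-- Total diffusion with the rate of acceleration for mixing flows. -/
theorem exists_isTimeChange_of_expMixing (hu : IsFlow u) {K p : ℝ} (hK : 0 < K) (hp : 0 < p)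
    (hs : LinftySmooth (Ici 0) u) (hmix : ExpMixing u K p) :
    ∃ σ : ℝ → ℝ, IsTimeChange σ ∧ TotallyDiffusive (accel u σ) ∧
      ∀ t ∈ Ico (0 : ℝ) 1, (1 - t) / (absLog t ^ (2 + 2 / p) + 1) *
        derivWithin σ (Ico 0 1) t ≤ 2 ^ (2 + 2 / p) := by
  set q := 2 + 2 / p with hq
  have hq0 : 0 < q := by positivity
  set l : ℕ → ℝ := fun n => 2 ^ n * ((n : ℝ) + 1) ^ q with hl
  have hlpos : ∀ n, 0 < l n := fun n => by positivity
  have hlmono : Monotone l := by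
    refine monotone_nat_of_le_succ fun n => ?_
    refine mul_le_mul (pow_le_pow_right₀ (by norm_num) n.le_succ) ?_ (by positivity) (by positivity)
    refine Real.rpow_le_rpow (by positivity) ?_ hq0.le
    push_cast; linarith
  have hlow : ∀ n : ℕ, (1 : ℝ) * 2 ^ n ≤ l n := by
    intro n
    rw [one_mul]
    exact le_mul_of_one_le_right (by positivity) (Real.one_le_rpow
      (by linarith [(Nat.cast_nonneg n : (0 : ℝ) ≤ n)]) hq0.le)
  obtain ⟨σ, hσ, hσle, hσeq, hσlin⟩ := exists_isTimeChange hlmono (hlpos 0) one_pos hlow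
  refine ⟨σ, hσ, totallyDiffusive_accel hu hσ hlpos hσeq hσlin fun ν hν => ?_, fun t ht => ?_⟩
  · obtain ⟨C, hC, ν₀, hν₀, h⟩ := hu.exists_dissTime_le_log hs hK hp hmix
    filter_upwards [eventually_log_rpow_lt hC hν₀ hp hν (l := l) fun n => rfl] with n hn
    refine (h _ (div_pos hν (hlpos n)) hn.1).trans_lt ?_
    exact (ENNReal.ofReal_lt_ofReal_iff (mul_pos (hlpos n) (by positivity))).2 hn.2
  · obtain ⟨n, hn⟩ := exists_mem_Ico_dyad ht
    have hI : dyad n ∈ Ico (0 : ℝ) 1 := ⟨dyad_nonneg n, dyad_lt_one n⟩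
    have h2 := absLog_monotoneOn hI ht hn.1
    rw [absLog_dyad] at h2
    have h3 : (n : ℝ) ^ q ≤ absLog t ^ q := Real.rpow_le_rpow (Nat.cast_nonneg n) h2 hq0.le
    have h4 : 1 - t ≤ (1 / 2) ^ n := by
      have := hn.1
      unfold dyad at this
      linarith
    have hnq : 0 < (n : ℝ) ^ q + 1 := by positivity
    -- On the dyadic interval the weight is at most its value at the left end; the powers of `2`
    -- cancel, and the quotient of the powers of `n` is at most `2^q`.
    calc (1 - t) / (absLog t ^ q + 1) * derivWithin σ (Ico 0 1) t
        ≤ (1 / 2) ^ n / ((n : ℝ) ^ q + 1) * l n :=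
          mul_le_mul (div_le_div₀ (by positivity) h4 hnq (by linarith)) (hσle n t ⟨hn.1, hn.2.le⟩)
            (hσ.deriv_pos t ht).le (by positivity)
      _ = ((1 / 2) ^ n * 2 ^ n) * (((n : ℝ) + 1) ^ q / ((n : ℝ) ^ q + 1)) := by rw [hl]; ring
      _ = ((n : ℝ) + 1) ^ q / ((n : ℝ) ^ q + 1) := by
          rw [← mul_pow]; norm_num
      _ ≤ 2 ^ q := by
          rw [div_le_iff₀ hnq]; exact add_one_rpow_le hq0.le n

end

end AcceleratedFlow

theorem theorem2 (d : ℕ) (hd : 1 ≤ d) (u : ℝ → Torus d → Vec d)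
    (hu : IsFlow u) :
    (∀ (X : Type*) [NormedAddCommGroup X] [NormedSpace ℝ X] [CompleteSpace X]
      (ι : X →ₗ[ℝ] (Torus d →ₘ[(volume : Measure (Torus d))] Vec d)),
      Function.Injective ι →
      RelaxationEnhancing u →
      (∀ t ∈ Ico (0 : ℝ) 1,
        0 < relaxInv u ((1 - t) / (4 * (absLog t + 1))) ∧
        relaxInv u ((1 - t) / (4 * (absLog t + 1))) < ∞) ∧
      ∃ σ : ℝ → ℝ, IsTimeChange σ ∧
        TotallyDiffusive (accel u σ) ∧
        linftyNorm ι (Ico 0 1)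
          (fun t x =>
            ((relaxInv u
                ((1 - t) / (4 * (absLog t + 1)))).toReal /
              (2 * (absLog t + 1))) • accel u σ t x)
          ≤ linftyNorm ι (Ici 0) u) ∧
    (∀ K p : ℝ, 0 < K → 0 < p →
      LinftySmooth (Ici 0) u → ExpMixing u K p →
      ∃ σ : ℝ → ℝ, IsTimeChange σ ∧
        TotallyDiffusive (accel u σ) ∧
        LinftySmooth (Ico 0 1)
          (fun t x =>
            ((1 - t) / (absLog t ^ (2 + 2 / p) + 1)) •
              accel u σ t x)) := by
  refine ⟨?_, ?_⟩
  · intro X _ _ _ ι _ hre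
    refine ⟨fun t ht => ⟨hre.relaxInv_pos (rateArg_pos ht.2), hu.relaxInv_lt_top hd ht⟩, ?_⟩
    obtain ⟨σ, hσ, htot, hle⟩ := exists_isTimeChange_of_relaxationEnhancing hd hu hre
    refine ⟨σ, hσ, htot, linftyNorm_accel_le ι hσ (aemeasurable_rate hd hu) (fun t _ => ?_) hle⟩
    have := absLog_nonneg t
    exact div_nonneg ENNReal.toReal_nonneg (by linarith)
  · intro K p hK hp hs hmix
    obtain ⟨σ, hσ, htot, hle⟩ := exists_isTimeChange_of_expMixing hu hK hp hs hmix
    refine ⟨σ, hσ, htot, hs.accel hσ (fun t ht => ?_) hle⟩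
    have := absLog_nonneg t
    have := ht.2
    exact div_nonneg (by linarith) (by positivity)
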